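/- Consider the synchronous CONGEST model. The network is a connected undirected graph $G=(V,E)$ with $n$ nodes and hop-diameter $D$, and one distinguished node $s$, the source. Each node has a unique identifier of $O(\log n)$ bits. For every edge $\{u,v\}\in E$, each of the two directions $u\to v$ and $v\to u$ carries an integer weight in $[1,\mathrm{poly}(n)]$; the two weights may differ. Communication is possible in both directions of every edge. Initially, each node knows only its own identifier, whether it is $s$, the identifiers of its neighbours, and the weights of its incident edges in both directions. In each round, each node may send a message of $O(\log n)$ bits (possibly a different one) to each of its neighbours. Local computation is unrestricted and may use private randomness. Let $d(s,t)$ denote the minimum, over all paths from $s$ to $t$, of the sum of the weights of the edges of the path in the direction of travel. Theorem. There is a randomized distributed algorithm that computes the exact distances from $s$ to all nodes in $\tilde O(n^{3/4}D^{1/4})$ rounds with high probability. Precisely: there is a constant $k$ such that for all constants $a,b$ (weights at most $n^a$, identifiers at most $n^b$) there is a constant $B$ such that for every constant $c$ there are a randomized algorithm and a constant $C$ with the following property. On every such network, the algorithm never sends more than $B\lceil\log_2 n\rceil$ bits over an edge in one direction in one round, and with probability at least $1-n^{-c}$, within at most $C\,n^{3/4}D^{1/4}(\log n)^k$ rounds,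 every node $t$ has halted with the output $d(s,t)$. -/

import Mathlib

open scoped ENNReal

namespace Congest

/-! ### Independent products of discrete distributions -/

theorem tsum_prod_fin {α : Type} (n : ℕ) (p : Fin n → α → ℝ≥0∞) :
    ∑' f : Fin n → α, ∏ i, p i (f i) = ∏ i, ∑' a, p i a := by
  induction n with
  | zero => simp
  | succ n ih =>
    rw [← (Fin.consEquiv fun _ : Fin (n + 1) => α).tsum_eq, ENNReal.tsum_prod', Fin.prod_univ_succ]
    simp only [Fin.consEquiv, Equiv.coe_fn_mk, Fin.prod_univ_succ, Fin.cons_zero, Fin.cons_succ,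
      ENNReal.tsum_mul_left, ih fun i => p i.succ, ENNReal.tsum_mul_right]

theorem tsum_prod_fintype {ι α : Type} [Fintype ι] (p : ι → α → ℝ≥0∞) :
    ∑' f : ι → α, ∏ i, p i (f i) = ∏ i, ∑' a, p i a := by
  let e := Fintype.equivFin ι
  rw [← (e.symm.arrowCongr (Equiv.refl α)).tsum_eq, ← e.symm.prod_comp,
    ← tsum_prod_fin _ fun i => p (e.symm i)]
  refine tsum_congr fun f => ?_
  rw [← e.symm.prod_comp]
  simp [Equiv.arrowCongr]

/-- The joint law of independent random variables, the `i`-th of which has law `p i`. -/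
noncomputable def indep {ι α : Type} [Fintype ι] (p : ι → PMF α) : PMF (ι → α) :=
  ⟨fun f => ∏ i, p i (f i), by
    rw [← show ∑' f : ι → α, ∏ i, p i (f i) = 1 by
      rw [tsum_prod_fintype]; simp [PMF.tsum_coe]]
    exact ENNReal.summable.hasSum⟩

/-! ### Weighted networks -/

/-- An instance of the single-source shortest path problem on a network. The vertices of the
network are the elements of a finite set of natural numbers, which serve as their unique
identifiers. The communication graph is undirected. For adjacent `u` and `v`, `weight u v` is the
weight of the link `u → v`, which may differ from `weight v u`. -/
structure Network where
  ids : Finset ℕ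
  graph : SimpleGraph ids
  weight : ids → ids → ℕ
  source : ids

namespace Network

variable (N : Network)

/-- The number of vertices. -/
def size : ℕ := N.ids.card

/-- The hop-diameter. -/
noncomputable def hopDiam : ℕ := N.graph.diam

/-- The length of a walk: the sum of the weights of its edges, in the direction of travel. -/
def walkLength {u v : N.ids} (p : N.graph.Walk u v) : ℕ :=
  (p.darts.map fun d => N.weight d.fst d.snd).sum

/-- The weighted distance `d(u, v)`: the least length of a walk from `u` to `v`. -/
noncomputable def distance (u v : N.ids) : ℕ :=
  sInf (Set.range fun p : N.graph.Walk u v => N.walkLength p)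

open Classical in
/-- The table that a vertex `v` has of a quantity `f u` for each of its neighbours `u`: it is
indexed by the identifiers of the neighbours, and has the value `default` elsewhere. -/
noncomputable def table {β : Type} [Inhabited β] (v : N.ids) (f : N.ids → β) : ℕ → β :=
  fun i => if h : ∃ hi : i ∈ N.ids, N.graph.Adj v ⟨i, hi⟩ then f ⟨i, h.fst⟩ else default

/-- The network is connected, every edge weight (in either direction) is an integer in
`[1, n ^ a]`, and every identifier is at most `n ^ b`, where `n` is the number of vertices. -/
structure Valid (a b : ℕ) : Prop where
  connected : N.graph.Connected
  one_le_weight : ∀ u v, N.graph.Adj u v → 1 ≤ N.weight u v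
  weight_le : ∀ u v, N.graph.Adj u v → N.weight u v ≤ N.size ^ a
  id_le : ∀ i ∈ N.ids, i ≤ N.size ^ b

end Network

/-- What a vertex knows at the beginning: its own identifier, whether it is the source, the
identifiers of its neighbours, and the weights of the links to and from each neighbour. In
particular it does not know the number of vertices, the diameter, or the largest weight. -/
structure LocalInput where
  id : ℕ
  isSource : Bool
  neighbors : Finset ℕ
  weightTo : ℕ → ℕ
  weightFrom : ℕ → ℕ

open Classical in
/-- The initial knowledge of the vertex `v` of the network `N`. -/
noncomputable def Network.localInput (N : Network) (v : N.ids) : LocalInput where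
  id := v
  isSource := decide (v = N.source)
  neighbors := N.ids.filter fun i => ∃ hi : i ∈ N.ids, N.graph.Adj v ⟨i, hi⟩
  weightTo := N.table v fun u => N.weight v u
  weightFrom := N.table v fun u => N.weight u v

/-! ### Randomized distributed algorithms -/

/-- A randomized distributed algorithm, run by every vertex. Local computation is unrestricted
and may use private randomness. Once `output` of the current state is `some x`, the vertex has
halted with the irrevocable output `x`. -/
structure Algorithm where
  /-- local states of a vertex -/
  State : Type
  /-- the (random) initial state -/
  init : LocalInput → PMF State
  /-- `send σ i` is the bit string sent to the neighbour with identifier `i` -/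
  send : State → ℕ → List Bool
  /-- the (random) new state, given the old one and the message received from each neighbour -/
  step : State → (ℕ → List Bool) → PMF State
  /-- the output, if the vertex has halted -/
  output : State → Option ℕ

namespace Algorithm

variable (A : Algorithm) (N : Network)

/-- The message that `u` sends to its neighbour `v`, when in state `σ`. A halted vertex is
silent. -/
def message (σ : A.State) (v : N.ids) : List Bool :=
  if (A.output σ).isSome then [] else A.send σ v

/-- The messages received by `v` in a round, indexed by the identifiers of the senders, where
`σ` gives the states of all vertices at the beginning of the round. -/
noncomputable def inbox (σ : N.ids → A.State) (v : N.ids) : ℕ → List Bool :=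
  N.table v fun u => A.message N (σ u) v

/-- The law of the next state of the vertex `v`. A halted vertex does not change its state. -/
noncomputable def next (σ : N.ids → A.State) (v : N.ids) : PMF A.State :=
  if (A.output (σ v)).isSome then PMF.pure (σ v) else A.step (σ v) (A.inbox N σ v)

/-- The joint law of the states of all vertices after `r` synchronous rounds. The random choices
of distinct vertices, and those of distinct rounds, are independent. -/
noncomputable def run : ℕ → PMF (N.ids → A.State)
  | 0 => indep fun v => A.init (N.localInput v)
  | r + 1 => (run r).bind fun σ => indep (A.next N σ)

/-- On the network `N`, no execution of the algorithm ever sends a message of more than `L` bits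
over an edge in one direction in one round. -/
def BandwidthAtMost (L : ℕ) : Prop :=
  ∀ r, ∀ σ ∈ (A.run N r).support, ∀ u v, N.graph.Adj u v → (A.message N (σ u) v).length ≤ L

/-- The probability that after `r` rounds every vertex `t` has halted with output `d(s, t)`. -/
noncomputable def successProb (r : ℕ) : ℝ≥0∞ :=
  (A.run N r).toOuterMeasure {σ | ∀ t, A.output (σ t) = some (N.distance N.source t)}

end Algorithm

end Congest

/-! The proof scales with potentials. A potential φ that vanishes at the source `s` and rises along
each link by at most its weight satisfies φ ≤ d(s,·), and the reduced weights w + φ(u) − φ(v) are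
nonnegative. One iteration computes levels ℓ that rise along each link by at most 8 times its
reduced weight, and yet are at least the reduced distance from `s`. Then φ + ⌈ℓ/8⌉ is again such a
potential, and the gap d − φ has shrunk by the factor 7/8 (`LevelInv.last`). The gap is an integer,
initially at most 2^I, so it vanishes after 8(I+1) iterations (`LevelInv.eq_distance`).

The levels come from a layering of width 2^I whose width is halved I times: a vertex of layer ℓ goes
to 2ℓ − 1 if it is near to a lower layer, and to 2ℓ otherwise. Nearness need only be decided up to a
factor 1 + 1/(2I). Walks of length at most 2^(I−i)(1 − i/(2I)) rise by at most one layer after i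
steps; the second factor of this radius decreases just enough per step to absorb the error, and
never falls below 1/2 (`Layered.refine`). A last test, for distance zero, repairs the links of
reduced weight 0 (`Layered.final`).

To decide nearness, a short walk from a lower layer is cut where it last enters the layer of its end
(`Path.exists_enter`), so that all layers can be searched simultaneously. About n^(1/4) vertices are
sampled; with high probability they hit every run of h, about n^(3/4) up to logarithms, consecutive
predecessors on an optimal walk (`coins_hits_le`), so walks with at most h edges between sampled
vertices suffice. Their lengths are approximated by rounding the weights at every binary scale,
which makes the rounded lengths O(A + h) with A = 2Ih; a pipelined search needs as many rounds as
the length bound plus the number of labels (`pipe_est_le`). The approximate distances at sampled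
vertices, about n^(1/2) values up to logarithms, are flooded by the same pipeline, and every vertex
finishes locally (`overlay_sound`, `overlay_complete`).

A phase therefore takes n^(3/4) + E rounds up to logarithms, E being the eccentricity of the source,
and E ≤ n^(3/4) D^(1/4) because E ≤ n and E ≤ D. A breadth-first exploration supplies n and E
beforehand, so that all vertices work in lockstep. Each sample is drawn after the potentials and
levels it serves are fixed; a union bound over the samples controls the failure probability. -/

namespace Congest

/-! ### Independent random choices -/

section Probability

variable {ι α β : Type} [Fintype ι]

theorem indep_apply (p : ι → PMF α) (f : ι → α) : indep p f = ∏ i, p i (f i) := rfl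

/-- Factorization of expectations is the form in which independence enters both tail bounds below.
-/
theorem tsum_indep_mul (p : ι → PMF α) (g : ι → α → ℝ≥0∞) :
    ∑' f : ι → α, indep p f * ∏ i, g i (f i) = ∏ i, ∑' a, p i a * g i a := by
  rw [← tsum_prod_fintype fun i a => p i a * g i a]
  simp only [indep_apply, Finset.prod_mul_distrib]

open Classical in
theorem indep_map (p : ι → PMF α) (g : ι → α → β) :
    indep (fun i => (p i).map (g i)) = (indep p).map fun ω i => g i (ω i) := by
  ext f
  rw [PMF.map_apply, indep_apply]
  simp only [PMF.map_apply]
  rw [← tsum_prod_fintype fun i a => if f i = g i a then p i a else 0]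
  refine tsum_congr fun ω => ?_
  rw [Finset.prod_ite_zero]
  simp only [funext_iff, Finset.mem_univ, true_implies, indep_apply]

theorem mem_support_indep {p : ι → PMF α} {f : ι → α} :
    f ∈ (indep p).support ↔ ∀ i, f i ∈ (p i).support := by
  simp [PMF.mem_support_iff, indep_apply, Finset.prod_ne_zero_iff]

theorem toOuterMeasure_le_tsum (p : PMF α) (s : Set α) (X : α → ℝ≥0∞) (h : ∀ a ∈ s, 1 ≤ X a) :
    p.toOuterMeasure s ≤ ∑' a, p a * X a := by
  rw [PMF.toOuterMeasure_apply]
  refine ENNReal.tsum_le_tsum fun a => ?_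
  by_cases ha : a ∈ s
  · rw [Set.indicator_of_mem ha]
    simpa using mul_le_mul_right (h a ha) (p a)
  · simp [Set.indicator_of_notMem ha]

/-- A biased coin. -/
noncomputable def coin (p : NNReal) : PMF Bool :=
  PMF.ofFintype (fun b => cond b (min p 1 : ℝ≥0∞) (1 - min p 1)) (by
    simp [add_tsub_cancel_of_le])

theorem coin_true (p : NNReal) (hp : p ≤ 1) : coin p true = p := by
  simpa [coin] using hp

theorem coin_false (p : NNReal) (hp : p ≤ 1) : coin p false = 1 - p := by
  have : (p : ℝ≥0∞) ≤ 1 := by exact_mod_cast hp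
  simp [coin, min_eq_left this]

/-- The indicator of the event is a product over the vertices, with trivial factors off `W`, so its
expectation factors. -/
theorem coins_miss_le (p : NNReal) (hp : p ≤ 1) (W : Finset ι) :
    (indep fun _ : ι => coin p).toOuterMeasure {ω | ∀ v ∈ W, ω v = false} ≤
      (1 - (p : ℝ≥0∞)) ^ W.card := by
  classical
  refine (toOuterMeasure_le_tsum _ _
    (fun ω => ∏ v, if v ∈ W then (if ω v = false then 1 else 0) else 1) ?_).trans ?_
  · intro ω hω
    rw [Finset.prod_eq_one]
    intro v _
    by_cases hv : v ∈ W <;> simp [hv]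
    simpa using hω v hv
  · rw [tsum_indep_mul (fun _ : ι => coin p)
      (fun v b => if v ∈ W then (if b = false then 1 else 0) else 1)]
    rw [← Finset.prod_const, ← Finset.prod_subset (Finset.subset_univ W)]
    · refine Finset.prod_le_prod' fun v hv => ?_
      simp [hv, coin_false p hp]
    · intro v _ hv
      simp only [hv, if_false, mul_one]
      exact PMF.tsum_coe _

/-- Markov's inequality for 2^X, where X is the number of successes; its expectation is (1 + p)^n.
-/
theorem coins_many_le (p : NNReal) (hp : p ≤ 1) (m : ℕ) :
    (indep fun _ : ι => coin p).toOuterMeasure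
      {ω | m < (Finset.univ.filter fun v => ω v = true).card} ≤
      (1 + (p : ℝ≥0∞)) ^ Fintype.card ι / 2 ^ m := by
  classical
  refine (toOuterMeasure_le_tsum _ _
    (fun ω => (∏ v, if ω v = true then 2 else 1) * (2 ^ m)⁻¹) ?_).trans ?_
  · intro ω hω
    rw [Finset.prod_ite, Finset.prod_const_one, mul_one, Finset.prod_const, ← div_eq_mul_inv]
    rw [ENNReal.le_div_iff_mul_le (Or.inl (by simp)) (Or.inl (by simp)), one_mul]
    exact pow_le_pow_right₀ (by norm_num) (le_of_lt hω)
  · simp only [← mul_assoc]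
    rw [ENNReal.tsum_mul_right, tsum_indep_mul (fun _ : ι => coin p)
      (fun v b => if b = true then 2 else 1), div_eq_mul_inv]
    refine mul_le_mul_left (le_of_eq ?_) _
    simp only [tsum_bool, coin_true p hp, coin_false p hp]
    rw [Finset.prod_const, Finset.card_univ]
    congr 1
    simp only [Bool.false_eq_true, if_false, if_true, mul_one, mul_two]
    rw [← add_assoc, tsub_add_cancel_of_le (by exact_mod_cast hp)]

end Probability

/-! ### Invariants of a run -/

namespace Algorithm

variable {A : Algorithm} {N : Network}

/-- After `r` rounds, the global state is in `G`, except with probability at most `ε`. -/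
def Holds (A : Algorithm) (N : Network) (r : ℕ) (G : Set (N.ids → A.State)) (ε : ℝ≥0∞) : Prop :=
  (A.run N r).toOuterMeasure Gᶜ ≤ ε

theorem Holds.mono {r : ℕ} {G G' : Set (N.ids → A.State)} {ε ε' : ℝ≥0∞} (h : A.Holds N r G ε)
    (hG : G ⊆ G') (hε : ε ≤ ε') : A.Holds N r G' ε' :=
  ((MeasureTheory.measure_mono (Set.compl_subset_compl.mpr hG)).trans h).trans hε

/-- States outside `G` cost at most `ε` in total; from a state in `G` only the fresh randomness of
one round can fail. -/
theorem Holds.step {r : ℕ} {G G' : Set (N.ids → A.State)} {ε δ : ℝ≥0∞} (h : A.Holds N r G ε)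
    (hs : ∀ σ ∈ G, (indep (A.next N σ)).toOuterMeasure G'ᶜ ≤ δ) :
    A.Holds N (r + 1) G' (ε + δ) := by
  classical
  unfold Holds at *
  rw [run, PMF.toOuterMeasure_bind_apply]
  calc ∑' σ, A.run N r σ * (indep (A.next N σ)).toOuterMeasure G'ᶜ
      ≤ ∑' σ, (Gᶜ.indicator (A.run N r) σ + A.run N r σ * δ) := by
        refine ENNReal.tsum_le_tsum fun σ => ?_
        by_cases hσ : σ ∈ G
        · rw [Set.indicator_of_notMem (by simpa using hσ), zero_add]
          exact mul_le_mul_right (hs σ hσ) _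
        · rw [Set.indicator_of_mem (by simpa using hσ)]
          refine le_add_right ?_
          calc _ ≤ A.run N r σ * 1 := mul_le_mul_right (by
                rw [← PMF.tsum_coe (indep (A.next N σ)), PMF.toOuterMeasure_apply]
                exact ENNReal.tsum_le_tsum fun _ => Set.indicator_le_self _ _ _) _
            _ = _ := mul_one _
    _ ≤ ε + δ := by
        rw [ENNReal.tsum_add, ENNReal.tsum_mul_right, PMF.tsum_coe, one_mul,
          ← PMF.toOuterMeasure_apply]
        gcongr

theorem Holds.le_toOuterMeasure {r : ℕ} {G : Set (N.ids → A.State)} {ε : ℝ≥0∞}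
    (h : A.Holds N r G ε) : 1 - ε ≤ (A.run N r).toOuterMeasure G := by
  rw [tsub_le_iff_right]
  calc 1 = (A.run N r).toOuterMeasure Set.univ := by
        symm; rw [PMF.toOuterMeasure_apply_eq_one_iff]; exact Set.subset_univ _
    _ = (A.run N r).toOuterMeasure (G ∪ Gᶜ) := by rw [Set.union_compl_self]
    _ ≤ _ := (MeasureTheory.measure_union_le _ _).trans (by gcongr; exact h)

end Algorithm

/-! ### Paths in a weighted directed graph -/

section Paths

variable {V : Type}

/-- `Path W u v c j`: there is a walk from `u` to `v` with `j` edges and of length `c`. A weight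
`⊤` stands for an absent edge. -/
inductive Path (W : V → V → ℕ∞) (u : V) : V → ℕ → ℕ → Prop
  | nil : Path W u u 0 0
  | snoc {v z : V} {c w j : ℕ} : Path W u v c j → W v z = w → Path W u z (c + w) (j + 1)

variable {W : V → V → ℕ∞}

theorem Path.trans {u v z : V} {c c' j j' : ℕ} (h : Path W u v c j) (h' : Path W v z c' j') :
    Path W u z (c + c') (j + j') := by
  induction h' with
  | nil => simpa using h
  | snoc _ hw ih => rw [← add_assoc, ← add_assoc]; exact ih.snoc hw

theorem Path.single {u v : V} {w : ℕ} (h : W u v = w) : Path W u v w 1 := by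
  simpa using (Path.nil (W := W) (u := u)).snoc h

/-- `Attains W a v e`: some walk that ends in `v`, with the initial value `a u` of its first vertex
`u` added to its length, has length `e`. -/
def Attains (W : V → V → ℕ∞) (a : V → ℕ∞) (v : V) (e : ℕ) : Prop :=
  ∃ u e₀ c j, a u = (e₀ : ℕ) ∧ Path W u v c j ∧ e = e₀ + c

theorem Attains.base {a : V → ℕ∞} {v : V} {e : ℕ} (h : a v = e) : Attains W a v e :=
  ⟨v, e, 0, 0, h, .nil, rfl⟩

theorem Attains.step {a : V → ℕ∞} {u v : V} {e w : ℕ} (h : Attains W a u e) (hw : W u v = w) :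
    Attains W a v (e + w) := by
  obtain ⟨x, e₀, c, j, h0, hp, rfl⟩ := h
  exact ⟨x, e₀, c + w, j + 1, h0, hp.snoc hw, by ring⟩

theorem Attains.cases {a : V → ℕ∞} {v : V} {e : ℕ} (h : Attains W a v e) :
    a v = e ∨ ∃ u e' w, Attains W a u e' ∧ W u v = (w : ℕ) ∧ e = e' + w := by
  obtain ⟨x, e₀, c, j, h0, hp, rfl⟩ := h
  cases hp with
  | nil => left; simpa using h0
  | snoc hp hw => exact Or.inr ⟨_, _, _, ⟨x, e₀, _, _, h0, hp, rfl⟩, hw, by ring⟩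

open Classical in
/-- The least length that is attained at `v`. -/
noncomputable def attDist (W : V → V → ℕ∞) (a : V → ℕ∞) (v : V) : ℕ∞ :=
  if h : ∃ e, Attains W a v e then (Nat.find h : ℕ) else ⊤

theorem attDist_le {a : V → ℕ∞} {v : V} {e : ℕ} (h : Attains W a v e) : attDist W a v ≤ e := by
  classical
  have hx : ∃ e, Attains W a v e := ⟨e, h⟩
  rw [attDist, dif_pos hx]
  exact_mod_cast Nat.find_min' hx h

theorem attains_of_attDist {a : V → ℕ∞} {v : V} {e : ℕ} (h : attDist W a v = e) :
    Attains W a v e := by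
  classical
  unfold attDist at h
  split_ifs at h with hx
  · have : Nat.find hx = e := by exact_mod_cast h
    exact this ▸ Nat.find_spec hx
  · exact absurd h.symm (ENat.natCast_ne_top e)

theorem attDist_step (a : V → ℕ∞) (u v : V) : attDist W a v ≤ attDist W a u + W u v := by
  rcases eq_or_ne (attDist W a u) ⊤ with h | h
  · simp [h]
  rcases eq_or_ne (W u v) ⊤ with h' | h'
  · simp [h']
  obtain ⟨e, he⟩ := ENat.ne_top_iff_exists.mp h
  obtain ⟨w, hw⟩ := ENat.ne_top_iff_exists.mp h'
  rw [← he, ← hw]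
  exact_mod_cast attDist_le ((attains_of_attDist he.symm).step hw.symm)

theorem attDist_le_init (a : V → ℕ∞) (v : V) : attDist W a v ≤ a v := by
  rcases eq_or_ne (a v) ⊤ with h | h
  · simp [h]
  obtain ⟨e, he⟩ := ENat.ne_top_iff_exists.mp h
  rw [← he]
  exact attDist_le (Attains.base he.symm)

end Paths

/-! ### Pipelined multi-source distances

Every vertex has a table of estimates, indexed by labels. In each round, every vertex sends the
lexicographically least pair (estimate, label) that it has not sent yet. -/

/-- The tables of a vertex: the current estimates, and the estimates that were last sent. -/
structure PipeState where
  est : ℕ → ℕ∞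
  sent : ℕ → ℕ∞

namespace PipeState

/-- The pairs that are still to be sent. -/
def pending (K Λ : ℕ) (s : PipeState) : Set (ℕ ×ₗ ℕ) :=
  {p | s.est (ofLex p).2 = (ofLex p).1 ∧ s.est (ofLex p).2 < s.sent (ofLex p).2 ∧
    (ofLex p).1 ≤ K ∧ (ofLex p).2 ≤ Λ}

open Classical in
/-- The pair that is sent next. -/
noncomputable def pick (K Λ : ℕ) (s : PipeState) : Option (ℕ × ℕ) :=
  if h : (s.pending K Λ).Nonempty then
    some (ofLex ((wellFounded_lt (α := ℕ ×ₗ ℕ)).min _ h)) else none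

/-- The estimate for the label `l` that a message carries. -/
def offer (msg : Option (ℕ × ℕ)) (l : ℕ) : ℕ∞ :=
  match msg with
  | some p => if p.2 = l then p.1 else ⊤
  | none => ⊤

/-- One round of a vertex, where `W i` is the weight of the link from the vertex `i`, and `inb i` is
the message received from it. -/
noncomputable def step (K Λ : ℕ) (W : ℕ → ℕ∞) (inb : ℕ → Option (ℕ × ℕ)) (s : PipeState) :
    PipeState where
  est l := s.est l ⊓ ⨅ i, offer (inb i) l + W i
  sent l := s.sent l ⊓ offer (s.pick K Λ) l

theorem pick_eq_some {K Λ : ℕ} {s : PipeState} {p : ℕ × ℕ} (h : s.pick K Λ = some p) :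
    toLex p ∈ s.pending K Λ ∧ ∀ q ∈ s.pending K Λ, toLex p ≤ q := by
  unfold pick at h
  split_ifs at h with hn
  have := Option.some_injective _ h
  rw [← this]
  exact ⟨WellFounded.min_mem wellFounded_lt _ hn,
    fun q hq => WellFounded.min_le wellFounded_lt hq⟩

theorem exists_pick {K Λ : ℕ} {s : PipeState} {p : ℕ ×ₗ ℕ} (h : p ∈ s.pending K Λ) :
    ∃ q, s.pick K Λ = some q := by
  unfold pick
  rw [dif_pos ⟨p, h⟩]
  exact ⟨_, rfl⟩

theorem offer_eq_coe {msg : Option (ℕ × ℕ)} {l d : ℕ} (h : offer msg l = d) :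
    msg = some (d, l) := by
  unfold offer at h
  split at h
  · split_ifs at h with h2
    · rename_i p
      have : p.1 = d := by exact_mod_cast h
      subst h2; subst this; rfl
    · exact absurd h.symm (ENat.natCast_ne_top d)
  · exact absurd h.symm (ENat.natCast_ne_top d)

end PipeState

section Pipe

variable {V : Type} (K Λ : ℕ) (W : V → V → ℕ∞) (a : V → ℕ → ℕ∞)

/-- The states of all vertices after `r` rounds. -/
noncomputable def pipe : ℕ → V → PipeState
  | 0, v => ⟨a v, fun _ => ⊤⟩
  | r + 1, v =>
    { est := fun l => (pipe r v).est l ⊓ ⨅ u, PipeState.offer ((pipe r u).pick K Λ) l + W u v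
      sent := fun l => (pipe r v).sent l ⊓ PipeState.offer ((pipe r v).pick K Λ) l }

variable {K Λ W a}

theorem pipe_est_sound (r : ℕ) (v : V) (l : ℕ) :
    attDist W (fun u => a u l) v ≤ (pipe K Λ W a r v).est l := by
  induction r generalizing v with
  | zero => exact attDist_le_init _ v
  | succ r ih =>
    refine le_inf (ih v) (le_iInf fun u => (attDist_step _ u v).trans ?_)
    gcongr
    rcases eq_or_ne (PipeState.offer ((pipe K Λ W a r u).pick K Λ) l) ⊤ with h | h
    · simp [h]
    · obtain ⟨d, hd⟩ := ENat.ne_top_iff_exists.mp h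
      have h1 := (PipeState.pick_eq_some (PipeState.offer_eq_coe hd.symm)).1.1
      rw [← hd]
      exact (ih u).trans h1.le

theorem attains_of_pipe_est {r : ℕ} {v : V} {l d : ℕ} (h : (pipe K Λ W a r v).est l = d) :
    ∃ e ≤ d, Attains W (fun u => a u l) v e := by
  have h1 := pipe_est_sound (K := K) (Λ := Λ) (W := W) (a := a) r v l
  rw [h] at h1
  obtain ⟨e, he⟩ := ENat.ne_top_iff_exists.mp (ne_top_of_le_ne_top (ENat.natCast_ne_top d) h1)
  rw [← he] at h1
  exact ⟨e, by exact_mod_cast h1, attains_of_attDist he.symm⟩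

/-- A pair that is sent is received in the same round, so the recipient's estimate never lags behind
`sent`. -/
theorem pipe_est_le_sent (r : ℕ) (u v : V) (l : ℕ) :
    (pipe K Λ W a r v).est l ≤ (pipe K Λ W a r u).sent l + W u v := by
  induction r with
  | zero => simp [pipe]
  | succ r ih =>
    simp only [pipe]
    rcases le_total ((pipe K Λ W a r u).sent l)
      (PipeState.offer ((pipe K Λ W a r u).pick K Λ) l) with h | h
    · rw [inf_eq_left.mpr h]
      exact inf_le_left.trans ih
    · rw [inf_eq_right.mpr h]
      exact inf_le_right.trans (iInf_le _ u)

theorem attDist_le_pipe_sent (r : ℕ) (v : V) (l : ℕ) :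
    attDist W (fun u => a u l) v ≤ (pipe K Λ W a r v).sent l := by
  induction r with
  | zero => simp [pipe]
  | succ r ih =>
    refine le_inf ih ?_
    rcases eq_or_ne (PipeState.offer ((pipe K Λ W a r v).pick K Λ) l) ⊤ with h | h
    · simp [h]
    · obtain ⟨d, hd⟩ := ENat.ne_top_iff_exists.mp h
      have h1 := (PipeState.pick_eq_some (PipeState.offer_eq_coe hd.symm)).1.1
      rw [← hd]
      exact (pipe_est_sound r v l).trans h1.le

variable (W a) in
open Classical in
/-- The number of labels in `L` that precede `l` in the final table of the vertex `v`, where `d` is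
the distance for `l`. -/
noncomputable def pipeRank (L : Finset ℕ) (v : V) (d l : ℕ) : ℕ :=
  (L.filter fun k => ∃ e : ℕ, attDist W (fun u => a u k) v = e ∧ toLex (e, k) < toLex (d, l)).card

/-- A pair (d, l) can be delayed only by the pairs that precede it lexicographically in the final
table, one round each. Hence it is correct by round d + rank and sent one round later. Since weights
are at least 1, the hop from a predecessor pays for the round in which its pair is sent. -/
theorem pipe_sent_eq (hW : ∀ u v, 1 ≤ W u v) (L : Finset ℕ)
    (hL : ∀ u l, a u l ≠ ⊤ → l ∈ L ∧ l ≤ Λ) (r : ℕ) :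
    ∀ v l d, attDist W (fun u => a u l) v = (d : ℕ) → d ≤ K →
      (d + pipeRank W a L v d l ≤ r → (pipe K Λ W a r v).est l = d) ∧
      (d + pipeRank W a L v d l + 1 ≤ r → (pipe K Λ W a r v).sent l = d) := by
  classical
  have hlab : ∀ v l (d : ℕ), attDist W (fun u => a u l) v = d → l ∈ L ∧ l ≤ Λ := by
    intro v l d h
    obtain ⟨u, e₀, c, j, h0, -, -⟩ := attains_of_attDist h
    exact hL u l (by simp [h0])
  induction r with
  | zero =>
    intro v l d hd hK
    refine ⟨fun h => ?_, fun h => by omega⟩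
    have hd0 : d = 0 := by omega
    subst hd0
    -- Distance 0 cannot use an edge, since edges weigh at least 1; so it is an initial value.
    rcases (attains_of_attDist hd).cases with h0 | ⟨u, e', w, -, hw, he⟩
    · exact h0
    · have := hW u v
      rw [hw] at this
      have : 1 ≤ w := by exact_mod_cast this
      omega
  | succ r ih =>
    have hsent : ∀ v l d, attDist W (fun u => a u l) v = (d : ℕ) → d ≤ K →
      d + pipeRank W a L v d l + 1 ≤ r + 1 → (pipe K Λ W a (r + 1) v).sent l = d := by
      intro v l d hd hK hr
      have hest : (pipe K Λ W a r v).est l = d := (ih v l d hd hK).1 (by omega)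
      refine le_antisymm ?_ (hd ▸ attDist_le_pipe_sent (r + 1) v l)
      rcases (attDist_le_pipe_sent (K := K) (Λ := Λ) (W := W) (a := a) r v l).eq_or_lt with h | h
      · exact inf_le_left.trans (by rw [← h, hd])
      refine inf_le_right.trans ?_
      have hmem : toLex (d, l) ∈ (pipe K Λ W a r v).pending K Λ :=
        ⟨hest, by simpa [hest, ← hd] using h, hK, (hlab v l d hd).2⟩
      obtain ⟨⟨f, k⟩, hq⟩ := PipeState.exists_pick hmem
      obtain ⟨⟨hq1, hq2, -, -⟩, hmin⟩ := PipeState.pick_eq_some hq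
      simp only [ofLex_toLex] at hq1 hq2
      -- If a smaller pair (f, k) were picked, the true distance f' ≤ f for `k` would have smaller
      -- rank, hence would already have been sent, and (f, k) would not be pending.
      rcases (hmin _ hmem).eq_or_lt with heq | hlt
      · have : (f, k) = (d, l) := heq
        rw [hq, this]
        simp [PipeState.offer]
      · exfalso
        have h1 := pipe_est_sound (K := K) (Λ := Λ) (W := W) (a := a) r v k
        rw [hq1] at h1
        obtain ⟨f', hf'⟩ := ENat.ne_top_iff_exists.mp (ne_top_of_le_ne_top (by simp) h1)
        rw [← hf'] at h1
        have h2 : f' ≤ f := by exact_mod_cast h1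
        have hlt' : toLex (f', k) < toLex (d, l) := by
          rw [Prod.Lex.toLex_lt_toLex] at hlt ⊢
          simp only at hlt ⊢
          omega
        have hfd : f' ≤ d := by
          rw [Prod.Lex.toLex_lt_toLex] at hlt'
          simp only at hlt'
          omega
        have hrank : pipeRank W a L v f' k < pipeRank W a L v d l := by
          refine Finset.card_lt_card (Finset.ssubset_iff_of_subset ?_ |>.mpr ⟨k, ?_, ?_⟩)
          · intro x
            simp only [Finset.mem_filter]
            rintro ⟨hx, e, he, hlt2⟩
            exact ⟨hx, e, he, hlt2.trans hlt'⟩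
          · simp only [Finset.mem_filter]
            exact ⟨(hlab v k f' hf'.symm).1, f', hf'.symm, hlt'⟩
          · simp only [Finset.mem_filter, not_and, not_exists]
            intro _ e he
            have : e = f' := by exact_mod_cast he.symm.trans hf'.symm
            rw [this]
            exact lt_irrefl _
        have := (ih v k f' hf'.symm (by omega)).2 (by omega)
        rw [hq1, this] at hq2
        have : f < f' := by exact_mod_cast hq2
        omega
    have key : ∀ v l d, attDist W (fun u => a u l) v = (d : ℕ) → d ≤ K →
      d + pipeRank W a L v d l ≤ r + 1 → (pipe K Λ W a (r + 1) v).est l = d := by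
      intro v l d hd hK hr
      refine le_antisymm ?_ (hd ▸ pipe_est_sound (r + 1) v l)
      rcases (attains_of_attDist hd).cases with h0 | ⟨u, e, w, hu, hw, he⟩
      · have : ∀ r, (pipe K Λ W a r v).est l ≤ a v l := by
          intro r
          induction r with
          | zero => exact le_rfl
          | succ r ih => exact inf_le_left.trans ih
        exact (this _).trans h0.le
      · have hw1 : 1 ≤ w := by
          have := hW u v
          rw [hw] at this
          exact_mod_cast this
        have hue : attDist W (fun u => a u l) u = e := by
          refine le_antisymm (attDist_le hu) ?_
          have := attDist_step (W := W) (fun u => a u l) u v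
          rw [hd, hw, he] at this
          push_cast at this
          exact (ENat.add_le_add_iff_right (ENat.natCast_ne_top w)).mp this
        -- Every label that precedes `l` at `u` still does so at `v`: both distances are extended by
        -- the same edge.
        have hrank : pipeRank W a L u e l ≤ pipeRank W a L v d l := by
          refine Finset.card_le_card fun k => ?_
          simp only [Finset.mem_filter]
          rintro ⟨hkL, f, hf, hlt⟩
          refine ⟨hkL, ?_⟩
          have h1 := attDist_step (W := W) (fun u => a u k) u v
          rw [hf, hw] at h1
          obtain ⟨f', hf'⟩ := ENat.ne_top_iff_exists.mp
            (ne_top_of_le_ne_top (by simp) h1)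
          rw [← hf'] at h1
          have h2 : f' ≤ f + w := by exact_mod_cast h1
          refine ⟨f', hf'.symm, ?_⟩
          rw [Prod.Lex.toLex_lt_toLex] at hlt ⊢
          simp only at hlt ⊢
          omega
        have hs := hsent u l e hue (by omega) (by omega)
        have := pipe_est_le_sent (K := K) (Λ := Λ) (W := W) (a := a) (r + 1) u v l
        rw [hs, hw] at this
        refine this.trans ?_
        rw [he]; push_cast; rfl
    exact fun v l d hd hK => ⟨key v l d hd hK, hsent v l d hd hK⟩

/-- The estimates are exact up to the distance `K` after `K + M` rounds, where `M` bounds the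
number of labels. -/
theorem pipe_est_le (hW : ∀ u v, 1 ≤ W u v) (L : Finset ℕ)
    (hL : ∀ u l, a u l ≠ ⊤ → l ∈ L ∧ l ≤ Λ) {r : ℕ} (hr : K + L.card ≤ r) {v : V} {l e : ℕ}
    (he : Attains W (fun u => a u l) v e) (hK : e ≤ K) : (pipe K Λ W a r v).est l ≤ e := by
  have h := attDist_le he
  obtain ⟨d, hd⟩ := ENat.ne_top_iff_exists.mp (ne_top_of_le_ne_top (ENat.natCast_ne_top e) h)
  rw [← hd] at h
  have hde : d ≤ e := by exact_mod_cast h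
  rw [(pipe_sent_eq hW L hL r v l d hd.symm (by omega)).1 ?_]
  · exact h
  · have : pipeRank W a L v d l ≤ L.card := by classical exact Finset.card_filter_le _ _
    omega

end Pipe

/-! ### Refining nested neighbourhoods of the source -/

section Levels

variable {V : Type} {W : V → V → ℕ∞}

theorem Path.exists_snoc {u z : V} {c j : ℕ} (h : Path W u z c (j + 1)) :
    ∃ v c' w, Path W u v c' j ∧ W v z = (w : ℕ) ∧ c = c' + w := by
  cases h with
  | snoc hp hw => exact ⟨_, _, _, hp, hw, rfl⟩

/-- The invariant of the refinement, after `i` of `I` steps: `ℓ` sorts the vertices into layers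
around `s`, whose width is about `2 ^ (I - i)`. -/
structure Layered (W : V → V → ℕ∞) (s : V) (I i : ℕ) (ℓ : V → ℕ) : Prop where
  source : ℓ s = 0
  le : ∀ v, ℓ v ≤ 2 ^ i
  -- The radius 2^(I−k)(1 − k/(2I)), cleared of its denominator, is kept for all earlier `k`, so
  -- that long links are controlled at the end as well.
  narrow : ∀ k ≤ i, ∀ u v c j, Path W u v c j → 2 * I * c ≤ 2 ^ (I - k) * (2 * I - k) →
    ℓ v + 1 ≤ ℓ u + 2 ^ (i - k + 1)
  wide : ∀ v, ∃ c j, Path W s v c j ∧ c ≤ 2 ^ (I - i) * ℓ v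

open Classical in
theorem layered_zero {s : V} {I : ℕ} (h : ∀ v, ∃ c j, Path W s v c j ∧ c ≤ 2 ^ I) :
    Layered W s I 0 fun v => if v = s then 0 else 1 where
  source := by simp
  le v := by split_ifs <;> simp
  narrow k hk u v c j _ _ := by
    obtain rfl : k = 0 := by omega
    split_ifs <;> simp
  wide v := by
    by_cases hv : v = s
    · subst hv
      exact ⟨0, 0, .nil, by simp⟩
    · simpa [hv] using h v

open Classical in
-- The two nearness hypotheses leave a gap between what may be declared near and what must be; this
-- is the room for an approximate test. Soundness preserves `wide`, completeness preserves `narrow`.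
theorem Layered.refine {s : V} {I i : ℕ} {ℓ : V → ℕ} (h : Layered W s I i ℓ) (hi : i < I)
    {near : V → Prop}
    (hs : ∀ v, near v → ∃ u c j, ℓ u < ℓ v ∧ Path W u v c j ∧
      4 * I * c ≤ 2 ^ (I - i) * (2 * I - i))
    (hc : ∀ u v c j, Path W u v c j → ℓ u < ℓ v →
      2 * I * c ≤ 2 ^ (I - (i + 1)) * (2 * I - (i + 1)) → near v) :
    Layered W s I (i + 1) fun v => 2 * ℓ v - if near v then 1 else 0 := by
  have hpos : ∀ v, near v → 1 ≤ ℓ v := fun v hv => by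
    obtain ⟨u, _, _, hu, _⟩ := hs v hv
    omega
  have hpow : 2 ^ (I - i) = 2 * 2 ^ (I - (i + 1)) := by
    rw [← pow_succ', show I - (i + 1) + 1 = I - i by omega]
  refine ⟨by simp [h.source], fun v => ?_, ?_, fun v => ?_⟩
  · have := h.le v
    rw [pow_succ]; omega
  · intro k hk u v c j hp hcρ
    rcases Nat.lt_or_ge i k with hki | hki
    · obtain rfl : k = i + 1 := by omega
      have hwide : 2 * I * c ≤ 2 ^ (I - i) * (2 * I - i) := by
        refine hcρ.trans (Nat.mul_le_mul (Nat.pow_le_pow_right (by norm_num) (by omega))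
          (by omega))
      have h1 := h.narrow i le_rfl u v c j hp hwide
      simp only [Nat.sub_self, zero_add, pow_one] at h1 ⊢
      rcases Nat.lt_or_ge (ℓ u) (ℓ v) with huv | huv
      · have hv : near v := hc u v c j hp huv hcρ
        rw [if_pos hv]
        by_cases hu : near u
        · exfalso
          -- If `u` were near too, the walk from the lower `x` through `u` to `v` would have length
          -- within the old radius and yet rise by two layers.
          obtain ⟨x, c', j', hxu, hp', hc'⟩ := hs u hu
          have h2 := h.narrow i le_rfl x v _ _ (hp'.trans hp) (by
            have : 2 * (2 * I * c) ≤ 2 ^ (I - i) * (2 * I - i) := by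
              have h3 : 2 ^ (I - (i + 1)) * (2 * I - (i + 1)) ≤ 2 ^ (I - (i + 1)) * (2 * I - i) :=
                Nat.mul_le_mul_left _ (by omega)
              rw [hpow, mul_assoc 2 (2 ^ (I - (i + 1)))]
              exact Nat.mul_le_mul_left 2 (hcρ.trans h3)
            have e : 2 * I * (c' + c) * 2 = 4 * I * c' + 2 * (2 * I * c) := by ring
            omega)
          simp only [Nat.sub_self, zero_add, pow_one] at h2
          omega
        · rw [if_neg hu]
          have := hpos v hv
          omega
      · have := hpos u
        split_ifs <;> omega
    · have h1 := h.narrow k hki u v c j hp hcρ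
      have h2 : 2 ^ (i + 1 - k + 1) = 2 * 2 ^ (i - k + 1) := by
        rw [← pow_succ', show i + 1 - k = i - k + 1 by omega]
      have := hpos u
      rw [h2]
      split_ifs <;> omega
  · by_cases hv : near v
    · obtain ⟨u, c, j, huv, hp, hcρ⟩ := hs v hv
      obtain ⟨c', j', hp', hc'⟩ := h.wide u
      refine ⟨c' + c, j' + j, hp'.trans hp, ?_⟩
      simp only [if_pos hv]
      have h1 : c ≤ 2 ^ (I - (i + 1)) := by
        have h2 : 4 * I * c ≤ 4 * I * 2 ^ (I - (i + 1)) := by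
          calc 4 * I * c ≤ _ := hcρ
            _ ≤ 2 ^ (I - i) * (2 * I) := Nat.mul_le_mul_left _ (by omega)
            _ = _ := by rw [hpow]; ring
        exact Nat.le_of_mul_le_mul_left h2 (by omega)
      calc c' + c ≤ 2 ^ (I - i) * ℓ u + 2 ^ (I - (i + 1)) := by omega
        _ = 2 ^ (I - (i + 1)) * (2 * ℓ u + 1) := by rw [hpow]; ring
        _ ≤ _ := Nat.mul_le_mul_left _ (by omega)
    · obtain ⟨c, j, hp, hc'⟩ := h.wide v
      refine ⟨c, j, hp, ?_⟩
      simp only [if_neg hv, Nat.sub_zero]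
      calc c ≤ _ := hc'
        _ = _ := by rw [hpow]; ring

open Classical in
-- A positive weight w lies between two consecutive radii, and the radius of index k is at least
-- 2^(I−k)/2; so `narrow` bounds the rise by 8w − 1. The spare 1 pays for a possible decrease at
-- `u`. Weight 0 leaves no such spare, hence the extra test on walks of length zero.
theorem Layered.final {s : V} {I : ℕ} {ℓ : V → ℕ} (h : Layered W s I I ℓ) (hI : 0 < I)
    {near : V → Prop}
    (hs : ∀ v, near v → ∃ u j, ℓ u < ℓ v ∧ Path W u v 0 j)
    (hc : ∀ u v j, Path W u v 0 j → ℓ u < ℓ v → near v) :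
    (∀ u v w, W u v = (w : ℕ) →
      (ℓ v - if near v then 1 else 0) ≤ (ℓ u - if near u then 1 else 0) + 8 * w) ∧
    ∀ v, ∃ c j, Path W s v c j ∧ c ≤ ℓ v - if near v then 1 else 0 := by
  have hpos : ∀ v, near v → 1 ≤ ℓ v := fun v hv => by
    obtain ⟨u, _, hu, _⟩ := hs v hv
    omega
  constructor
  · intro u v w hw
    have hp : Path W u v w 1 := Path.single hw
    rcases Nat.eq_zero_or_pos w with rfl | hw0
    · have key : ∀ x j, Path W x v 0 j → (ℓ v - if near v then 1 else 0) ≤ ℓ x := by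
        intro x j hx
        have h1 := h.narrow I le_rfl x v 0 j hx (by simp)
        simp only [Nat.sub_self, zero_add, pow_one] at h1
        rcases Nat.lt_or_ge (ℓ x) (ℓ v) with hlt | hge
        · rw [if_pos (hc x v j hx hlt)]; omega
        · omega
      by_cases hu : near u
      · obtain ⟨x, j, hxu, hx⟩ := hs u hu
        have := key x _ (hx.trans hp)
        rw [if_pos hu]; omega
      · have := key u _ hp
        rw [if_neg hu]; omega
    · rcases Nat.lt_or_ge (2 ^ I) w with hbig | hsmall
      · have := h.le v
        omega
      · have hex : ∃ i, ¬ 2 * I * w ≤ 2 ^ (I - i) * (2 * I - i) := by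
          refine ⟨I, ?_⟩
          simp only [Nat.sub_self, pow_zero, one_mul, not_le]
          have : 2 * I * 1 ≤ 2 * I * w := Nat.mul_le_mul_left _ hw0
          omega
        classical
        set i := Nat.find hex with hidef
        have hi := Nat.find_spec hex
        rw [← hidef] at hi
        have hiI : i ≤ I := Nat.find_min' hex (by
          simp only [Nat.sub_self, pow_zero, one_mul, not_le]
          have : 2 * I * 1 ≤ 2 * I * w := Nat.mul_le_mul_left _ hw0
          omega)
        have hi0 : i ≠ 0 := by
          intro h0
          rw [h0] at hi
          apply hi
          simp only [Nat.sub_zero]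
          rw [mul_comm (2 ^ I)]
          exact Nat.mul_le_mul_left _ hsmall
        obtain ⟨k, hk⟩ := Nat.exists_eq_succ_of_ne_zero hi0
        have hk1 : 2 * I * w ≤ 2 ^ (I - k) * (2 * I - k) := by
          have := Nat.find_min hex (m := k) (by omega)
          push Not at this
          exact this
        have h1 := h.narrow k (by omega) u v w 1 hp hk1
        have h2 : 2 ^ (I - i) ≤ 2 * w := by
          push Not at hi
          have : 2 ^ (I - i) * I ≤ 2 * w * I := by
            calc 2 ^ (I - i) * I ≤ 2 ^ (I - i) * (2 * I - i) :=
                  Nat.mul_le_mul_left _ (by omega)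
              _ ≤ 2 * I * w := hi.le
              _ = _ := by ring
          exact Nat.le_of_mul_le_mul_right this hI
        have h3 : 2 ^ (I - k + 1) = 4 * 2 ^ (I - i) := by
          rw [show I - k + 1 = I - i + 2 by omega, pow_add]; ring
        have := hpos u
        split_ifs <;> omega
  · intro v
    by_cases hv : near v
    · obtain ⟨u, j, huv, hp⟩ := hs v hv
      obtain ⟨c', j', hp', hc'⟩ := h.wide u
      refine ⟨c' + 0, j' + j, hp'.trans hp, ?_⟩
      simp only [Nat.sub_self, pow_zero, one_mul] at hc'
      rw [if_pos hv]; omega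
    · obtain ⟨c, j, hp, hc'⟩ := h.wide v
      exact ⟨c, j, hp, by simpa [hv] using hc'⟩

/-! ### Entering a layer -/

/-- The weights inside the layers. -/
def cellWeight (W : V → V → ℕ∞) (ℓ : V → ℕ) (u v : V) : ℕ∞ := if ℓ u = ℓ v then W u v else ⊤

/-- Some walk to `v` of length `c` enters the layer of `v` from a lower one by its first edge, and
stays in the layer for another `j` edges. -/
def Enter (W : V → V → ℕ∞) (ℓ : V → ℕ) (v : V) (c j : ℕ) : Prop :=
  ∃ x u w c', ℓ x < ℓ u ∧ W x u = (w : ℕ) ∧ Path (cellWeight W ℓ) u v c' j ∧ c = w + c'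

variable {ℓ : V → ℕ}

theorem cellWeight_eq_coe {u v : V} {w : ℕ} (h : cellWeight W ℓ u v = w) :
    ℓ u = ℓ v ∧ W u v = w := by
  unfold cellWeight at h
  split_ifs at h with h1
  · exact ⟨h1, h⟩
  · exact absurd h.symm (ENat.natCast_ne_top w)

theorem Path.of_cell {u v : V} {c j : ℕ} (h : Path (cellWeight W ℓ) u v c j) :
    ℓ u = ℓ v ∧ Path W u v c j := by
  induction h with
  | nil => exact ⟨rfl, .nil⟩
  | snoc _ hw ih =>
    obtain ⟨h1, h2⟩ := cellWeight_eq_coe hw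
    exact ⟨ih.1.trans h1, ih.2.snoc h2⟩

theorem Enter.snoc {u v : V} {c j w : ℕ} (h : Enter W ℓ u c j) (hw : cellWeight W ℓ u v = w) :
    Enter W ℓ v (c + w) (j + 1) := by
  obtain ⟨x, y, w', c', hl, hw', hp, rfl⟩ := h
  exact ⟨x, y, w', c' + w, hl, hw', hp.snoc hw, by ring⟩

/-- A short walk cannot overshoot the layer of its end: coming from below, it would have risen by
two layers. So after its last entry from below it stays in that layer. -/
theorem Path.exists_enter {u v : V} {c j : ℕ} (h : Path W u v c j) (hl : ℓ u < ℓ v)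
    (hn : ∀ x y c' j', Path W x y c' j' → c' ≤ c → ℓ y ≤ ℓ x + 1) :
    ∃ c' ≤ c, ∃ j', Enter W ℓ v c' j' := by
  induction h with
  | nil => omega
  | @snoc v z c w j hp hw ih =>
    rcases lt_trichotomy (ℓ v) (ℓ z) with h1 | h1 | h1
    · exact ⟨w, by omega, 0, v, z, w, 0, h1, hw, .nil, rfl⟩
    · obtain ⟨c', hc', j', he⟩ := ih (h1 ▸ hl)
        fun x y c' j' hp hc => hn x y c' j' hp (by omega)
      exact ⟨c' + w, by omega, j' + 1, he.snoc (by simp [cellWeight, h1, hw])⟩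
    · have := hn _ _ _ _ hp (by omega)
      omega

/-- `c` is the least length with which `v` can be entered, and `j` the least number of edges that
achieves it. -/
def OptEnter (W : V → V → ℕ∞) (ℓ : V → ℕ) (v : V) (c j : ℕ) : Prop :=
  Enter W ℓ v c j ∧ ∀ c' j', Enter W ℓ v c' j' → c < c' ∨ c = c' ∧ j ≤ j'

theorem Enter.exists_opt {v : V} {c j : ℕ} (h : Enter W ℓ v c j) :
    ∃ c' ≤ c, ∃ j', OptEnter W ℓ v c' j' := by
  classical
  have h1 : ∃ c j, Enter W ℓ v c j := ⟨c, j, h⟩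
  have h2 : ∃ j, Enter W ℓ v (Nat.find h1) j := Nat.find_spec h1
  refine ⟨Nat.find h1, Nat.find_min' h1 ⟨j, h⟩, Nat.find h2, Nat.find_spec h2, ?_⟩
  intro c' j' h'
  rcases (Nat.find_min' h1 ⟨j', h'⟩).lt_or_eq with hlt | heq
  · exact Or.inl hlt
  · exact Or.inr ⟨heq, Nat.find_min' h2 (heq ▸ h')⟩

theorem OptEnter.unique {v : V} {c j c' j' : ℕ} (h : OptEnter W ℓ v c j)
    (h' : OptEnter W ℓ v c' j') : c = c' ∧ j = j' := by
  have h1 := h.2 _ _ h'.1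
  have h2 := h'.2 _ _ h.1
  omega

/-- Because optimality is lexicographic in length and number of edges, a better way to enter the
predecessor would improve the whole walk. -/
theorem OptEnter.exists_pred {z : V} {c j : ℕ} (h : OptEnter W ℓ z c (j + 1)) :
    ∃ v c' w, OptEnter W ℓ v c' j ∧ cellWeight W ℓ v z = (w : ℕ) ∧ c = c' + w := by
  obtain ⟨⟨x, u, w', c', hl, hw', hp, rfl⟩, hmin⟩ := h
  obtain ⟨v, c₁, w, hp', hw, rfl⟩ := hp.exists_snoc
  obtain ⟨c₂, hc₂, j₂, hopt⟩ := (show Enter W ℓ v (w' + c₁) j from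
    ⟨x, u, w', c₁, hl, hw', hp', rfl⟩).exists_opt
  have h1 := hmin _ _ (hopt.1.snoc hw)
  have h2 := hopt.2 _ _ (show Enter W ℓ v (w' + c₁) j from ⟨x, u, w', c₁, hl, hw', hp', rfl⟩)
  have h3 : c₂ = w' + c₁ ∧ j₂ = j := by omega
  obtain ⟨rfl, rfl⟩ := h3
  exact ⟨v, _, w, hopt, hw, by ring⟩

/-- The last `h` predecessors of a vertex on an optimal walk. -/
theorem OptEnter.exists_window {v : V} {c j h : ℕ} (ho : OptEnter W ℓ v c j) (hj : h ≤ j) :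
    ∃ F : Finset V, F.card = h ∧ ∀ x ∈ F, ∃ c₂ j₂ c₁ j₁, OptEnter W ℓ x c₂ j₂ ∧ j₂ < j ∧
      Path (cellWeight W ℓ) x v c₁ j₁ ∧ j₁ ≤ h ∧ c = c₂ + c₁ := by
  classical
  induction h generalizing v c j with
  | zero => exact ⟨∅, rfl, by simp⟩
  | succ h ih =>
    obtain ⟨j, rfl⟩ : ∃ j', j = j' + 1 := ⟨j - 1, by omega⟩
    obtain ⟨u, c', w, hu, hw, rfl⟩ := ho.exists_pred
    obtain ⟨F, hF, hx⟩ := ih hu (by omega)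
    -- The predecessors are distinct because their optimal numbers of edges strictly decrease.
    have hnot : u ∉ F := by
      intro hmem
      obtain ⟨c₂, j₂, c₁, j₁, ho2, hlt, -⟩ := hx u hmem
      have := (ho2.unique hu).2
      omega
    refine ⟨insert u F, by rw [Finset.card_insert_of_notMem hnot, hF], fun x hxF => ?_⟩
    rcases Finset.mem_insert.mp hxF with rfl | hxF
    · exact ⟨c', j, w, 1, hu, by omega, Path.single hw, by omega, rfl⟩
    · obtain ⟨c₂, j₂, c₁, j₁, ho2, hlt, hp, hj1, hc⟩ := hx x hxF
      exact ⟨c₂, j₂, c₁ + w, j₁ + 1, ho2, by omega, hp.snoc hw, by omega, by omega⟩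

/-- The sampled vertices `S` hit every window of `h` predecessors on an optimal walk. -/
def Hits (W : V → V → ℕ∞) (ℓ : V → ℕ) (h : ℕ) (S : V → Prop) : Prop :=
  ∀ v c j, OptEnter W ℓ v c j → h ≤ j → ∃ x c₂ j₂ c₁ j₁, S x ∧ OptEnter W ℓ x c₂ j₂ ∧ j₂ < j ∧
    Path (cellWeight W ℓ) x v c₁ j₁ ∧ j₁ ≤ h ∧ c = c₂ + c₁

/-! ### Approximate distances by way of the sampled vertices -/

section Overlay

variable {ι : V → ℕ} {D₀ : ℕ → ℕ∞} {D₁ : ℕ → ℕ → ℕ∞} {A : ℕ}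

/-- Overlay edges represent walks inside a layer, so the start remains in a lower layer than the
current end. -/
theorem overlay_sound
    (h₀ : ∀ y e, D₀ y = (e : ℕ) → ∃ v, ι v = y ∧ ∃ u c j, ℓ u < ℓ v ∧ Path W u v c j ∧ A * c ≤ e)
    (hι : Function.Injective ι)
    (h₁ : ∀ x y e, D₁ x y = (e : ℕ) → ∃ u v, ι u = x ∧ ι v = y ∧ ∃ c j,
      Path (cellWeight W ℓ) u v c j ∧ A * c ≤ e) {y e : ℕ} (h : Attains D₁ D₀ y e) :
    ∃ v, ι v = y ∧ ∃ u c j, ℓ u < ℓ v ∧ Path W u v c j ∧ A * c ≤ e := by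
  obtain ⟨x, e₀, c, j, hx, hp, rfl⟩ := h
  induction hp with
  | nil => simpa using h₀ x e₀ hx
  | snoc hp hw ih =>
    obtain ⟨v, hv, u, c, j, hl, hpath, hc⟩ := ih
    obtain ⟨v', z, hv', hz, c', j', hpath', hc'⟩ := h₁ _ _ _ hw
    obtain rfl : v' = v := hι (hv'.trans hv.symm)
    obtain ⟨hle, hW⟩ := hpath'.of_cell
    exact ⟨z, hz, u, c + c', j + j', hle ▸ hl, hpath.trans hW, by rw [mul_add]; omega⟩

/-- Induction on the number of edges of the optimal walk, which is cut at a sampled vertex among the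
last `h` predecessors. Each piece costs at most β times its length, so the relative errors of the
pieces do not compound. -/
theorem overlay_complete {h B β : ℕ} {S : V → Prop} {v₀ : V}
    (h₀ : ∀ v c j, S v ∨ v = v₀ → Enter W ℓ v c j → j < h → c ≤ B → D₀ (ι v) ≤ (β * c : ℕ))
    (h₁ : ∀ x v c j, S x → S v ∨ v = v₀ → Path (cellWeight W ℓ) x v c j → j ≤ h → c ≤ B →
      D₁ (ι x) (ι v) ≤ (β * c : ℕ)) (hS : Hits W ℓ h S) (j : ℕ) :
    ∀ v c, S v ∨ v = v₀ → OptEnter W ℓ v c j → c ≤ B → ∃ e ≤ β * c, Attains D₁ D₀ (ι v) e := by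
  induction j using Nat.strong_induction_on with
  | _ j ih =>
    intro v c hv ho hB
    rcases Nat.lt_or_ge j h with hj | hj
    · have := h₀ v c j hv ho.1 hj hB
      obtain ⟨e, he⟩ := ENat.ne_top_iff_exists.mp (ne_top_of_le_ne_top (ENat.natCast_ne_top _) this)
      rw [← he] at this
      exact ⟨e, by exact_mod_cast this, Attains.base he.symm⟩
    · obtain ⟨x, c₂, j₂, c₁, j₁, hx, hox, hlt, hp, hj₁, rfl⟩ := hS v c j ho hj
      obtain ⟨e, he, hatt⟩ := ih j₂ hlt x c₂ (Or.inl hx) hox (by omega)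
      have := h₁ x v c₁ j₁ hx hv hp hj₁ (by omega)
      obtain ⟨e', he'⟩ := ENat.ne_top_iff_exists.mp
        (ne_top_of_le_ne_top (ENat.natCast_ne_top _) this)
      rw [← he'] at this
      have h2 : e' ≤ β * c₁ := by exact_mod_cast this
      exact ⟨e + e', by rw [mul_add]; omega, hatt.step he'.symm⟩

end Overlay

/-! ### Rounded weights -/

/-- The weight `w`, rounded at the scale `i`. The scale `0` is for weights that vanish. -/
def roundWeight (A i w : ℕ) : ℕ∞ :=
  if i = 0 then (if w = 0 then 1 else ⊤) else ((w * A / 2 ^ (i - 1) + 1 : ℕ) : ℕ∞)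

/-- The length, in units of `1 / A`, of a walk with rounded length `d` at the scale `i`. -/
def unround (i d : ℕ) : ℕ := if i = 0 then 0 else 2 ^ (i - 1) * d

theorem one_le_roundWeight (A i w : ℕ) : 1 ≤ roundWeight A i w := by
  unfold roundWeight
  split_ifs
  · exact le_rfl
  · exact le_top
  · exact_mod_cast Nat.le_add_left 1 _

theorem unround_add (i d d' : ℕ) : unround i (d + d') = unround i d + unround i d' := by
  unfold unround; split_ifs <;> ring

theorem unround_mono (i : ℕ) {d d' : ℕ} (h : d ≤ d') : unround i d ≤ unround i d' := by
  unfold unround; split_ifs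
  · exact le_rfl
  · exact Nat.mul_le_mul_left _ h

theorem le_unround {A i w r : ℕ} (h : roundWeight A i w = r) : A * w ≤ unround i r := by
  unfold roundWeight at h
  unfold unround
  split_ifs at h ⊢ with h1 h2
  · simp [h2]
  · exact absurd h.symm (ENat.natCast_ne_top r)
  · have : w * A / 2 ^ (i - 1) + 1 = r := by exact_mod_cast h
    rw [← this, mul_comm A]
    have := Nat.lt_mul_div_succ (w * A) (b := 2 ^ (i - 1)) (by positivity)
    omega

/-- The weights of a graph, rounded. -/
noncomputable def roundW (A i : ℕ) (W : V → V → ℕ∞) (u v : V) : ℕ∞ :=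
  if W u v = ⊤ then ⊤ else roundWeight A i (W u v).toNat

theorem roundW_eq_coe {A i : ℕ} {u v : V} {r : ℕ} (h : roundW A i W u v = r) :
    ∃ w : ℕ, W u v = w ∧ roundWeight A i w = r := by
  unfold roundW at h
  split_ifs at h with h1
  · exact absurd h.symm (ENat.natCast_ne_top r)
  · exact ⟨_, (ENat.natCast_toNat h1).symm, h⟩

theorem roundW_of_coe {A i : ℕ} {u v : V} {w : ℕ} (h : W u v = w) :
    roundW A i W u v = roundWeight A i w := by
  simp [roundW, h]

theorem one_le_roundW (A i : ℕ) (u v : V) : 1 ≤ roundW A i W u v := by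
  unfold roundW
  split_ifs
  · exact le_top
  · exact one_le_roundWeight _ _ _

theorem Path.of_roundW {A i : ℕ} {u v : V} {e j : ℕ} (h : Path (roundW A i W) u v e j) :
    ∃ c, Path W u v c j ∧ A * c ≤ unround i e := by
  induction h with
  | nil => exact ⟨0, .nil, by simp⟩
  | snoc _ hr ih =>
    obtain ⟨c, hp, hc⟩ := ih
    obtain ⟨w, hw, hr⟩ := roundW_eq_coe hr
    refine ⟨c + w, hp.snoc hw, ?_⟩
    rw [mul_add, unround_add]
    exact add_le_add hc (le_unround hr)

/-- `e` is a good enough rounded length, for a walk of length `c` with `j` edges. -/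
def RoundBound (A i c j e : ℕ) : Prop :=
  if i = 0 then c = 0 ∧ e = j else 2 ^ (i - 1) * e ≤ A * c + j * 2 ^ (i - 1)

theorem exists_roundBound_weight {A i w c : ℕ} (hi : i = Nat.size c) (hw : w ≤ c) :
    ∃ r, roundWeight A i w = (r : ℕ) ∧ RoundBound A i w 1 r := by
  unfold roundWeight RoundBound
  by_cases h1 : i = 0
  · have : c = 0 := by rw [← Nat.size_eq_zero]; omega
    have hw0 : w = 0 := by omega
    exact ⟨1, by simp [h1, hw0], by simp [h1, hw0]⟩
  · simp only [if_neg h1]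
    refine ⟨_, rfl, ?_⟩
    rw [mul_add, mul_one, one_mul]
    have := Nat.mul_div_le (w * A) (2 ^ (i - 1))
    rw [mul_comm A]
    omega

theorem RoundBound.add {A i c j e c' j' e' : ℕ} (h : RoundBound A i c j e)
    (h' : RoundBound A i c' j' e') : RoundBound A i (c + c') (j + j') (e + e') := by
  unfold RoundBound at *
  split_ifs at *
  · omega
  · rw [mul_add, mul_add, add_mul]; omega

theorem Path.exists_roundW {A i c₀ : ℕ} (hi : i = Nat.size c₀) {u v : V} {c j : ℕ}
    (h : Path W u v c j) (hc : c ≤ c₀) :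
    ∃ e, Path (roundW A i W) u v e j ∧ RoundBound A i c j e := by
  induction h with
  | nil => exact ⟨0, .nil, by unfold RoundBound; split_ifs <;> simp⟩
  | @snoc v z c w j _ hw ih =>
    obtain ⟨e, hp, he⟩ := ih (by omega)
    obtain ⟨r, hr, hb⟩ := exists_roundBound_weight (A := A) hi (show w ≤ c₀ by omega)
    exact ⟨e + r, hp.snoc (by rw [roundW_of_coe hw, hr]), he.add hb⟩

/-- At the scale of `c`, one has 2^(i−1) ≤ c < 2^i. The upper bound keeps the rounded length within
2A + h; the lower bound turns the rounding error of one unit per edge into the relative error h/A.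
Length zero has its own scale, on which the result is exact. -/
theorem RoundBound.le {A h c j e : ℕ} (hb : RoundBound A (Nat.size c) c j e) (hj : j ≤ h) :
    e ≤ 2 * A + h ∧ unround (Nat.size c) e ≤ (A + h) * c := by
  unfold RoundBound at hb
  unfold unround
  split_ifs at hb ⊢ with h0
  · omega
  · have hc0 : c ≠ 0 := fun h => h0 (by rw [h]; simp)
    have h1 : c < 2 ^ Nat.size c := Nat.lt_size_self c
    have h2 : 2 ^ (Nat.size c - 1) ≤ c := by
      rw [← Nat.lt_size]; omega
    have h3 : 2 ^ Nat.size c = 2 * 2 ^ (Nat.size c - 1) := by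
      rw [← pow_succ', show Nat.size c - 1 + 1 = Nat.size c by omega]
    set p := 2 ^ (Nat.size c - 1)
    have hp : 0 < p := by positivity
    constructor
    · have : p * e ≤ p * (2 * A + h) := by
        calc p * e ≤ A * c + j * p := hb
          _ ≤ A * (2 * p) + h * p :=
            add_le_add (Nat.mul_le_mul_left _ (by omega)) (Nat.mul_le_mul_right _ hj)
          _ = _ := by ring
      exact Nat.le_of_mul_le_mul_left this hp
    · calc p * e ≤ A * c + j * p := hb
        _ ≤ A * c + h * c := add_le_add le_rfl (Nat.mul_le_mul hj h2)
        _ = _ := by ring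

end Levels

/-! ### Encoding of messages -/

/-- The natural number with the given binary digits. -/
def ofBits (l : List Bool) : ℕ := l.foldr Nat.bit 0

theorem ofBits_bits (n : ℕ) : ofBits n.bits = n := by
  induction n using Nat.binaryRec' with
  | zero => simp [ofBits]
  | bit b n h ih =>
    rw [Nat.bits_append_bit n b h]
    simpa [ofBits] using congrArg (Nat.bit b) ih

/-- A message consists of two numbers and an optional pair of numbers. -/
abbrev Msg := ℕ × ℕ × Option (ℕ × ℕ)

/-- The encoding of an optional pair by a number. -/
def encPair : Option (ℕ × ℕ) → ℕ
  | none => 0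
  | some p => Nat.pair p.1 p.2 + 1

/-- The inverse of `encPair`. -/
def decPair (k : ℕ) : Option (ℕ × ℕ) := if k = 0 then none else some (Nat.unpair (k - 1))

theorem decPair_encPair (x : Option (ℕ × ℕ)) : decPair (encPair x) = x := by
  cases x <;> simp [encPair, decPair]

/-- The encoding of a message by a number. -/
def Msg.code (x : Msg) : ℕ := Nat.pair x.1 (Nat.pair x.2.1 (encPair x.2.2))

/-- The encoding of a message by bits. -/
def encMsg (x : Msg) : List Bool := x.code.bits

/-- The inverse of `encMsg`. -/
def decMsg (l : List Bool) : Msg :=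
  ((Nat.unpair (ofBits l)).1, (Nat.unpair (Nat.unpair (ofBits l)).2).1,
    decPair (Nat.unpair (Nat.unpair (ofBits l)).2).2)

theorem decMsg_encMsg (x : Msg) : decMsg (encMsg x) = x := by
  simp [decMsg, encMsg, ofBits_bits, Msg.code, decPair_encPair]

theorem decMsg_nil : decMsg [] = (0, 0, none) := by
  simp [decMsg, ofBits, decPair]

/-- Three nested pairings, each of which at most squares the size, stay below (X + 2)^8. -/
theorem encMsg_length_le {x : Msg} {X e : ℕ} (h₁ : x.1 ≤ X) (h₂ : x.2.1 ≤ X)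
    (h₃ : ∀ p ∈ x.2.2, p.1 ≤ X ∧ p.2 ≤ X) (hX : X + 2 ≤ 2 ^ e) : (encMsg x).length ≤ 8 * e := by
  have hpair : ∀ {a b Y : ℕ}, a ≤ Y → b ≤ Y → Nat.pair a b + 1 ≤ (Y + 1) ^ 2 := by
    intro a b Y ha hb
    refine (Nat.pair_lt_max_add_one_sq a b).trans_le (Nat.pow_le_pow_left ?_ 2)
    have := max_le ha hb
    omega
  have h4 : encPair x.2.2 ≤ (X + 1) ^ 2 := by
    rcases hx : x.2.2 with _ | p
    · simp [encPair]
    · have := h₃ p (by simp [hx])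
      exact hpair this.1 this.2
  have h5 : Nat.pair x.2.1 (encPair x.2.2) + 1 ≤ ((X + 1) ^ 2 + 1) ^ 2 :=
    hpair (h₂.trans (by nlinarith)) h4
  have h6 : x.code + 1 ≤ (((X + 1) ^ 2 + 1) ^ 2 + 1) ^ 2 :=
    hpair (h₁.trans (by nlinarith [Nat.zero_le X])) (by omega)
  have h7 : (X + 1) ^ 2 + 1 ≤ (X + 2) ^ 2 := by nlinarith
  have h8 : ((X + 1) ^ 2 + 1) ^ 2 + 1 ≤ (X + 2) ^ 4 := by
    have : (X + 2) ^ 2 = (X + 1) ^ 2 + 1 + (2 * X + 2) := by ring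
    have h9 : (X + 2) ^ 4 = ((X + 2) ^ 2) ^ 2 := by ring
    rw [h9, this]
    nlinarith [Nat.zero_le ((X + 1) ^ 2)]
  have h10 : x.code < 2 ^ (8 * e) := by
    calc x.code < (((X + 1) ^ 2 + 1) ^ 2 + 1) ^ 2 := h6
      _ ≤ ((X + 2) ^ 4) ^ 2 := Nat.pow_le_pow_left h8 2
      _ = (X + 2) ^ 8 := by ring
      _ ≤ (2 ^ e) ^ 8 := Nat.pow_le_pow_left hX 8
      _ = _ := by rw [← pow_mul]; ring_nf
  rw [encMsg, Nat.size_eq_bits_len]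
  exact Nat.size_le.mpr h10

/-! ### The algorithm -/

/-- What all vertices know after the exploration of the network: the number `n` of vertices and the
eccentricity `E` of the source. The numbers `a`, `b` and `τ` are constants. -/
structure Params where
  a : ℕ
  b : ℕ
  τ : ℕ
  n : ℕ
  E : ℕ

namespace Params

variable (P : Params)

/-- The number of bits of the distances. -/
def I : ℕ := (P.a + 1) * Nat.clog 2 P.n
/-- The expected number of sampled vertices. -/
def g : ℕ := Nat.sqrt (Nat.sqrt P.n) + 1
/-- The slack that makes failures unlikely. -/
def t : ℕ := P.τ * Nat.clog 2 P.n
/-- The number of edges within which a sampled vertex is expected. -/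
def h : ℕ := min ((P.n / P.g + 1) * P.t) P.n
/-- The precision of rounded weights. -/
def A : ℕ := 2 * P.I * P.h
/-- The range of the pipelined searches. -/
def K : ℕ := 2 * P.A + P.h + 2 * P.E
/-- A bound on the number of sampled vertices. -/
def m : ℕ := 2 * P.g + 2 * P.t
/-- The number of rounds of a phase. -/
def R : ℕ := P.K + (P.m + 1) ^ 2 + 1
/-- A bound on the approximate distances. -/
def cap : ℕ := 2 ^ P.I * P.K
/-- A bound on the labels. -/
def Λ : ℕ := ((P.n ^ P.b + 2) ^ 2 + P.cap + 1) ^ 2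
/-- The number of iterations of the outer loop. -/
def J : ℕ := 8 * (P.I + 1)
/-- The threshold for approximate distances, in units of `1 / (4 * I)`. -/
def thr (i : ℕ) : ℕ := if i < P.I then 2 ^ (P.I - i) * (2 * P.I - i) else 0

end Params

/-- The memory of a vertex between two phases: its potential, its level, whether it is sampled,
potentials and levels of its neighbours, and the approximate distances from sampled vertices. -/
structure Mem where
  phi : ℕ
  lev : ℕ
  coin : Bool
  nbr : ℕ → ℕ × ℕ
  acc : ℕ → ℕ∞

/-- The label for the information that `y` has the approximate distance `e` for the label `k`. -/
def item (y k e : ℕ) : ℕ := Nat.pair (Nat.pair y k) e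

section Local

variable (P : Params) (inp : LocalInput)

/-- The reduced weight of the link from the neighbour `u`. -/
def redWeight (mem : Mem) (u : ℕ) : ℕ := inp.weightFrom u + (mem.nbr u).1 - mem.phi

open Classical in
/-- The initial table of a vertex in the phase `p`. -/
noncomputable def initTable (p : ℕ) (mem : Mem) (l : ℕ) : ℕ∞ :=
  if p = 0 then ⊤
  else if p ≤ P.I + 2 then
    -- Label 0 stands for the lower layers; a sampled vertex `x` uses the label `x + 1`.
    if l = 0 then
      ⨅ u ∈ inp.neighbors.filter fun u => (mem.nbr u).2 < mem.lev,
        roundWeight P.A (p - 1) (redWeight inp mem u)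
    else if l = inp.id + 1 ∧ mem.coin then 0 else ⊤
  else if mem.coin ∧ ∃ k e : ℕ, mem.acc k = e ∧ l = item inp.id k e then 0 else ⊤

/-- The weight of the link from `u` in the phase `p`. -/
noncomputable def linkWeight (p : ℕ) (mem : Mem) (u : ℕ) : ℕ∞ :=
  if u ∈ inp.neighbors then
    if p = 0 ∨ P.I + 2 < p then 1
    else if (mem.nbr u).2 = mem.lev then roundWeight P.A (p - 1) (redWeight inp mem u) else ⊤
  else ⊤

open Classical in
/-- What a vertex knows after the broadcast about the approximate distances of the vertex `y`. -/
noncomputable def known (mem : Mem) (est : ℕ → ℕ∞) (y k : ℕ) : ℕ∞ :=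
  -- Only sampled vertices broadcast; an unsampled vertex can still be the end of an overlay walk,
  -- by means of its own table.
  if y = inp.id then mem.acc k else ⨅ (e : ℕ) (_ : est (item y k e) ≠ ⊤), (e : ℕ∞)

/-- The vertex is found to be close to the lower levels. -/
def Near (i : ℕ) (mem : Mem) (est : ℕ → ℕ∞) : Prop :=
  ∃ e, Attains (fun x y => known inp mem est y (x + 1)) (fun y => known inp mem est y 0) inp.id e ∧
    4 * P.I * e ≤ P.A * P.thr i

open Classical in
/-- The level after the refinement number `i`. -/
noncomputable def newLevel (i : ℕ) (mem : Mem) (est : ℕ → ℕ∞) : ℕ :=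
  -- The last test, with threshold 0, does not halve the layers any more.
  (if i < P.I then 2 else 1) * mem.lev - if Near P inp i mem est then 1 else 0

/-- The memory after the phase `p`, where `est` are the final estimates, `pubs` are the potentials
and the levels of the neighbours, and `c` is a fresh coin. -/
noncomputable def finish (i p : ℕ) (mem : Mem) (est : ℕ → ℕ∞) (pubs : ℕ → ℕ × ℕ) (c : Bool) : Mem :=
  if p = 0 then { mem with nbr := pubs, acc := fun _ => ⊤ }
  else if p ≤ P.I + 2 then
    { mem with
      acc := fun l => mem.acc l ⊓ if est l ≤ P.K then (unround (p - 1) (est l).toNat : ℕ) else ⊤ }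
  else if i < P.I then { mem with lev := newLevel P inp i mem est, coin := c }
  else { mem with
    phi := mem.phi + (newLevel P inp i mem est + 7) / 8
    lev := if inp.isSource then 0 else 1
    coin := c }

/-- The memory at the beginning. -/
def startMem (c : Bool) : Mem where
  phi := 0
  lev := if inp.isSource then 0 else 1
  coin := c
  nbr _ := (0, 0)
  acc _ := ⊤

end Local

/-- The state of a vertex while it explores the network. -/
structure Explore where
  inp : LocalInput
  time : ℕ
  reached : Bool
  parent : Option ℕ
  mass : ℕ
  total : ℕ
  fin : Option (ℕ × ℕ)

/-- The state of a vertex after the exploration of the network: it is in the round `j` of the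
phase `p` of the refinement number `i` of the iteration number `o`. -/
structure Work where
  inp : LocalInput
  n : ℕ
  E : ℕ
  o : ℕ
  i : ℕ
  p : ℕ
  j : ℕ
  mem : Mem
  pipe : PipeState

/-- The state of a vertex. -/
inductive St where
  | explore (s : Explore)
  | work (s : Work)

/-- The state at the beginning. -/
def Explore.start (inp : LocalInput) : Explore where
  inp := inp
  time := 0
  reached := inp.isSource
  parent := none
  mass := if inp.isSource then 1 else 0
  total := if inp.isSource then 1 else 0
  fin := none

/-- The message to the neighbour `i`. -/
def Explore.msg (s : Explore) (i : ℕ) : Msg :=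
  (if s.reached then 1 else 0, if s.parent = some i then s.mass else 0, s.fin)

open Classical in
/-- One round of the exploration. -/
noncomputable def Explore.advance (s : Explore) (inb : ℕ → Msg) : Explore :=
  let hit := s.inp.neighbors.filter fun i => (inb i).1 = 1
  let mass := (∑ i ∈ s.inp.neighbors, (inb i).2.1) +
    if s.reached = false ∧ hit.Nonempty then 1 else 0
  { inp := s.inp
    time := s.time + 1
    reached := s.reached || decide hit.Nonempty
    parent := if s.reached then s.parent else if h : hit.Nonempty then some (hit.min' h) else none
    mass := mass
    total := s.total + mass
    fin := if s.fin.isSome then s.fin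
      -- The mass that arrives at the even time 2j is the size of the layer at hop-distance j, so
      -- the first zero occurs at time 2(E + 1).
      else if s.inp.isSource ∧ Even (s.time + 1) ∧ mass = 0 then
        some (s.total + mass, (s.time + 1) / 2 - 1)
      else if h : ∃ x, ∃ i ∈ s.inp.neighbors, (inb i).2.2 = some x then some h.choose else none }

namespace Work

variable (a b τ : ℕ) (s : Work)

/-- The parameters that the vertex uses. -/
def params : Params := ⟨a, b, τ, s.n, s.E⟩

/-- The message to all neighbours. -/
noncomputable def msg : Msg :=
  -- Clipping bounds the message even in executions whose samples have failed; otherwise it has no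
  -- effect.
  (min s.mem.phi (2 ^ (s.params a b τ).I), min s.mem.lev (2 ^ (s.params a b τ).I),
    s.pipe.pick (s.params a b τ).K (s.params a b τ).Λ)

/-- The state at the beginning of a phase. -/
noncomputable def start (P : Params) (inp : LocalInput) (o i p : ℕ) (mem : Mem) : Work where
  inp := inp
  n := P.n
  E := P.E
  o := o
  i := i
  p := p
  j := 0
  mem := mem
  pipe := ⟨initTable P inp p mem, fun _ => ⊤⟩

/-- One round. -/
noncomputable def advance (inb : ℕ → Msg) (c : Bool) : Work :=
  let P := s.params a b τ
  let q := s.pipe.step P.K P.Λ (linkWeight P s.inp s.p s.mem) fun i => (inb i).2.2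
  if s.j + 1 < P.R then { s with j := s.j + 1, pipe := q }
  else
    let mem := finish P s.inp s.i s.p s.mem q.est (fun i => ((inb i).1, (inb i).2.1)) c
    if s.p < P.I + 3 then start P s.inp s.o s.i (s.p + 1) mem
    else if s.i < P.I then start P s.inp s.o (s.i + 1) 0 mem
    else start P s.inp (s.o + 1) 0 0 mem

variable {a b τ s}

theorem advance_of_lt {inb : ℕ → Msg} {c : Bool} (h : s.j + 1 < (s.params a b τ).R) :
    s.advance a b τ inb c =
      { s with
        j := s.j + 1
        pipe := s.pipe.step (s.params a b τ).K (s.params a b τ).Λ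
          (linkWeight (s.params a b τ) s.inp s.p s.mem) fun i => (inb i).2.2 } :=
  if_pos h

theorem advance_of_not_lt {inb : ℕ → Msg} {c : Bool} (h : ¬ s.j + 1 < (s.params a b τ).R)
    {est : ℕ → ℕ∞} {mem : Mem}
    (hest : (s.pipe.step (s.params a b τ).K (s.params a b τ).Λ
      (linkWeight (s.params a b τ) s.inp s.p s.mem) fun i => (inb i).2.2).est = est)
    (hmem : finish (s.params a b τ) s.inp s.i s.p s.mem est
      (fun i => ((inb i).1, (inb i).2.1)) c = mem) :
    s.advance a b τ inb c =
      if s.p < (s.params a b τ).I + 3 then start (s.params a b τ) s.inp s.o s.i (s.p + 1) mem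
      else if s.i < (s.params a b τ).I then start (s.params a b τ) s.inp s.o (s.i + 1) 0 mem
      else start (s.params a b τ) s.inp (s.o + 1) 0 0 mem := by
  subst hest hmem
  exact if_neg h

end Work

namespace St

variable (a b τ : ℕ)

/-- The message to the neighbour `i`. -/
noncomputable def msg (σ : St) (i : ℕ) : Msg :=
  match σ with
  | explore s => s.msg i
  | work s => s.msg a b τ

/-- The next state, where `inb` is the inbox and `c` a fresh coin. -/
noncomputable def advance (σ : St) (inb : ℕ → Msg) (c : Bool) : St :=
  match σ with
  | explore s =>
    match s.fin with
    | none => explore (s.advance inb)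
    -- A vertex at depth k learns (n, E) at time 2E + 2 + k, so by now all vertices have learned it
    -- and they switch in the same round.
    | some x => if s.time = 3 * x.2 + 2 then
        work (Work.start ⟨a, b, τ, x.1, x.2⟩ s.inp 0 0 0 (startMem s.inp c))
      else explore (s.advance inb)
  | work s => work (s.advance a b τ inb c)

/-- The bias of the coin: the probability with which a vertex is sampled. -/
noncomputable def bias (σ : St) : NNReal :=
  match σ with
  | explore s =>
    match s.fin with
    | none => 0
    | some x => (Params.g ⟨a, b, τ, x.1, x.2⟩ : NNReal) / x.1
  | work s => ((s.params a b τ).g : NNReal) / s.n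

/-- The output, if the vertex has halted. -/
noncomputable def output (σ : St) : Option ℕ :=
  match σ with
  | explore _ => none
  | work s => if s.o = (s.params a b τ).J then some s.mem.phi else none

end St

/-- The algorithm for exact distances from the source. -/
noncomputable def ssspAlgorithm (a b τ : ℕ) : Algorithm where
  State := St
  init inp := PMF.pure (.explore (.start inp))
  send σ i := encMsg (σ.msg a b τ i)
  step σ inb := (coin (σ.bias a b τ)).map (σ.advance a b τ fun i => decMsg (inb i))
  output σ := σ.output a b τ

/-! ### One round of the algorithm -/

namespace Algorithm

variable {A : Algorithm} {N : Network}

theorem Holds.of_support {r : ℕ} {G G' : Set (N.ids → A.State)} {ε : ℝ≥0∞} (h : A.Holds N r G ε)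
    (hs : ∀ σ ∈ G, ∀ f : N.ids → A.State, (∀ v, f v ∈ (A.next N σ v).support) → f ∈ G') :
    A.Holds N (r + 1) G' ε := by
  rw [← add_zero ε]
  refine h.step fun σ hσ => le_of_eq ?_
  rw [PMF.toOuterMeasure_apply_eq_zero_iff, Set.disjoint_compl_right_iff_subset]
  exact fun f hf => hs σ hσ f (mem_support_indep.mp hf)

theorem Holds.map_step {r : ℕ} {G G' : Set (N.ids → A.State)} {ε δ : ℝ≥0∞} {q : NNReal}
    (h : A.Holds N r G ε) (f : (N.ids → A.State) → N.ids → Bool → A.State)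
    (hf : ∀ σ ∈ G, ∀ v, A.next N σ v = (coin q).map (f σ v))
    (hδ : ∀ σ ∈ G, (indep fun _ : N.ids => coin q).toOuterMeasure
      {ω | (fun v => f σ v (ω v)) ∉ G'} ≤ δ) : A.Holds N (r + 1) G' (ε + δ) := by
  refine h.step fun σ hσ => ?_
  rw [show A.next N σ = fun v => (coin q).map (f σ v) from funext (hf σ hσ), indep_map,
    PMF.toOuterMeasure_map_apply]
  exact hδ σ hσ

theorem Holds.support_subset {r : ℕ} {G : Set (N.ids → A.State)} (h : A.Holds N r G 0) :
    (A.run N r).support ⊆ G := by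
  have := (PMF.toOuterMeasure_apply_eq_zero_iff _ _).mp (nonpos_iff_eq_zero.mp h)
  exact Set.disjoint_compl_right_iff_subset.mp this

end Algorithm

section Rounds

variable {a b τ : ℕ} {N : Network}

/-- The messages that the vertex `v` receives. -/
noncomputable def inMsgs (a b τ : ℕ) (N : Network) (σ : N.ids → St) (v : N.ids) : ℕ → Msg :=
  fun i => decMsg ((ssspAlgorithm a b τ).inbox N σ v i)

theorem inMsgs_of_adj {σ : N.ids → St} {u v : N.ids} (h : N.graph.Adj v u)
    (hu : (σ u).output a b τ = none) : inMsgs a b τ N σ v u = (σ u).msg a b τ v := by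
  unfold inMsgs Algorithm.inbox Network.table
  rw [dif_pos ⟨u.2, h⟩]
  simp only [Algorithm.message, ssspAlgorithm, Subtype.coe_eta, hu]
  simpa using decMsg_encMsg _

theorem inMsgs_of_not_adj {σ : N.ids → St} {v : N.ids} {i : ℕ}
    (h : ¬ ∃ hi : i ∈ N.ids, N.graph.Adj v ⟨i, hi⟩) : inMsgs a b τ N σ v i = (0, 0, none) := by
  unfold inMsgs Algorithm.inbox Network.table
  rw [dif_neg h]
  exact decMsg_nil

/-- The next global state, where `ω` are the coins. -/
noncomputable def nextState (a b τ : ℕ) (N : Network) (σ : N.ids → St) (ω : N.ids → Bool)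
    (v : N.ids) : St :=
  (σ v).advance a b τ (inMsgs a b τ N σ v) (ω v)

theorem next_eq_map {σ : N.ids → St} {v : N.ids} (h : (σ v).output a b τ = none) :
    (ssspAlgorithm a b τ).next N σ v =
      (coin ((σ v).bias a b τ)).map ((σ v).advance a b τ (inMsgs a b τ N σ v)) := by
  unfold Algorithm.next
  simp only [ssspAlgorithm, h]
  rfl

theorem Algorithm.Holds.random {r : ℕ} {G G' : Set (N.ids → St)} {ε δ : ℝ≥0∞} {q : NNReal}
    (h : (ssspAlgorithm a b τ).Holds N r G ε)
    (hG : ∀ σ ∈ G, (∀ v, (σ v).output a b τ = none ∧ (σ v).bias a b τ = q) ∧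
      (indep fun _ : N.ids => coin q).toOuterMeasure {ω | nextState a b τ N σ ω ∉ G'} ≤ δ) :
    (ssspAlgorithm a b τ).Holds N (r + 1) G' (ε + δ) := by
  refine h.map_step (q := q)
    (fun σ v => St.advance a b τ (σ v) (inMsgs a b τ N σ v)) (fun σ hσ v => ?_)
    fun σ hσ => (hG σ hσ).2
  rw [← ((hG σ hσ).1 v).2]
  exact next_eq_map ((hG σ hσ).1 v).1

theorem mem_support_next {σ : N.ids → St} {v : N.ids} {x : St}
    (h : x ∈ ((ssspAlgorithm a b τ).next N σ v).support) :
    x = σ v ∨ ∃ c, x = (σ v).advance a b τ (inMsgs a b τ N σ v) c := by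
  rcases ho : (σ v).output a b τ with _ | y
  · rw [next_eq_map ho] at h
    obtain ⟨c, -, hc⟩ := (PMF.mem_support_map_iff _ _ _).mp h
    exact Or.inr ⟨c, hc.symm⟩
  · left
    unfold Algorithm.next at h
    simp only [ssspAlgorithm, ho, Option.isSome_some, if_true, PMF.support_pure] at h
    exact h

theorem Algorithm.Holds.deterministic {r : ℕ} {G G' : Set (N.ids → St)} {ε : ℝ≥0∞}
    (h : (ssspAlgorithm a b τ).Holds N r G ε)
    (hG : ∀ σ ∈ G, (∀ v, (σ v).output a b τ = none) ∧ ∀ ω, nextState a b τ N σ ω ∈ G') :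
    (ssspAlgorithm a b τ).Holds N (r + 1) G' ε := by
  refine h.of_support fun σ hσ f hf => ?_
  have : ∀ v, ∃ c, f v = (σ v).advance a b τ (inMsgs a b τ N σ v) c := by
    intro v
    have := hf v
    rw [next_eq_map ((hG σ hσ).1 v)] at this
    obtain ⟨c, -, hc⟩ := (PMF.mem_support_map_iff _ _ _).mp this
    exact ⟨c, hc.symm⟩
  choose ω hω using this
  rw [show f = nextState a b τ N σ ω from funext hω]
  exact (hG σ hσ).2 ω

open Classical in
theorem mem_neighbors {v : N.ids} {i : ℕ} :
    i ∈ (N.localInput v).neighbors ↔ ∃ hi : i ∈ N.ids, N.graph.Adj v ⟨i, hi⟩ := by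
  simp only [Network.localInput, Finset.mem_filter, and_iff_right_iff_imp]
  exact fun h => h.1

theorem coe_mem_neighbors {u v : N.ids} :
    (u : ℕ) ∈ (N.localInput v).neighbors ↔ N.graph.Adj v u := by
  rw [mem_neighbors]
  exact ⟨fun h => h.2, fun h => ⟨u.2, h⟩⟩

open Classical in
theorem sum_neighbors (v : N.ids) (F : ℕ → ℕ) :
    ∑ i ∈ (N.localInput v).neighbors, F i = ∑ u : N.ids, if N.graph.Adj v u then F u else 0 := by
  rw [← Finset.sum_filter]
  symm
  refine Finset.sum_bij (fun u _ => (u : ℕ)) ?_ ?_ ?_ ?_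
  · intro u hu
    rw [coe_mem_neighbors]
    simpa using hu
  · intro u _ v _ h
    exact Subtype.ext h
  · intro i hi
    obtain ⟨h1, h2⟩ := mem_neighbors.mp hi
    exact ⟨⟨i, h1⟩, by simpa using h2, rfl⟩
  · intro u _
    rfl

end Rounds

/-! ### Exploration of the network -/

namespace Network

variable (N : Network)

/-- The hop-distance from the source. -/
noncomputable def depth (v : N.ids) : ℕ := N.graph.dist N.source v

/-- The eccentricity of the source. -/
noncomputable def ecc : ℕ := Finset.univ.sup N.depth

open Classical in
/-- The number of vertices at hop-distance `j` from the source. -/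
noncomputable def layer (j : ℕ) : ℕ := (Finset.univ.filter fun v => N.depth v = j).card

open Classical in
/-- The identifiers of the neighbours of `v` that are closer to the source. -/
noncomputable def hitIds (v : N.ids) : Finset ℕ :=
  (N.localInput v).neighbors.filter fun i => ∃ hi : i ∈ N.ids, N.depth ⟨i, hi⟩ + 1 = N.depth v

open Classical in
/-- The identifier of the parent in a breadth-first search tree. -/
noncomputable def parentId (v : N.ids) : Option ℕ :=
  if h : (N.hitIds v).Nonempty then some ((N.hitIds v).min' h) else none

open Classical in
/-- The mass of a vertex at time `t`: every vertex emits one unit when it is reached, which then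
moves up the tree. -/
noncomputable def mass : ℕ → N.ids → ℕ
  | 0, v => if v = N.source then 1 else 0
  | t + 1, v => (∑ u, if N.graph.Adj v u then (if N.parentId u = some (v : ℕ) then mass t u else 0)
      else 0) + if N.depth v = t + 1 then 1 else 0

variable {N}

theorem depth_source : N.depth N.source = 0 := SimpleGraph.dist_self

theorem depth_le_ecc (v : N.ids) : N.depth v ≤ N.ecc := Finset.le_sup (Finset.mem_univ v)

theorem parentId_eq_some {u v : N.ids} (h : N.parentId u = some (v : ℕ)) :
    N.graph.Adj u v ∧ N.depth u = N.depth v + 1 := by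
  classical
  unfold parentId at h
  split_ifs at h with hn
  have h1 : (N.hitIds u).min' hn = v := Option.some_injective _ h
  have h2 := Finset.min'_mem _ hn
  rw [h1] at h2
  unfold hitIds at h2
  rw [Finset.mem_filter, coe_mem_neighbors] at h2
  obtain ⟨h3, hi, h4⟩ := h2
  exact ⟨h3, h4.symm⟩

theorem sum_layer {j : ℕ} (h : N.ecc < j) : ∑ i ∈ Finset.range j, N.layer i = N.size := by
  classical
  unfold layer
  rw [← Finset.card_eq_sum_card_fiberwise (s := (Finset.univ : Finset N.ids)) (f := N.depth)]
  · simp [size]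
  · intro v _
    simpa using (depth_le_ecc v).trans_lt h

theorem layer_eq_zero {j : ℕ} (h : N.ecc < j) : N.layer j = 0 := by
  classical
  unfold layer
  rw [Finset.card_eq_zero, Finset.filter_eq_empty_iff]
  intro v _ hv
  have := depth_le_ecc v
  omega

theorem mass_eq_zero {t : ℕ} {v : N.ids} (h : t < N.depth v) : N.mass t v = 0 := by
  classical
  induction t generalizing v with
  | zero =>
    have : v ≠ N.source := by
      rintro rfl
      simp [depth_source] at h
    simp [mass, this]
  | succ t ih =>
    unfold mass
    rw [if_neg (by omega), add_zero]
    refine Finset.sum_eq_zero fun u _ => ?_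
    split_ifs with h1 h2
    · exact ih (by have := (parentId_eq_some h2).2; omega)
    all_goals rfl

/-! ### Counting the vertices by sending masses up the breadth-first tree -/

section

variable (hN : N.graph.Connected)
include hN

theorem depth_eq_zero {v : N.ids} : N.depth v = 0 ↔ v = N.source := by
  unfold depth
  rw [hN.dist_eq_zero_iff]
  exact eq_comm

theorem depth_le_of_adj {u v : N.ids} (h : N.graph.Adj u v) : N.depth v ≤ N.depth u + 1 := by
  have := hN.dist_triangle (u := N.source) (v := u) (w := v)
  rwa [SimpleGraph.dist_eq_one_iff_adj.mpr h] at this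

theorem exists_depth_pred {v : N.ids} {k : ℕ} (h : N.depth v = k + 1) :
    ∃ u, N.graph.Adj v u ∧ N.depth u = k := by
  obtain ⟨p, hp⟩ := hN.exists_walk_length_eq_dist v N.source
  have h0 : p.length = k + 1 := by rw [hp, SimpleGraph.dist_comm]; exact h
  cases p with
  | nil => simp at h0
  | @cons _ u _ hadj q =>
    refine ⟨u, hadj, ?_⟩
    have h1 : q.length = k := by simpa using h0
    have h2 : N.depth u ≤ k := by
      unfold depth
      rw [SimpleGraph.dist_comm, ← h1]
      exact SimpleGraph.dist_le q
    have := depth_le_of_adj hN hadj.symm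
    omega

theorem exists_parentId {u : N.ids} {k : ℕ} (h : N.depth u = k + 1) :
    ∃ v : N.ids, N.parentId u = some (v : ℕ) := by
  classical
  obtain ⟨w, hw, hk⟩ := exists_depth_pred hN h
  have hn : (N.hitIds u).Nonempty := by
    refine ⟨w, ?_⟩
    unfold hitIds
    rw [Finset.mem_filter, coe_mem_neighbors]
    exact ⟨hw, w.2, by rw [h, ← hk]⟩
  have h2 := Finset.min'_mem _ hn
  unfold hitIds at h2
  rw [Finset.mem_filter] at h2
  obtain ⟨-, hi, -⟩ := h2
  exact ⟨⟨_, hi⟩, by unfold parentId; rw [dif_pos hn]; rfl⟩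

open Classical in
-- A unit emitted at depth D starts at time D and climbs one step per round, so at time t it is at
-- depth 2D − t. Hence depth d holds exactly the units with D = (t + d)/2.
theorem sum_mass (t d : ℕ) :
    ∑ v, (if N.depth v = d then N.mass t v else 0) =
      if d ≤ t ∧ (t - d) % 2 = 0 then N.layer ((t + d) / 2) else 0 := by
  induction t generalizing d with
  | zero =>
    unfold mass
    by_cases hd : d = 0
    · subst hd
      have : N.layer 0 = 1 := by
        unfold layer
        simp [depth_eq_zero hN, Finset.filter_eq']
      simp [depth_eq_zero hN, this]
    · rw [if_neg (by omega)]
      refine Finset.sum_eq_zero fun v _ => ?_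
      split_ifs with h1 h2
      · subst h2
        exact absurd (h1.symm.trans depth_source) hd
      all_goals rfl
  | succ t ih =>
    have h1 : ∀ u, (∑ v, if N.depth v = d then (if N.graph.Adj v u then
        (if N.parentId u = some (v : ℕ) then N.mass t u else 0) else 0) else 0) =
        if N.depth u = d + 1 then N.mass t u else 0 := by
      intro u
      split_ifs with hu
      · obtain ⟨p, hp⟩ := exists_parentId hN hu
        obtain ⟨h2, h3⟩ := parentId_eq_some hp
        rw [Finset.sum_eq_single p]
        · rw [if_pos (by omega), if_pos h2.symm, if_pos hp]
        · intro v _ hv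
          split_ifs with h4 h5 h6
          · exfalso
            rw [hp] at h6
            exact hv (Subtype.ext (Option.some_injective _ h6).symm)
          all_goals rfl
        · simp
      · refine Finset.sum_eq_zero fun v _ => ?_
        split_ifs with h4 h5 h6
        · have := (parentId_eq_some h6).2
          omega
        all_goals rfl
    have h2 : ∑ v, (if N.depth v = d then N.mass (t + 1) v else 0) =
        (∑ u, if N.depth u = d + 1 then N.mass t u else 0) +
          if d = t + 1 then N.layer d else 0 := by
      rw [← Finset.sum_congr rfl fun u _ => h1 u, Finset.sum_comm]
      have h3 : (if d = t + 1 then N.layer d else 0) =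
          ∑ v, if N.depth v = d then (if N.depth v = t + 1 then 1 else 0) else 0 := by
        split_ifs with hd
        · subst hd
          rw [layer, Finset.card_filter]
          refine Finset.sum_congr rfl fun v _ => ?_
          split_ifs <;> rfl
        · symm
          refine Finset.sum_eq_zero fun v _ => ?_
          split_ifs with h4 h5
          · omega
          all_goals rfl
      rw [h3, ← Finset.sum_add_distrib]
      refine Finset.sum_congr rfl fun v _ => ?_
      split_ifs with h4 h5
      · simp [mass, h5]
      · simp [mass, h5]
      · simp
    rw [h2, ih]
    by_cases h3 : d = t + 1
    · subst h3
      rw [if_neg (by omega), if_pos rfl, if_pos (by omega), zero_add]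
      congr 1; omega
    · rw [if_neg h3, add_zero]
      by_cases h4 : d + 1 ≤ t ∧ (t - (d + 1)) % 2 = 0
      · rw [if_pos h4, if_pos (by omega)]
        congr 1; omega
      · rw [if_neg h4, if_neg (by omega)]

theorem mass_source (t : ℕ) :
    N.mass t N.source = if t % 2 = 0 then N.layer (t / 2) else 0 := by
  classical
  have := sum_mass hN t 0
  simp only [depth_eq_zero hN, Finset.sum_ite_eq', Finset.mem_univ, if_true] at this
  simpa using this

theorem layer_pos {j : ℕ} (h : j ≤ N.ecc) : 0 < N.layer j := by
  classical
  have key : ∀ k v, N.depth v = j + k → 0 < N.layer j := by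
    intro k
    induction k with
    | zero =>
      intro v hv
      exact Finset.card_pos.mpr ⟨v, by simpa using hv⟩
    | succ k ih =>
      intro v hv
      obtain ⟨u, -, hu⟩ := exists_depth_pred hN (k := j + k) (by omega)
      exact ih u hu
  obtain ⟨v, -, hv⟩ := Finset.exists_mem_eq_sup (Finset.univ : Finset N.ids)
    ⟨N.source, Finset.mem_univ _⟩ N.depth
  exact key (N.depth v - j) v (by unfold ecc at h; omega)

theorem ecc_lt_size : N.ecc < N.size := by
  rw [← sum_layer (Nat.lt_succ_self _)]
  calc N.ecc < ∑ i ∈ Finset.range (N.ecc + 1), 1 := by simp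
    _ ≤ _ := Finset.sum_le_sum fun i hi => layer_pos hN (by simp at hi; omega)

theorem sum_mass_source (j : ℕ) :
    ∑ k ∈ Finset.range (2 * j + 1), N.mass k N.source = ∑ i ∈ Finset.range (j + 1), N.layer i := by
  induction j with
  | zero => simp [mass_source hN]
  | succ j ih =>
    rw [show 2 * (j + 1) + 1 = 2 * j + 1 + 1 + 1 by ring, Finset.sum_range_succ,
      Finset.sum_range_succ, ih, Finset.sum_range_succ _ (j + 1), mass_source hN, mass_source hN,
      if_neg (by omega), if_pos (by omega)]
    rw [show (2 * j + 1 + 1) / 2 = j + 1 by omega]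
    ring

/-- All the mass at one depth at one time comes from a single layer; this bounds the messages of the
exploration. -/
theorem mass_le (t : ℕ) (v : N.ids) : N.mass t v ≤ N.size := by
  classical
  have h1 : N.mass t v ≤ ∑ u, (if N.depth u = N.depth v then N.mass t u else 0) := by
    refine le_trans ?_ (Finset.single_le_sum (f := fun u =>
      if N.depth u = N.depth v then N.mass t u else 0) (fun _ _ => Nat.zero_le _)
      (Finset.mem_univ v))
    simp
  refine h1.trans ?_
  rw [sum_mass hN]
  split_ifs
  · refine (Finset.card_le_univ _).trans ?_
    simp [size]
  · exact Nat.zero_le _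

end

open Classical in
variable (N) in
/-- The state of the vertex `v` at time `t`. -/
noncomputable def exploreState (t : ℕ) (v : N.ids) : Explore where
  inp := N.localInput v
  time := t
  reached := decide (N.depth v ≤ t)
  parent := if N.depth v ≤ t then N.parentId v else none
  mass := N.mass t v
  total := ∑ k ∈ Finset.range (t + 1), N.mass k v
  fin := if 2 * N.ecc + 2 + N.depth v ≤ t then some (N.size, N.ecc) else none

theorem explore_start (hN : N.graph.Connected) (v : N.ids) :
    Explore.start (N.localInput v) = N.exploreState 0 v := by
  classical
  unfold Explore.start exploreState
  have h1 : (N.localInput v).isSource = decide (v = N.source) := rfl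
  have h2 : N.depth v ≤ 0 ↔ v = N.source := by rw [Nat.le_zero, depth_eq_zero hN]
  congr 1
  · rw [h1]; simp [h2]
  · split_ifs with h
    · rw [h2] at h
      subst h
      unfold parentId
      rw [dif_neg]
      rintro ⟨i, hi⟩
      unfold hitIds at hi
      rw [Finset.mem_filter] at hi
      obtain ⟨-, _, h4⟩ := hi
      rw [depth_source] at h4
      omega
    · rfl
  · simp [h1, mass]
  · simp [h1, mass]
  · rw [if_neg (by omega)]

open Classical in
theorem explore_advance (hN : N.graph.Connected) (t : ℕ) (v : N.ids) {inb : ℕ → Msg}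
    (h : ∀ u, N.graph.Adj v u → inb u = (N.exploreState t u).msg v) :
    (N.exploreState t v).advance inb = N.exploreState (t + 1) v := by
  have hsrc : (N.localInput v).isSource = decide (v = N.source) := rfl
  have hmass : (∑ i ∈ (N.localInput v).neighbors, (inb i).2.1) +
      (if N.depth v = t + 1 then 1 else 0) = N.mass (t + 1) v := by
    rw [sum_neighbors v fun i => (inb i).2.1, mass]
    congr 1
    refine Finset.sum_congr rfl fun u _ => ?_
    by_cases hu : N.graph.Adj v u
    · simp only [if_pos hu, h u hu, Explore.msg, exploreState]
      by_cases h1 : N.depth u ≤ t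
      · simp [h1]
      · simp [h1, mass_eq_zero (not_le.mp h1)]
    · simp [hu]
  have hhit : ((N.localInput v).neighbors.filter fun i => (inb i).1 = 1) =
      (N.localInput v).neighbors.filter fun i => ∃ hi : i ∈ N.ids, N.depth ⟨i, hi⟩ ≤ t := by
    refine Finset.filter_congr fun i hi => ?_
    obtain ⟨h1, h2⟩ := mem_neighbors.mp hi
    have := h ⟨i, h1⟩ h2
    simp only at this
    rw [this]
    simp only [Explore.msg, exploreState, decide_eq_true_eq]
    constructor
    · intro h3
      split_ifs at h3 with h4
      · exact ⟨h1, h4⟩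
    · rintro ⟨h1, h4⟩
      rw [if_pos h4]
  have hhit0 : ¬ N.depth v ≤ t + 1 →
      ¬ ((N.localInput v).neighbors.filter fun i => (inb i).1 = 1).Nonempty := by
    rw [hhit]
    rintro h1 ⟨i, hi⟩
    rw [Finset.mem_filter] at hi
    obtain ⟨h2, h3, h4⟩ := hi
    obtain ⟨h5, h6⟩ := mem_neighbors.mp h2
    have := depth_le_of_adj hN h6.symm
    omega
  have hhit1 : N.depth v = t + 1 →
      ((N.localInput v).neighbors.filter fun i => (inb i).1 = 1) = N.hitIds v := by
    intro hv
    rw [hhit, hitIds]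
    refine Finset.filter_congr fun i hi => ?_
    obtain ⟨h5, h6⟩ := mem_neighbors.mp hi
    have := depth_le_of_adj hN h6.symm
    constructor
    · rintro ⟨h7, h8⟩
      exact ⟨h7, by omega⟩
    · rintro ⟨h7, h8⟩
      exact ⟨h7, by omega⟩
  have hhit2 : N.depth v = t + 1 → (N.hitIds v).Nonempty := by
    intro hv
    obtain ⟨w, hw, hk⟩ := exists_depth_pred hN hv
    refine ⟨w, ?_⟩
    unfold hitIds
    rw [Finset.mem_filter, coe_mem_neighbors]
    exact ⟨hw, w.2, by rw [hv, ← hk]⟩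
  have hcond : (decide (N.depth v ≤ t) = false ∧
      ((N.localInput v).neighbors.filter fun i => (inb i).1 = 1).Nonempty) ↔
      N.depth v = t + 1 := by
    rw [decide_eq_false_iff_not]
    constructor
    · rintro ⟨h1, h2⟩
      by_contra h3
      exact hhit0 (by omega) h2
    · intro h1
      exact ⟨by omega, by rw [hhit1 h1]; exact hhit2 h1⟩
  have hmass' : (∑ i ∈ (N.localInput v).neighbors, (inb i).2.1) +
      (if decide (N.depth v ≤ t) = false ∧
        ((N.localInput v).neighbors.filter fun i => (inb i).1 = 1).Nonempty then 1 else 0) =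
      N.mass (t + 1) v := by
    rw [← hmass]
    congr 1
    simp only [hcond]
  delta exploreState Explore.advance
  dsimp only
  rw [hmass']
  congr 1
  · by_cases h1 : N.depth v ≤ t
    · simp [h1, Nat.le_succ_of_le h1]
    · by_cases h2 : N.depth v = t + 1
      · rw [hhit1 h2]
        simp [h2, hhit2 h2]
      · have := hhit0 (by omega)
        simp [h1, this, show ¬ N.depth v ≤ t + 1 by omega]
  · by_cases h1 : N.depth v ≤ t
    · simp [h1, Nat.le_succ_of_le h1]
    · by_cases h2 : N.depth v = t + 1
      · simp only [hhit1 h2]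
        simp [h2, hhit2 h2, parentId]
      · have := hhit0 (by omega)
        simp only [h1, this, show ¬ N.depth v ≤ t + 1 by omega]
        simp
  · rw [Finset.sum_range_succ _ (t + 1)]
  · by_cases h1 : 2 * N.ecc + 2 + N.depth v ≤ t
    · rw [if_pos h1, if_pos (Nat.le_succ_of_le h1)]
      simp
    rw [if_neg h1]
    simp only [Option.isSome_none, Bool.false_eq_true, if_false]
    have hfin : ∀ x : ℕ × ℕ, (∃ i ∈ (N.localInput v).neighbors, (inb i).2.2 = some x) →
        x = (N.size, N.ecc) ∧ 2 * N.ecc + 2 + N.depth v ≤ t + 1 := by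
      rintro x ⟨i, hi, hx⟩
      obtain ⟨h5, h6⟩ := mem_neighbors.mp hi
      have h7 := h ⟨i, h5⟩ h6
      simp only at h7
      rw [h7] at hx
      simp only [Explore.msg, exploreState] at hx
      split_ifs at hx with h8
      have := depth_le_of_adj hN h6.symm
      exact ⟨(Option.some_injective _ hx).symm, by omega⟩
    by_cases hv : v = N.source
    · subst hv
      rw [depth_source] at h1 ⊢
      simp only [hsrc, decide_true, true_and]
      -- At this time the source sees the first empty layer, and its running total is the number of
      -- vertices; at earlier even times the layer is nonempty.
      by_cases h2 : t + 1 = 2 * N.ecc + 2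
      · rw [if_pos, if_pos (by omega)]
        · have h3 := sum_mass_source hN (N.ecc + 1)
          rw [sum_layer (by omega), Finset.sum_range_succ] at h3
          rw [show 2 * (N.ecc + 1) = t + 1 by omega] at h3
          rw [h3]
          congr 2
          omega
        · rw [h2, mass_source hN, if_pos (by omega)]
          exact ⟨⟨N.ecc + 1, by ring⟩, layer_eq_zero (by omega)⟩
      · rw [if_neg, dif_neg, if_neg (by omega)]
        · rintro ⟨x, hx⟩
          have := (hfin x hx).2
          rw [depth_source] at this
          omega
        · rintro ⟨h3, h4⟩
          rw [Nat.even_iff] at h3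
          rw [mass_source hN, if_pos h3] at h4
          have := layer_pos hN (j := (t + 1) / 2) (by omega)
          omega
    · rw [if_neg (by simp [hsrc, hv])]
      by_cases h2 : 2 * N.ecc + 2 + N.depth v ≤ t + 1
      · have hex : ∃ x, ∃ i ∈ (N.localInput v).neighbors, (inb i).2.2 = some x := by
          obtain ⟨k, hk⟩ := Nat.exists_eq_succ_of_ne_zero (fun h0 => hv ((depth_eq_zero hN).mp h0))
          obtain ⟨u, hu, hd⟩ := exists_depth_pred hN hk
          refine ⟨(N.size, N.ecc), u, coe_mem_neighbors.mpr hu, ?_⟩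
          rw [h u hu]
          simp only [Explore.msg, exploreState]
          rw [if_pos (by omega)]
        rw [dif_pos hex, if_pos h2, (hfin _ hex.choose_spec).1]
      · rw [dif_neg, if_neg h2]
        rintro ⟨x, hx⟩
        exact h2 (hfin x hx).2

end Network

theorem holds_explore {a b τ : ℕ} {N : Network} (hN : N.graph.Connected) (t : ℕ)
    (ht : t ≤ 3 * N.ecc + 2) :
    (ssspAlgorithm a b τ).Holds N t {fun v => St.explore (N.exploreState t v)} 0 := by
  induction t with
  | zero =>
    refine le_of_eq ?_
    rw [PMF.toOuterMeasure_apply_eq_zero_iff, Set.disjoint_compl_right_iff_subset]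
    intro f hf
    change f = _
    funext v
    have := mem_support_indep.mp hf v
    simp only [ssspAlgorithm, PMF.support_pure] at this
    rw [this, Network.explore_start hN]
  | succ t ih =>
    refine (ih (by omega)).deterministic ?_
    rintro σ rfl
    refine ⟨fun v => rfl, fun ω => ?_⟩
    change _ = _
    funext v
    have key : (N.exploreState t v).advance (inMsgs a b τ N
        (fun v => St.explore (N.exploreState t v)) v) = N.exploreState (t + 1) v := by
      refine Network.explore_advance hN t v fun u hu => ?_
      rw [inMsgs_of_adj hu rfl]
      rfl
    simp only [nextState, St.advance]
    split
    · rw [key]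
    · rename_i x hx
      rw [if_neg, key]
      simp only [Network.exploreState] at hx ⊢
      split_ifs at hx
      rw [← Option.some_injective _ hx]
      simp only
      omega

/-! ### Phases -/

section Phases

variable (a b τ : ℕ) (N : Network)

/-- The parameters for the network. -/
noncomputable def Network.params : Params := ⟨a, b, τ, N.size, N.ecc⟩

variable (P : Params) {N}

/-- The initial tables of all vertices. -/
noncomputable def gInit (p : ℕ) (m : N.ids → Mem) (v : N.ids) (l : ℕ) : ℕ∞ :=
  initTable P (N.localInput v) p (m v) l

/-- The weights of all links. -/
noncomputable def gWeight (p : ℕ) (m : N.ids → Mem) (u v : N.ids) : ℕ∞ :=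
  linkWeight P (N.localInput v) p (m v) u

/-- The tables of all vertices in a phase. -/
noncomputable def gPipe (p : ℕ) (m : N.ids → Mem) : ℕ → N.ids → PipeState :=
  pipe P.K P.Λ (gWeight P p m) (gInit P p m)

/-- The potentials and levels that the vertices send to their neighbours. -/
noncomputable def gPubs (m : N.ids → Mem) (v : N.ids) : ℕ → ℕ × ℕ :=
  N.table v fun u => (min (m u).phi (2 ^ P.I), min (m u).lev (2 ^ P.I))

/-- The memories of all vertices at the end of a phase. -/
noncomputable def gFinish (i p : ℕ) (m : N.ids → Mem) (ω : N.ids → Bool) (v : N.ids) : Mem :=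
  finish P (N.localInput v) i p (m v) (gPipe P p m P.R v).est (gPubs P m v) (ω v)

/-- The state of a vertex in the round `j` of a phase. -/
noncomputable def workState (o i p j : ℕ) (m : N.ids → Mem) (v : N.ids) : St :=
  .work ⟨N.localInput v, P.n, P.E, o, i, p, j, m v, gPipe P p m j v⟩

/-- The global states in the round `j` of a phase that starts with memories in `Inv`. -/
def WorkSet (o i p j : ℕ) (Inv : (N.ids → Mem) → Prop) : Set (N.ids → St) :=
  {σ | ∃ m, Inv m ∧ σ = workState P o i p j m}

/-- The numbers of the next phase. -/
def nextPhase (o i p : ℕ) : ℕ × ℕ × ℕ :=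
  if p < P.I + 3 then (o, i, p + 1) else if i < P.I then (o, i + 1, 0) else (o + 1, 0, 0)

variable {P} {a b τ}

theorem table_of_adj {β : Type} [Inhabited β] {u v : N.ids} (f : N.ids → β)
    (h : N.graph.Adj v u) : N.table v f u = f u := by
  unfold Network.table
  rw [dif_pos ⟨u.2, h⟩]

theorem table_of_not_adj {β : Type} [Inhabited β] {v : N.ids} {i : ℕ} (f : N.ids → β)
    (h : ¬ ∃ hi : i ∈ N.ids, N.graph.Adj v ⟨i, hi⟩) : N.table v f i = default := by
  unfold Network.table
  rw [dif_neg h]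

/-- Links from non-neighbours have weight ⊤, so the infimum over identifiers, which a vertex
computes, agrees with the infimum over vertices in `pipe`. -/
theorem gPipe_step (p j : ℕ) (m : N.ids → Mem) (v : N.ids) (inb : ℕ → Option (ℕ × ℕ))
    (h : ∀ u : N.ids, N.graph.Adj v u → inb u = (gPipe P p m j u).pick P.K P.Λ) :
    (gPipe P p m j v).step P.K P.Λ (linkWeight P (N.localInput v) p (m v)) inb =
      gPipe P p m (j + 1) v := by
  have hW : ∀ i, ¬ (∃ hi : i ∈ N.ids, N.graph.Adj v ⟨i, hi⟩) →
      linkWeight P (N.localInput v) p (m v) i = ⊤ := by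
    intro i hi
    unfold linkWeight
    rw [if_neg (mem_neighbors.not.mpr hi)]
  unfold PipeState.step
  simp only [gPipe, pipe]
  congr 1
  funext l
  congr 1
  refine le_antisymm (le_iInf fun u => ?_) (le_iInf fun i => ?_)
  · by_cases hu : N.graph.Adj v u
    · refine (iInf_le _ (u : ℕ)).trans (le_of_eq ?_)
      rw [h u hu]
      rfl
    · have : gWeight P p m u v = ⊤ := hW u fun h => hu h.2
      rw [this]
      simp
  · by_cases hi : ∃ hi : i ∈ N.ids, N.graph.Adj v ⟨i, hi⟩
    · obtain ⟨h1, h2⟩ := hi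
      refine (iInf_le _ ⟨i, h1⟩).trans (le_of_eq ?_)
      have := h ⟨i, h1⟩ h2
      simp only at this
      rw [this]
      rfl
    · rw [hW i hi]
      simp

theorem output_workState {o i p j : ℕ} {m : N.ids → Mem} {v : N.ids}
    (ho : o ≠ (N.params a b τ).J) :
    (workState (N.params a b τ) o i p j m v).output a b τ = none := by
  simp only [workState, St.output, Work.params]
  exact if_neg ho

theorem inMsgs_workState {o i p j : ℕ} {m : N.ids → Mem} {u v : N.ids}
    (ho : o ≠ (N.params a b τ).J) (h : N.graph.Adj v u) :
    inMsgs a b τ N (workState (N.params a b τ) o i p j m) v u =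
      (min (m u).phi (2 ^ (N.params a b τ).I), min (m u).lev (2 ^ (N.params a b τ).I),
        (gPipe (N.params a b τ) p m j u).pick (N.params a b τ).K (N.params a b τ).Λ) :=
  inMsgs_of_adj h (output_workState ho)

theorem nextState_workState {o i p j : ℕ} {m : N.ids → Mem} (ho : o ≠ (N.params a b τ).J)
    (hj : j + 1 < (N.params a b τ).R) (ω : N.ids → Bool) :
    nextState a b τ N (workState (N.params a b τ) o i p j m) ω =
      workState (N.params a b τ) o i p (j + 1) m := by
  funext v
  change St.work (Work.advance a b τ _ _ _) = St.work _
  congr 1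
  have key := gPipe_step (P := N.params a b τ) p j m v
    (fun i' => (inMsgs a b τ N (workState (N.params a b τ) o i p j m) v i').2.2)
    fun u hu => by rw [inMsgs_workState ho hu]
  refine (Work.advance_of_lt hj).trans ?_
  exact congrArg (fun q => Work.mk (N.localInput v) N.size N.ecc o i p (j + 1) (m v) q) key

theorem nextState_workState_last {o i p j : ℕ} {m : N.ids → Mem} (ho : o ≠ (N.params a b τ).J)
    (hj : j + 1 = (N.params a b τ).R) (ω : N.ids → Bool) :
    nextState a b τ N (workState (N.params a b τ) o i p j m) ω =
      workState (N.params a b τ) (nextPhase (N.params a b τ) o i p).1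
        (nextPhase (N.params a b τ) o i p).2.1 (nextPhase (N.params a b τ) o i p).2.2 0
        (gFinish (N.params a b τ) i p m ω) := by
  funext v
  set σ := workState (N.params a b τ) o i p j m with hσ
  have key := gPipe_step (P := N.params a b τ) p j m v (fun i' => (inMsgs a b τ N σ v i').2.2)
    fun u hu => by rw [hσ, inMsgs_workState ho hu]
  have hpubs : (fun i' => ((inMsgs a b τ N σ v i').1, (inMsgs a b τ N σ v i').2.1)) =
      gPubs (N.params a b τ) m v := by
    funext i'
    by_cases hi : ∃ hi : i' ∈ N.ids, N.graph.Adj v ⟨i', hi⟩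
    · obtain ⟨h1, h2⟩ := hi
      have e1 := inMsgs_workState (a := a) (b := b) (τ := τ) (i := i) (p := p) (j := j) (m := m)
        ho h2
      have e2 := table_of_adj (N := N) (v := v) (u := ⟨i', h1⟩) (fun u =>
        (min (m u).phi (2 ^ (N.params a b τ).I), min (m u).lev (2 ^ (N.params a b τ).I))) h2
      simp only at e1 e2
      rw [hσ, e1, gPubs, e2]
    · rw [inMsgs_of_not_adj hi, gPubs, table_of_not_adj _ hi]
      rfl
  rw [hj] at key
  change St.work (Work.advance a b τ _ _ _) = St.work _
  congr 1
  let s : Work := ⟨N.localInput v, N.size, N.ecc, o, i, p, j, m v, gPipe (N.params a b τ) p m j v⟩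
  have hlt : ¬ s.j + 1 < (s.params a b τ).R := by
    change ¬ j + 1 < (N.params a b τ).R
    omega
  have hfin : finish (s.params a b τ) s.inp s.i s.p s.mem
      (gPipe (N.params a b τ) p m (N.params a b τ).R v).est
      (fun i' => ((inMsgs a b τ N σ v i').1, (inMsgs a b τ N σ v i').2.1)) (ω v) =
      gFinish (N.params a b τ) i p m ω v := by
    rw [hpubs]
    rfl
  refine (Work.advance_of_not_lt (s := s) hlt (congrArg PipeState.est key) hfin).trans ?_
  by_cases h1 : p < (N.params a b τ).I + 3
  · rw [show nextPhase (N.params a b τ) o i p = (o, i, p + 1) from if_pos h1]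
    exact if_pos h1
  by_cases h2 : i < (N.params a b τ).I
  · rw [show nextPhase (N.params a b τ) o i p = (o, i + 1, 0) from (if_neg h1).trans (if_pos h2)]
    exact (if_neg h1).trans (if_pos h2)
  · rw [show nextPhase (N.params a b τ) o i p = (o + 1, 0, 0) from (if_neg h1).trans (if_neg h2)]
    exact (if_neg h1).trans (if_neg h2)

/-- The coin matters only in the last round of a phase; the earlier rounds are deterministic and
cost no probability. -/
theorem holds_phase {r o i p : ℕ} {Inv Inv' : (N.ids → Mem) → Prop} {ε δ : ℝ≥0∞}
    (ho : o ≠ (N.params a b τ).J)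
    (h : (ssspAlgorithm a b τ).Holds N r (WorkSet (N.params a b τ) o i p 0 Inv) ε)
    (hf : ∀ m, Inv m → (indep fun _ : N.ids =>
      coin ((N.params a b τ).g / (N.size : NNReal))).toOuterMeasure
        {ω | ¬ Inv' (gFinish (N.params a b τ) i p m ω)} ≤ δ) :
    (ssspAlgorithm a b τ).Holds N (r + (N.params a b τ).R)
      (WorkSet (N.params a b τ) (nextPhase (N.params a b τ) o i p).1
        (nextPhase (N.params a b τ) o i p).2.1 (nextPhase (N.params a b τ) o i p).2.2 0 Inv')
      (ε + δ) := by
  have h1 : ∀ j, j < (N.params a b τ).R →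
      (ssspAlgorithm a b τ).Holds N (r + j) (WorkSet (N.params a b τ) o i p j Inv) ε := by
    intro j
    induction j with
    | zero => exact fun _ => h
    | succ j ih =>
      intro hj
      refine (ih (by omega)).deterministic ?_
      rintro σ ⟨m, hm, rfl⟩
      exact ⟨fun v => output_workState ho, fun ω => ⟨m, hm, nextState_workState ho hj ω⟩⟩
  obtain ⟨j, hj⟩ : ∃ j, (N.params a b τ).R = j + 1 := ⟨_, rfl⟩
  rw [hj, ← add_assoc]
  refine (h1 j (by omega)).random (q := (N.params a b τ).g / (N.size : NNReal)) ?_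
  rintro σ ⟨m, hm, rfl⟩
  refine ⟨fun v => ⟨output_workState ho, rfl⟩, (MeasureTheory.measure_mono ?_).trans (hf m hm)⟩
  intro ω hω hI
  exact hω ⟨_, hI, nextState_workState_last ho hj.symm ω⟩

theorem holds_start (hN : N.graph.Connected) {Inv : (N.ids → Mem) → Prop} {δ : ℝ≥0∞}
    (hf : (indep fun _ : N.ids =>
      coin ((N.params a b τ).g / (N.size : NNReal))).toOuterMeasure
        {ω | ¬ Inv fun v => startMem (N.localInput v) (ω v)} ≤ δ) :
    (ssspAlgorithm a b τ).Holds N (3 * N.ecc + 3) (WorkSet (N.params a b τ) 0 0 0 0 Inv) δ := by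
  rw [← zero_add δ]
  have hfin : ∀ v, (N.exploreState (3 * N.ecc + 2) v).fin = some (N.size, N.ecc) := by
    intro v
    have := Network.depth_le_ecc v
    simp only [Network.exploreState]
    rw [if_pos (by omega)]
  refine (holds_explore hN _ le_rfl).random (q := (N.params a b τ).g / (N.size : NNReal)) ?_
  rintro σ rfl
  refine ⟨fun v => ⟨rfl, ?_⟩, (MeasureTheory.measure_mono ?_).trans hf⟩
  · simp only [St.bias, hfin]
    rfl
  · intro ω hω hI
    refine hω ⟨_, hI, funext fun v => ?_⟩
    simp only [nextState, St.advance]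
    simp only [hfin]
    exact if_pos rfl

/-! ### Bandwidth -/

variable (N) in
/-- All vertices know the number of vertices and the eccentricity of the source. -/
def Informed : Set (N.ids → St) :=
  {σ | ∀ v, ∃ s : Work, σ v = .work s ∧ s.n = N.size ∧ s.E = N.ecc}

/-- The failure probability is 0 here because the bandwidth bound concerns every execution,
including those with bad samples. -/
theorem holds_informed (hN : N.graph.Connected) (r : ℕ) :
    (ssspAlgorithm a b τ).Holds N (3 * N.ecc + 3 + r) (Informed N) 0 := by
  induction r with
  | zero =>
    refine (holds_start hN (Inv := fun _ => True) (δ := 0) (by simp)).mono ?_ le_rfl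
    rintro σ ⟨m, -, rfl⟩ v
    exact ⟨_, rfl, rfl, rfl⟩
  | succ r ih =>
    refine ih.of_support fun σ hσ f hf v => ?_
    obtain ⟨s, hs, hn, hE⟩ := hσ v
    rcases mem_support_next (hf v) with h | ⟨c, h⟩
    · exact ⟨s, h.trans hs, hn, hE⟩
    · rw [hs] at h
      refine ⟨_, h, ?_⟩
      unfold Work.advance
      dsimp only
      split_ifs
      · exact ⟨hn, hE⟩
      · exact ⟨hn, hE⟩
      · exact ⟨hn, hE⟩
      · exact ⟨hn, hE⟩

theorem bandwidthAtMost (hN : N.graph.Connected) {X e : ℕ} (hX : X + 2 ≤ 2 ^ e)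
    (hn : N.size ≤ X) (hn1 : 1 ≤ N.size) (hI : 2 ^ (N.params a b τ).I ≤ X)
    (hK : (N.params a b τ).K ≤ X) (hΛ : (N.params a b τ).Λ ≤ X) :
    (ssspAlgorithm a b τ).BandwidthAtMost N (8 * e) := by
  intro r σ hσ u v _
  have hlen : ∀ x : St, ((x.msg a b τ v).1 ≤ X ∧ (x.msg a b τ v).2.1 ≤ X ∧
      ∀ p ∈ (x.msg a b τ v).2.2, p.1 ≤ X ∧ p.2 ≤ X) →
      ((ssspAlgorithm a b τ).message N x v).length ≤ 8 * e := by
    rintro x ⟨h1, h2, h3⟩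
    unfold Algorithm.message
    split_ifs
    · simp
    · exact encMsg_length_le h1 h2 h3 hX
  refine hlen _ ?_
  rcases Nat.lt_or_ge r (3 * N.ecc + 3) with hr | hr
  · have h1 := (holds_explore (a := a) (b := b) (τ := τ) hN r (by omega)).support_subset hσ
    have h2 : σ = fun v => St.explore (N.exploreState r v) := h1
    rw [h2]
    simp only [St.msg, Explore.msg, Network.exploreState]
    refine ⟨?_, ?_, ?_⟩
    · refine le_trans ?_ (hn1.trans hn)
      by_cases hd : N.depth u ≤ r <;> simp [hd]
    · have := Network.mass_le hN r u
      exact le_trans (by split_ifs <;> simp [this]) hn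
    · intro p hp
      have := Network.ecc_lt_size hN
      split_ifs at hp
      · have : p = (N.size, N.ecc) := (Option.some_injective _ hp).symm
        rw [this]
        simp only
        omega
      · exact absurd hp (by simp)
  · obtain ⟨k, rfl⟩ := Nat.exists_eq_add_of_le hr
    have h1 := (holds_informed (a := a) (b := b) (τ := τ) hN k).support_subset hσ
    obtain ⟨s, hs, hsn, hsE⟩ := h1 u
    have hP : s.params a b τ = N.params a b τ := by
      simp [Work.params, Network.params, hsn, hsE]
    rw [hs]
    simp only [St.msg, Work.msg, hP]
    refine ⟨(min_le_right _ _).trans hI, (min_le_right _ _).trans hI, fun p hp => ?_⟩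
    obtain ⟨⟨-, -, h2, h3⟩, -⟩ := PipeState.pick_eq_some hp
    exact ⟨h2.trans hK, h3.trans hΛ⟩

end Phases

/-! ### Distances and potentials in a network -/

namespace Network

variable {N : Network}

open Classical in
variable (N) in
/-- The weights of the links, where a potential `φ` is subtracted. -/
noncomputable def redW (φ : N.ids → ℕ) (u v : N.ids) : ℕ∞ :=
  if N.graph.Adj u v then ((N.weight u v + φ u - φ v : ℕ) : ℕ∞) else ⊤

/-- A potential does not increase by more than the weight along any link. -/
def Feasible (φ : N.ids → ℕ) : Prop :=
  φ N.source = 0 ∧ ∀ u v, N.graph.Adj u v → φ v ≤ φ u + N.weight u v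

theorem redW_eq_coe {φ : N.ids → ℕ} {u v : N.ids} {w : ℕ} (h : N.redW φ u v = w) :
    N.graph.Adj u v ∧ w = N.weight u v + φ u - φ v := by
  unfold redW at h
  split_ifs at h with h1
  · exact ⟨h1, by exact_mod_cast h.symm⟩
  · exact absurd h.symm (ENat.natCast_ne_top w)

theorem redW_of_adj {φ : N.ids → ℕ} {u v : N.ids} (h : N.graph.Adj u v) :
    N.redW φ u v = ((N.weight u v + φ u - φ v : ℕ) : ℕ∞) := if_pos h

/-- The potentials telescope along the walk; feasibility makes the truncated subtractions exact. -/
theorem exists_walk_of_path {φ : N.ids → ℕ} (hφ : Feasible φ) {u v : N.ids} {c j : ℕ}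
    (h : Path (N.redW φ) u v c j) : ∃ p : N.graph.Walk u v, N.walkLength p + φ u = c + φ v := by
  induction h with
  | nil => exact ⟨.nil, by simp [walkLength]⟩
  | @snoc v z c w j _ hw ih =>
    obtain ⟨p, hp⟩ := ih
    obtain ⟨hadj, rfl⟩ := redW_eq_coe hw
    refine ⟨p.concat hadj, ?_⟩
    have h1 : N.walkLength (p.concat hadj) = N.walkLength p + N.weight v z := by
      simp [walkLength]
    have := hφ.2 v z hadj
    rw [h1]; omega

theorem exists_path_of_walk {φ : N.ids → ℕ} (hφ : Feasible φ) {u v : N.ids}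
    (p : N.graph.Walk u v) : ∃ c, Path (N.redW φ) u v c p.length ∧
      N.walkLength p + φ u = c + φ v := by
  induction p with
  | nil => exact ⟨0, .nil, by simp [walkLength]⟩
  | @cons u v z h p ih =>
    obtain ⟨c, hp, hc⟩ := ih
    refine ⟨N.weight u v + φ u - φ v + c, ?_, ?_⟩
    · rw [SimpleGraph.Walk.length_cons, add_comm p.length]
      exact (Path.single (redW_of_adj h)).trans hp
    · have h1 : N.walkLength (p.cons h) = N.weight u v + N.walkLength p := by
        simp [walkLength]
      have := hφ.2 u v h
      rw [h1]; omega

theorem distance_le {u v : N.ids} (p : N.graph.Walk u v) : N.distance u v ≤ N.walkLength p :=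
  Nat.sInf_le ⟨p, rfl⟩

theorem exists_walk_distance (hN : N.graph.Connected) (u v : N.ids) :
    ∃ p : N.graph.Walk u v, N.walkLength p = N.distance u v := by
  obtain ⟨p⟩ := hN u v
  exact Nat.sInf_mem (s := Set.range fun p : N.graph.Walk u v => N.walkLength p) ⟨_, p, rfl⟩

theorem distance_le_of_path {φ : N.ids → ℕ} (hφ : Feasible φ) {v : N.ids} {c j : ℕ}
    (h : Path (N.redW φ) N.source v c j) : N.distance N.source v ≤ c + φ v := by
  obtain ⟨p, hp⟩ := exists_walk_of_path hφ h
  have := distance_le p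
  rw [hφ.1] at hp
  omega

theorem exists_path_distance (hN : N.graph.Connected) {φ : N.ids → ℕ} (hφ : Feasible φ)
    (v : N.ids) : φ v ≤ N.distance N.source v ∧
      ∃ j, Path (N.redW φ) N.source v (N.distance N.source v - φ v) j := by
  obtain ⟨p, hp⟩ := exists_walk_distance hN N.source v
  obtain ⟨c, hc, hpc⟩ := exists_path_of_walk hφ p
  rw [hφ.1, hp] at hpc
  refine ⟨by omega, p.length, ?_⟩
  rwa [show N.distance N.source v - φ v = c by omega]

theorem walkLength_le {a b : ℕ} (hV : N.Valid a b) {u v : N.ids} (p : N.graph.Walk u v) :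
    N.walkLength p ≤ p.length * N.size ^ a := by
  induction p with
  | nil => simp [walkLength]
  | @cons u v z h p ih =>
    have h1 : N.walkLength (p.cons h) = N.weight u v + N.walkLength p := by
      simp [walkLength]
    have := hV.weight_le u v h
    rw [h1, SimpleGraph.Walk.length_cons, add_mul]
    omega

theorem distance_le_pow {a b : ℕ} (hV : N.Valid a b) (v : N.ids) :
    N.distance N.source v ≤ N.size ^ (a + 1) := by
  obtain ⟨p, hp⟩ := hV.connected.exists_walk_length_eq_dist N.source v
  refine (distance_le p).trans ((walkLength_le hV p).trans ?_)
  rw [hp, pow_succ, mul_comm]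
  refine Nat.mul_le_mul_left _ ?_
  have h1 := depth_le_ecc v
  have h2 := ecc_lt_size hV.connected
  unfold depth at h1
  omega

theorem dist_le_two_mul_ecc (hN : N.graph.Connected) (u v : N.ids) :
    N.graph.dist u v ≤ 2 * N.ecc := by
  have h1 := hN.dist_triangle (u := u) (v := N.source) (w := v)
  have h2 := depth_le_ecc u
  have h3 := depth_le_ecc v
  unfold depth at h2 h3
  rw [SimpleGraph.dist_comm] at h2
  omega

theorem ecc_le_hopDiam (hN : N.graph.Connected) : N.ecc ≤ N.hopDiam := by
  have : Nonempty N.ids := ⟨N.source⟩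
  exact Finset.sup_le fun v _ =>
    SimpleGraph.dist_le_diam (SimpleGraph.connected_iff_ediam_ne_top.mp hN)

end Network

/-! ### Approximate distances within the layers -/

section Search

variable {N : Network} {P : Params}

/-- The potentials and the levels of the neighbours are known. -/
def NbrInv (m : N.ids → Mem) : Prop :=
  ∀ u v, N.graph.Adj u v → (m v).nbr u = ((m u).phi, (m u).lev)

variable (P) in
/-- The table `acc` contains approximate lengths, in units of `1 / A`, of walks within the layers:
from the lower layers for the label `0`, and from the sampled vertex `x` for the label `x + 1`. All
walks with at most `h` edges, whose length has at most `z - 1` binary digits, are accounted for. -/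
structure AccInv (φ ℓ : N.ids → ℕ) (σ : N.ids → Bool) (z : ℕ) (acc : N.ids → ℕ → ℕ∞) : Prop where
  sound_zero : ∀ v (e : ℕ), acc v 0 = e →
    ∃ u c j, ℓ u < ℓ v ∧ Path (N.redW φ) u v c j ∧ P.A * c ≤ e
  sound_succ : ∀ v l (e : ℕ), acc v (l + 1) = e → ∃ x : N.ids, (x : ℕ) = l ∧ σ x = true ∧
    ∃ c j, Path (cellWeight (N.redW φ) ℓ) x v c j ∧ P.A * c ≤ e
  le_cap : ∀ v l (e : ℕ), acc v l = e → e ≤ P.cap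
  complete_zero : ∀ v c j, Enter (N.redW φ) ℓ v c j → j < P.h → Nat.size c < z →
    acc v 0 ≤ ((P.A + P.h) * c : ℕ)
  complete_succ : ∀ (x v : N.ids) c j, σ x = true → Path (cellWeight (N.redW φ) ℓ) x v c j →
    j ≤ P.h → Nat.size c < z → acc v (x + 1) ≤ ((P.A + P.h) * c : ℕ)

theorem redWeight_eq {m : N.ids → Mem} (hm : NbrInv m) {u v : N.ids} (h : N.graph.Adj u v) :
    N.redW (fun v => (m v).phi) u v = redWeight (N.localInput v) (m v) u := by
  rw [Network.redW_of_adj h, redWeight, hm u v h]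
  congr 3
  exact (table_of_adj (fun u => N.weight u v) h.symm).symm

theorem gWeight_search {m : N.ids → Mem} (hm : NbrInv m) {p : ℕ} (h0 : 0 < p) (hp : p ≤ P.I + 2) :
    gWeight P p m = roundW P.A (p - 1)
      (cellWeight (N.redW fun v => (m v).phi) fun v => (m v).lev) := by
  funext u v
  unfold gWeight linkWeight
  by_cases hadj : N.graph.Adj u v
  · rw [if_pos (coe_mem_neighbors.mpr hadj.symm), if_neg (by omega), hm u v hadj]
    dsimp only
    by_cases hl : (m u).lev = (m v).lev
    · rw [if_pos hl, roundW_of_coe]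
      unfold cellWeight
      rw [if_pos hl, redWeight_eq hm hadj]
    · rw [if_neg hl, roundW, if_pos]
      exact if_neg hl
  · rw [if_neg (fun h => hadj (coe_mem_neighbors.mp h).symm), roundW, if_pos]
    unfold cellWeight
    split_ifs
    · exact if_neg hadj
    · rfl

theorem gInit_zero {m : N.ids → Mem} {p : ℕ} (h0 : 0 < p) (hp : p ≤ P.I + 2) (v : N.ids) :
    gInit P p m v 0 = ⨅ u ∈ (N.localInput v).neighbors.filter fun u => ((m v).nbr u).2 < (m v).lev,
        roundWeight P.A (p - 1) (redWeight (N.localInput v) (m v) u) := by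
  unfold gInit initTable
  rw [if_neg (by omega), if_pos hp, if_pos rfl]

theorem gInit_succ {m : N.ids → Mem} {p : ℕ} (h0 : 0 < p) (hp : p ≤ P.I + 2) (v : N.ids) (l : ℕ) :
    gInit P p m v (l + 1) = if l = v ∧ (m v).coin = true then 0 else ⊤ := by
  unfold gInit initTable
  rw [if_neg (by omega), if_pos hp, if_neg (by omega)]
  congr 1
  simp [Network.localInput]

theorem gInit_zero_sound {m : N.ids → Mem} (hm : NbrInv m) {p : ℕ} (h0 : 0 < p) (hp : p ≤ P.I + 2)
    {v : N.ids} {e : ℕ} (h : gInit P p m v 0 = e) : ∃ x w, (m x).lev < (m v).lev ∧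
      N.redW (fun v => (m v).phi) x v = (w : ℕ) ∧ roundWeight P.A (p - 1) w = e := by
  rw [gInit_zero h0 hp, ← Finset.inf_eq_iInf] at h
  have hne : (Finset.filter (fun u => ((m v).nbr u).2 < (m v).lev)
      (N.localInput v).neighbors).Nonempty := by
    rw [Finset.nonempty_iff_ne_empty]
    intro h2
    rw [h2] at h
    exact absurd h.symm (ENat.natCast_ne_top e)
  obtain ⟨i, hi, hie⟩ := Finset.exists_mem_eq_inf _ hne
    fun u => roundWeight P.A (p - 1) (redWeight (N.localInput v) (m v) u)
  rw [Finset.mem_filter, mem_neighbors] at hi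
  obtain ⟨⟨h1, h2⟩, h3⟩ := hi
  rw [hm ⟨i, h1⟩ v h2.symm] at h3
  exact ⟨⟨i, h1⟩, _, h3, redWeight_eq hm h2.symm, hie.symm.trans h⟩

theorem gInit_zero_le {m : N.ids → Mem} (hm : NbrInv m) {p : ℕ} (h0 : 0 < p) (hp : p ≤ P.I + 2)
    {x v : N.ids} {w : ℕ} (hl : (m x).lev < (m v).lev)
    (hw : N.redW (fun v => (m v).phi) x v = (w : ℕ)) :
    gInit P p m v 0 ≤ roundWeight P.A (p - 1) w := by
  have hadj := (Network.redW_eq_coe hw).1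
  rw [gInit_zero h0 hp]
  refine (iInf₂_le (x : ℕ) ?_).trans (le_of_eq ?_)
  · rw [Finset.mem_filter, coe_mem_neighbors, hm x v hadj]
    exact ⟨hadj.symm, hl⟩
  · rw [redWeight_eq hm hadj] at hw
    rw [ENat.natCast_inj.mp hw]

theorem search_sound_zero {m : N.ids → Mem} (hm : NbrInv m) {p r : ℕ} (h0 : 0 < p)
    (hp : p ≤ P.I + 2) {v : N.ids} {d : ℕ} (h : (gPipe P p m r v).est 0 = d) :
    ∃ u c j, (m u).lev < (m v).lev ∧ Path (N.redW fun v => (m v).phi) u v c j ∧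
      P.A * c ≤ unround (p - 1) d := by
  obtain ⟨e, he, u, e₀, e', j, hi, hpath, rfl⟩ := attains_of_pipe_est h
  rw [gWeight_search hm h0 hp] at hpath
  obtain ⟨x, w, hl, hw, hr⟩ := gInit_zero_sound hm h0 hp hi
  obtain ⟨c, hc, hce⟩ := hpath.of_roundW
  obtain ⟨hlev, hc⟩ := hc.of_cell
  refine ⟨x, _, _, hlev ▸ hl, (Path.single hw).trans hc, ?_⟩
  have := le_unround hr
  have := unround_mono (p - 1) he
  rw [unround_add] at this
  rw [mul_add]
  omega

theorem search_sound_succ {m : N.ids → Mem} (hm : NbrInv m) {p r : ℕ} (h0 : 0 < p)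
    (hp : p ≤ P.I + 2) {v : N.ids} {l d : ℕ} (h : (gPipe P p m r v).est (l + 1) = d) :
    ∃ x : N.ids, (x : ℕ) = l ∧ (m x).coin = true ∧ ∃ c j,
      Path (cellWeight (N.redW fun v => (m v).phi) fun v => (m v).lev) x v c j ∧
      P.A * c ≤ unround (p - 1) d := by
  obtain ⟨e, he, u, e₀, e', j, hi, hpath, rfl⟩ := attains_of_pipe_est h
  rw [gWeight_search hm h0 hp] at hpath
  simp only [gInit_succ h0 hp] at hi
  split_ifs at hi with h1
  · obtain ⟨c, hc, hce⟩ := hpath.of_roundW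
    refine ⟨u, h1.1.symm, h1.2, c, _, hc, hce.trans (unround_mono _ ?_)⟩
    omega
  · exact absurd hi.symm (ENat.natCast_ne_top _)

/-- There are at most `m + 1` labels in use: 0 and one for each sampled vertex. -/
theorem search_complete (hb : ∀ i ∈ N.ids, i ≤ P.n ^ P.b) {m : N.ids → Mem} (hm : NbrInv m)
    (hS : (Finset.univ.filter fun v => (m v).coin = true).card ≤ P.m) {p : ℕ} (h0 : 0 < p)
    (hp : p ≤ P.I + 2) {v : N.ids} {l e : ℕ}
    (h : Attains (gWeight P p m) (fun u => gInit P p m u l) v e) (hK : e ≤ P.K) :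
    (gPipe P p m P.R v).est l ≤ e := by
  classical
  have hΛ : P.n ^ P.b + 1 ≤ P.Λ := by
    unfold Params.Λ
    nlinarith [Nat.zero_le (P.n ^ P.b), Nat.zero_le P.cap]
  refine pipe_est_le ?_ (insert 0 ((Finset.univ.filter fun v => (m v).coin = true).image
    fun v : N.ids => (v : ℕ) + 1)) ?_ ?_ h hK
  · rw [gWeight_search hm h0 hp]
    exact one_le_roundW _ _
  · rintro u (_ | l) hl
    · exact ⟨Finset.mem_insert_self _ _, Nat.zero_le _⟩
    · rw [gInit_succ h0 hp] at hl
      split_ifs at hl with h1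
      · obtain ⟨rfl, h1⟩ := h1
        refine ⟨Finset.mem_insert_of_mem (Finset.mem_image.mpr ⟨u, by simpa using h1, rfl⟩), ?_⟩
        have := hb u u.2
        omega
      · exact absurd rfl hl
  · refine (Nat.add_le_add_left ((Finset.card_insert_le (0 : ℕ) _).trans
      (Nat.add_le_add_right (Finset.card_image_le.trans hS) 1)) _).trans ?_
    unfold Params.R
    nlinarith [Nat.zero_le P.m]

/-- The table after a search. -/
theorem gFinish_search_acc {i p : ℕ} (h0 : 0 < p) (hp : p ≤ P.I + 2) (m : N.ids → Mem)
    (ω : N.ids → Bool) (v : N.ids) (l : ℕ) :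
    (gFinish P i p m ω v).acc l = (m v).acc l ⊓ if (gPipe P p m P.R v).est l ≤ P.K then
      (unround (p - 1) ((gPipe P p m P.R v).est l).toNat : ℕ) else ⊤ := by
  unfold gFinish finish
  rw [if_neg (by omega), if_pos hp]

/-- Phase `p` serves the walks whose length has exactly `p - 1` binary digits. Shorter ones were
served before, and taking minima never spoils them; soundness holds at every scale. -/
theorem AccInv.search (hb : ∀ i ∈ N.ids, i ≤ P.n ^ P.b) {m : N.ids → Mem} (hm : NbrInv m)
    (hS : (Finset.univ.filter fun v => (m v).coin = true).card ≤ P.m) {i p : ℕ} (h0 : 0 < p)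
    (hp : p ≤ P.I + 2) (ω : N.ids → Bool)
    (h : AccInv P (fun v => (m v).phi) (fun v => (m v).lev) (fun v => (m v).coin) (p - 1)
      fun v => (m v).acc) :
    AccInv P (fun v => (m v).phi) (fun v => (m v).lev) (fun v => (m v).coin) p
      fun v => (gFinish P i p m ω v).acc := by
  have hcase : ∀ v l (e : ℕ), (gFinish P i p m ω v).acc l = e → (m v).acc l = e ∨
      ∃ d : ℕ, (gPipe P p m P.R v).est l = d ∧ d ≤ P.K ∧ e = unround (p - 1) d := by
    intro v l e he
    rw [gFinish_search_acc h0 hp] at he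
    rcases min_choice ((m v).acc l) (if (gPipe P p m P.R v).est l ≤ P.K then
      (unround (p - 1) ((gPipe P p m P.R v).est l).toNat : ℕ) else ⊤) with h1 | h1
    · exact Or.inl (h1.symm.trans he)
    · have h2 := h1.symm.trans he
      split_ifs at h2 with h3
      · obtain ⟨d, hd⟩ := ENat.ne_top_iff_exists.mp (ne_top_of_le_ne_top (ENat.natCast_ne_top _) h3)
        rw [← hd] at h2 h3
        exact Or.inr ⟨d, hd.symm, by exact_mod_cast h3, by simpa using ENat.natCast_inj.mp h2.symm⟩
      · exact absurd h2.symm (ENat.natCast_ne_top _)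
  have hold : ∀ v l, (gFinish P i p m ω v).acc l ≤ (m v).acc l := fun v l => by
    rw [gFinish_search_acc h0 hp]
    exact inf_le_left
  have hnew : ∀ v l (e x : ℕ), Attains (gWeight P p m) (fun u => gInit P p m u l) v e → e ≤ P.K →
      unround (p - 1) e ≤ x → (gFinish P i p m ω v).acc l ≤ (x : ℕ) := by
    intro v l e x ha hK hx
    have h1 := search_complete hb hm hS h0 hp ha hK
    rw [gFinish_search_acc h0 hp, if_pos (h1.trans (by exact_mod_cast hK))]
    refine inf_le_right.trans ?_
    obtain ⟨d, hd⟩ := ENat.ne_top_iff_exists.mp (ne_top_of_le_ne_top (ENat.natCast_ne_top _) h1)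
    rw [← hd] at h1 ⊢
    have h2 := unround_mono (p - 1) (show d ≤ e by exact_mod_cast h1)
    exact_mod_cast h2.trans hx
  have hAK : 2 * P.A + P.h ≤ P.K := Nat.le_add_right _ _
  refine ⟨?_, ?_, ?_, ?_, ?_⟩
  · intro v e he
    rcases hcase v 0 e he with h1 | ⟨d, hd, -, rfl⟩
    · exact h.sound_zero v e h1
    · exact search_sound_zero hm h0 hp hd
  · intro v l e he
    rcases hcase v _ e he with h1 | ⟨d, hd, -, rfl⟩
    · exact h.sound_succ v l e h1
    · exact search_sound_succ hm h0 hp hd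
  · intro v l e he
    rcases hcase v _ e he with h1 | ⟨d, hd, hdK, rfl⟩
    · exact h.le_cap v l e h1
    · unfold unround Params.cap
      split_ifs
      · exact Nat.zero_le _
      · exact Nat.mul_le_mul (Nat.pow_le_pow_right (by norm_num) (by omega)) hdK
  · intro v c j hc hj hz
    rcases Nat.lt_or_ge (Nat.size c) (p - 1) with h1 | h1
    · exact (hold v 0).trans (h.complete_zero v c j hc hj h1)
    have hsz : p - 1 = Nat.size c := by omega
    obtain ⟨x, u, w, c', hl, hw, hpath, rfl⟩ := hc
    obtain ⟨e', hp', hb'⟩ := hpath.exists_roundW (A := P.A) hsz (by omega)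
    obtain ⟨r, hr, hbr⟩ := exists_roundBound_weight (A := P.A) hsz (Nat.le_add_right w c')
    have hle := gInit_zero_le hm h0 hp hl hw
    rw [hr] at hle
    obtain ⟨e₀, he₀⟩ := ENat.ne_top_iff_exists.mp
      (ne_top_of_le_ne_top (ENat.natCast_ne_top _) hle)
    rw [← he₀] at hle
    have hle' : e₀ ≤ r := by exact_mod_cast hle
    have hsum := hbr.add hb'
    rw [hsz] at hsum
    obtain ⟨hs1, hs2⟩ := hsum.le (h := P.h) (by omega)
    refine hnew v 0 (e₀ + e') _ ⟨u, e₀, e', j, he₀.symm, ?_, rfl⟩ (by omega) ?_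
    · rw [gWeight_search hm h0 hp]
      exact hp'
    · rw [hsz]
      exact (unround_mono _ (by omega)).trans hs2
  · intro x v c j hx hpath hj hz
    rcases Nat.lt_or_ge (Nat.size c) (p - 1) with h1 | h1
    · exact (hold v _).trans (h.complete_succ x v c j hx hpath hj h1)
    have hsz : p - 1 = Nat.size c := by omega
    obtain ⟨e', hp', hb'⟩ := hpath.exists_roundW (A := P.A) hsz le_rfl
    rw [hsz] at hb'
    obtain ⟨hs1, hs2⟩ := hb'.le hj
    refine hnew v _ (0 + e') _ ⟨x, 0, e', j, ?_, ?_, rfl⟩ (by omega) ?_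
    · simp only
      rw [gInit_succ h0 hp, if_pos ⟨rfl, hx⟩]
      rfl
    · rw [gWeight_search hm h0 hp]
      exact hp'
    · rw [hsz, zero_add]
      exact hs2

end Search

/-! ### Broadcast of the approximate distances -/

section Broadcast

variable {N : Network} {P : Params}

theorem item_inj {y k e y' k' e' : ℕ} (h : item y k e = item y' k' e') :
    y = y' ∧ k = k' ∧ e = e' := by
  unfold item at h
  obtain ⟨h1, h2⟩ := Nat.pair_eq_pair.mp h
  obtain ⟨h3, h4⟩ := Nat.pair_eq_pair.mp h1
  exact ⟨h3, h4, h2⟩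

theorem gWeight_broadcast {m : N.ids → Mem} {u v : N.ids} (h : N.graph.Adj v u) :
    gWeight P (P.I + 3) m u v = 1 := by
  unfold gWeight linkWeight
  rw [if_pos (coe_mem_neighbors.mpr h), if_pos (Or.inr (by omega))]

theorem one_le_gWeight_broadcast {m : N.ids → Mem} (u v : N.ids) :
    1 ≤ gWeight P (P.I + 3) m u v := by
  by_cases h : N.graph.Adj v u
  · exact (gWeight_broadcast h).ge
  · unfold gWeight linkWeight
    rw [if_neg (coe_mem_neighbors.not.mpr h)]
    exact le_top

open Classical in
theorem gInit_broadcast {m : N.ids → Mem} (v : N.ids) (l : ℕ) : gInit P (P.I + 3) m v l =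
    if (m v).coin = true ∧ ∃ k e : ℕ, (m v).acc k = e ∧ l = item v k e then 0 else ⊤ := by
  unfold gInit initTable
  rw [if_neg (by omega), if_neg (by omega)]
  congr 1

theorem path_broadcast {m : N.ids → Mem} {u v : N.ids} (p : N.graph.Walk u v) :
    Path (gWeight P (P.I + 3) m) u v p.length p.length := by
  induction p with
  | nil => exact .nil
  | cons h p ih =>
    rw [SimpleGraph.Walk.length_cons, add_comm p.length]
    exact (Path.single (gWeight_broadcast h.symm)).trans ih

theorem broadcast_sound {m : N.ids → Mem} {r l : ℕ} {v : N.ids}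
    (h : (gPipe P (P.I + 3) m r v).est l ≠ ⊤) :
    ∃ (y : N.ids) (k e : ℕ), (m y).coin = true ∧ (m y).acc k = e ∧ l = item y k e := by
  obtain ⟨d, hd⟩ := ENat.ne_top_iff_exists.mp h
  obtain ⟨_, -, u, e₀, _, _, hi, -, -⟩ := attains_of_pipe_est hd.symm
  simp only [gInit_broadcast] at hi
  split_ifs at hi with h1
  · obtain ⟨h1, k, e, h2, h3⟩ := h1
    exact ⟨u, k, e, h1, h2, h3⟩
  · exact absurd hi.symm (ENat.natCast_ne_top _)

/-- Flooding is the pipelined search with unit weights: every item starts with the value 0, any two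
vertices are within 2E ≤ K hops, and there are at most m(m + 1) items. -/
theorem broadcast_complete (hN : N.graph.Connected) (hE : P.E = N.ecc)
    (hb : ∀ i ∈ N.ids, i ≤ P.n ^ P.b) {m : N.ids → Mem} {φ ℓ : N.ids → ℕ} {z : ℕ}
    (hS : (Finset.univ.filter fun v => (m v).coin = true).card ≤ P.m)
    (hA : AccInv P φ ℓ (fun v => (m v).coin) z fun v => (m v).acc) {y v : N.ids} {k e : ℕ}
    (hy : (m y).coin = true) (he : (m y).acc k = e) :
    (gPipe P (P.I + 3) m P.R v).est (item y k e) ≠ ⊤ := by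
  classical
  obtain ⟨p, hp⟩ := hN.exists_walk_length_eq_dist y v
  have hd := Network.dist_le_two_mul_ecc hN y v
  have hpK : p.length ≤ P.K := by
    rw [hp]
    refine hd.trans ?_
    rw [← hE]
    exact Nat.le_add_left _ _
  let S : Finset N.ids := Finset.univ.filter fun v => (m v).coin = true
  let T : Finset ℕ := insert 0 (S.image fun v : N.ids => (v : ℕ) + 1)
  have hT : T.card ≤ P.m + 1 :=
    (Finset.card_insert_le _ _).trans (Nat.add_le_add_right (Finset.card_image_le.trans hS) 1)
  have hlab : ∀ (u : N.ids) (k e : ℕ), (m u).acc k = e → k ∈ T ∧ k ≤ P.n ^ P.b + 1 := by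
    rintro u (_ | k) e he
    · exact ⟨Finset.mem_insert_self _ _, Nat.zero_le _⟩
    · obtain ⟨x, rfl, hx, -⟩ := hA.sound_succ u k e he
      have := hb x x.2
      exact ⟨Finset.mem_insert_of_mem (Finset.mem_image.mpr
        ⟨x, Finset.mem_filter.mpr ⟨Finset.mem_univ _, hx⟩, rfl⟩), by omega⟩
  refine ne_top_of_le_ne_top (ENat.natCast_ne_top p.length) (pipe_est_le one_le_gWeight_broadcast
    ((S ×ˢ T).image fun q => item q.1 q.2 ((m q.1).acc q.2).toNat) ?_ ?_
    ⟨y, 0, p.length, p.length, ?_, path_broadcast p, (zero_add _).symm⟩ hpK)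
  · intro u l hl
    rw [gInit_broadcast] at hl
    split_ifs at hl with h1
    · obtain ⟨h1, k, e, h2, rfl⟩ := h1
      refine ⟨Finset.mem_image.mpr ⟨(u, k), Finset.mem_product.mpr
        ⟨Finset.mem_filter.mpr ⟨Finset.mem_univ _, h1⟩, (hlab u k e h2).1⟩, by simp [h2]⟩, ?_⟩
      have h3 := (hlab u k e h2).2
      have h4 := hA.le_cap u k e h2
      have h5 := hb u u.2
      have h6 := Nat.pair_lt_max_add_one_sq (u : ℕ) k
      have h7 := Nat.pair_lt_max_add_one_sq (Nat.pair u k) e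
      have h8 : max (u : ℕ) k ≤ P.n ^ P.b + 1 := max_le (by omega) h3
      have h9 : (max (u : ℕ) k + 1) ^ 2 ≤ (P.n ^ P.b + 2) ^ 2 := Nat.pow_le_pow_left (by omega) 2
      have h10 : max (Nat.pair u k) e ≤ (P.n ^ P.b + 2) ^ 2 + P.cap := max_le (by omega) (by omega)
      exact h7.le.trans (Nat.pow_le_pow_left (by omega) 2)
    · exact absurd rfl hl
  · have h1 : ((S ×ˢ T).image fun q => item q.1 q.2 ((m q.1).acc q.2).toNat).card ≤
        P.m * (P.m + 1) :=
      Finset.card_image_le.trans ((Finset.card_product _ _).le.trans (Nat.mul_le_mul hS hT))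
    unfold Params.R
    nlinarith
  · simp only [gInit_broadcast]
    rw [if_pos ⟨hy, k, e, he, rfl⟩]
    rfl

variable (P) in
/-- What the vertex `v` knows after the broadcast. -/
noncomputable def gKnown (m : N.ids → Mem) (v : N.ids) (y k : ℕ) : ℕ∞ :=
  known (N.localInput v) (m v) (gPipe P (P.I + 3) m P.R v).est y k

theorem gKnown_sound {m : N.ids → Mem} {v : N.ids} {y k e : ℕ} (h : gKnown P m v y k = e) :
    ∃ u : N.ids, (u : ℕ) = y ∧ (m u).acc k = e := by
  unfold gKnown known at h
  split_ifs at h with h1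
  · exact ⟨v, h1.symm, h⟩
  · have h2 : ∃ e', (gPipe P (P.I + 3) m P.R v).est (item y k e') ≠ ⊤ ∧ e' = e := by
      by_contra! h3
      have h4 : ((e + 1 : ℕ) : ℕ∞) ≤ (e : ℕ) := by
        rw [← h]
        refine le_iInf₂ fun e' he' => ?_
        have h5 := h3 e' he'
        have h6 : (e : ℕ∞) ≤ e' := h.ge.trans (iInf₂_le e' he')
        have h7 : e ≤ e' := by exact_mod_cast h6
        exact_mod_cast (show e + 1 ≤ e' by omega)
      exact absurd (show e + 1 ≤ e by exact_mod_cast h4) (by omega)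
    obtain ⟨e', h3, rfl⟩ := h2
    obtain ⟨u, k', e'', -, hu, hi⟩ := broadcast_sound h3
    obtain ⟨rfl, rfl, rfl⟩ := item_inj hi
    exact ⟨u, rfl, hu⟩

theorem gKnown_le (hN : N.graph.Connected) (hE : P.E = N.ecc)
    (hb : ∀ i ∈ N.ids, i ≤ P.n ^ P.b) {m : N.ids → Mem} {φ ℓ : N.ids → ℕ} {z : ℕ}
    (hS : (Finset.univ.filter fun v => (m v).coin = true).card ≤ P.m)
    (hA : AccInv P φ ℓ (fun v => (m v).coin) z fun v => (m v).acc) {y v : N.ids} {k : ℕ}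
    (hy : (m y).coin = true ∨ y = v) : gKnown P m v y k ≤ (m y).acc k := by
  unfold gKnown known
  split_ifs with h1
  · have : y = v := Subtype.ext h1
    rw [this]
  · rcases hy with hy | rfl
    · rcases eq_or_ne ((m y).acc k) ⊤ with h2 | h2
      · rw [h2]
        exact le_top
      · obtain ⟨e, he⟩ := ENat.ne_top_iff_exists.mp h2
        rw [← he]
        exact iInf₂_le e (broadcast_complete hN hE hb hS hA hy he.symm)
    · exact absurd rfl h1

/-! ### Correctness of the overlay -/

theorem Near.sound {i : ℕ} {m : N.ids → Mem} {φ ℓ : N.ids → ℕ} {z : ℕ} (hA0 : 0 < P.A)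
    (hA : AccInv P φ ℓ (fun v => (m v).coin) z fun v => (m v).acc) {v : N.ids}
    (h : Near P (N.localInput v) i (m v) (gPipe P (P.I + 3) m P.R v).est) :
    ∃ u c j, ℓ u < ℓ v ∧ Path (N.redW φ) u v c j ∧ 4 * P.I * c ≤ P.thr i := by
  obtain ⟨e, he, hle⟩ := h
  obtain ⟨v', hv, u, c, j, hl, hp, hc⟩ := overlay_sound (W := N.redW φ) (ℓ := ℓ) (A := P.A)
    (ι := fun v : N.ids => (v : ℕ)) (fun y e h => by
      obtain ⟨u, hu, h1⟩ := gKnown_sound h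
      exact ⟨u, hu, hA.sound_zero u e h1⟩) Subtype.val_injective (fun x y e h => by
      obtain ⟨u, hu, h1⟩ := gKnown_sound h
      obtain ⟨w, hw, -, h2⟩ := hA.sound_succ u x e h1
      exact ⟨w, u, hw, hu, h2⟩) he
  obtain rfl : v' = v := Subtype.ext hv
  refine ⟨u, c, j, hl, hp, Nat.le_of_mul_le_mul_left ?_ hA0⟩
  calc P.A * (4 * P.I * c) = 4 * P.I * (P.A * c) := by ring
    _ ≤ 4 * P.I * e := Nat.mul_le_mul_left _ hc
    _ ≤ _ := hle

/-- The walk is cut at its last entry into the layer and replaced by an optimal one, which the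
overlay approximates within the factor 1 + h/A. -/
theorem near_of_path (hN : N.graph.Connected) (hE : P.E = N.ecc)
    (hb : ∀ i ∈ N.ids, i ≤ P.n ^ P.b) {i : ℕ} {m : N.ids → Mem} {φ ℓ : N.ids → ℕ}
    (hS : (Finset.univ.filter fun v => (m v).coin = true).card ≤ P.m)
    (hA : AccInv P φ ℓ (fun v => (m v).coin) (P.I + 2) fun v => (m v).acc)
    (hH : Hits (N.redW φ) ℓ P.h fun v => (m v).coin = true) {u v : N.ids} {c j : ℕ}
    (hp : Path (N.redW φ) u v c j) (hl : ℓ u < ℓ v)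
    (hn : ∀ x y c' j', Path (N.redW φ) x y c' j' → c' ≤ c → ℓ y ≤ ℓ x + 1)
    (hcI : c ≤ 2 ^ P.I) (hc : 4 * P.I * ((P.A + P.h) * c) ≤ P.A * P.thr i) :
    Near P (N.localInput v) i (m v) (gPipe P (P.I + 3) m P.R v).est := by
  obtain ⟨c₁, hc₁, j₁, h1⟩ := hp.exists_enter hl hn
  obtain ⟨c₂, hc₂, j₂, h2⟩ := h1.exists_opt
  -- Lengths up to 2^I have at most I + 1 binary digits, and the scales 0, …, I + 1 have all been
  -- searched.
  have hsz : ∀ c, c ≤ 2 ^ P.I → Nat.size c < P.I + 2 := fun c hc => by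
    have := Nat.size_le_size hc
    rw [Nat.size_pow] at this
    omega
  obtain ⟨e, he, hatt⟩ := overlay_complete (W := N.redW φ) (ℓ := ℓ) (h := P.h) (B := 2 ^ P.I)
    (β := P.A + P.h) (S := fun v => (m v).coin = true) (v₀ := v)
    (ι := fun v : N.ids => (v : ℕ)) (D₀ := fun y => gKnown P m v y 0)
    (D₁ := fun x y => gKnown P m v y (x + 1))
    (fun y c j hy hen hj hB => (gKnown_le hN hE hb hS hA hy).trans
      (hA.complete_zero y c j hen hj (hsz c hB)))
    (fun x y c j hx hy hen hj hB => (gKnown_le hN hE hb hS hA hy).trans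
      (hA.complete_succ x y c j hx hen hj (hsz c hB))) hH j₂ v c₂ (Or.inr rfl) h2 (by omega)
  refine ⟨e, hatt, (Nat.mul_le_mul_left _ (he.trans (Nat.mul_le_mul_left _ ?_))).trans hc⟩
  omega

end Broadcast

/-! ### The invariant of the main loop -/

section Loop

variable {N : Network} {P : Params}

/-- This is where A = 2Ih is used: the factor 1 + h/A = 1 + 1/(2I) costs c/(2I), at most the
decrease of the radius factor from 2I − i to 2I − (i + 1). -/
theorem threshold_le {i c : ℕ} (hi : i < P.I)
    (hc : 2 * P.I * c ≤ 2 ^ (P.I - (i + 1)) * (2 * P.I - (i + 1))) :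
    4 * P.I * ((P.A + P.h) * c) ≤ P.A * P.thr i ∧ c ≤ 2 ^ (P.I - (i + 1)) := by
  unfold Params.thr Params.A
  rw [if_pos hi, show P.I - i = P.I - (i + 1) + 1 by omega, pow_succ]
  obtain ⟨y, hy⟩ : ∃ y, 2 * P.I - (i + 1) = y := ⟨_, rfl⟩
  rw [hy] at hc
  rw [show 2 * P.I - i = y + 1 by omega]
  generalize 2 ^ (P.I - (i + 1)) = X at *
  have h1 : c ≤ X := by
    have h2 : 2 * P.I * c ≤ 2 * P.I * X := by
      refine hc.trans ?_
      rw [mul_comm X]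
      exact Nat.mul_le_mul_right _ (by omega)
    exact Nat.le_of_mul_le_mul_left h2 (by omega)
  refine ⟨?_, h1⟩
  calc 4 * P.I * ((2 * P.I * P.h + P.h) * c) = 4 * P.I * P.h * (2 * P.I * c + c) := by ring
    _ ≤ 4 * P.I * P.h * (X * y + X) := Nat.mul_le_mul_left _ (add_le_add hc h1)
    _ = _ := by ring

variable (P) in
/-- The invariant for the potential and the levels, at the beginning of the refinement number `i` of
the iteration number `o`. -/
structure LevelInv (o i : ℕ) (φ ℓ : N.ids → ℕ) : Prop where
  feasible : Network.Feasible φ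
  progress : ∀ v, 8 ^ o * (N.distance N.source v - φ v) ≤ 7 ^ o * 2 ^ P.I
  layered : Layered (N.redW φ) N.source P.I i ℓ

variable (P) in
/-- The sampled vertices are few, and hit all long optimal walks. -/
def SampleInv (φ ℓ : N.ids → ℕ) (σ : N.ids → Bool) : Prop :=
  Hits (N.redW φ) ℓ P.h (fun v => σ v = true) ∧
    (Finset.univ.filter fun v => σ v = true).card ≤ P.m

variable (P) in
/-- The invariant at the beginning of a phase. -/
structure PhaseInv (o i p : ℕ) (m : N.ids → Mem) : Prop where
  level : LevelInv P o i (fun v => (m v).phi) fun v => (m v).lev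
  sample : SampleInv P (fun v => (m v).phi) (fun v => (m v).lev) fun v => (m v).coin
  nbr : 0 < p → NbrInv m
  acc : 0 < p → AccInv P (fun v => (m v).phi) (fun v => (m v).lev) (fun v => (m v).coin) (p - 1)
    fun v => (m v).acc

theorem PhaseInv.exchange (hd : ∀ v, N.distance N.source v ≤ 2 ^ P.I) (hN : N.graph.Connected)
    {o i : ℕ} (hi : i ≤ P.I) {m : N.ids → Mem} (h : PhaseInv P o i 0 m) (ω : N.ids → Bool) :
    PhaseInv P o i 1 (gFinish P i 0 m ω) := by
  refine ⟨h.level, h.sample, fun _ u v hadj => ?_, fun _ => ?_⟩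
  · change gPubs P m v u = ((m u).phi, (m u).lev)
    rw [gPubs, table_of_adj _ hadj.symm, min_eq_left, min_eq_left]
    · exact (h.level.layered.le u).trans (Nat.pow_le_pow_right (by norm_num) hi)
    · exact (Network.exists_path_distance hN h.level.feasible u).1.trans (hd u)
  · exact
      { sound_zero := fun v e he => absurd he.symm (ENat.natCast_ne_top e)
        sound_succ := fun v l e he => absurd he.symm (ENat.natCast_ne_top e)
        le_cap := fun v l e he => absurd he.symm (ENat.natCast_ne_top e)
        complete_zero := fun v c j _ _ hz => absurd hz (Nat.not_lt_zero _)
        complete_succ := fun x v c j _ _ _ hz => absurd hz (Nat.not_lt_zero _) }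

theorem gFinish_search {i p : ℕ} (h0 : 0 < p) (hp : p ≤ P.I + 2) (m : N.ids → Mem)
    (ω : N.ids → Bool) (v : N.ids) : (gFinish P i p m ω v).phi = (m v).phi ∧
      (gFinish P i p m ω v).lev = (m v).lev ∧ (gFinish P i p m ω v).coin = (m v).coin ∧
      (gFinish P i p m ω v).nbr = (m v).nbr := by
  unfold gFinish finish
  rw [if_neg (by omega), if_pos hp]
  exact ⟨rfl, rfl, rfl, rfl⟩

theorem PhaseInv.search (hb : ∀ i ∈ N.ids, i ≤ P.n ^ P.b) {o i p : ℕ} (h0 : 0 < p)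
    (hp : p ≤ P.I + 2) {m : N.ids → Mem} (h : PhaseInv P o i p m) (ω : N.ids → Bool) :
    PhaseInv P o i (p + 1) (gFinish P i p m ω) := by
  have hacc := AccInv.search hb (h.nbr h0) h.sample.2 (i := i) h0 hp ω (h.acc h0)
  have e1 : (fun v => (gFinish P i p m ω v).phi) = fun v => (m v).phi :=
    funext fun v => (gFinish_search h0 hp m ω v).1
  have e2 : (fun v => (gFinish P i p m ω v).lev) = fun v => (m v).lev :=
    funext fun v => (gFinish_search h0 hp m ω v).2.1
  have e3 : (fun v => (gFinish P i p m ω v).coin) = fun v => (m v).coin :=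
    funext fun v => (gFinish_search h0 hp m ω v).2.2.1
  refine ⟨?_, ?_, fun _ u v hadj => ?_, fun _ => ?_⟩
  · rw [e1, e2]
    exact h.level
  · rw [e1, e2, e3]
    exact h.sample
  · rw [(gFinish_search h0 hp m ω v).2.2.2, congrFun e1 u, congrFun e2 u]
    exact h.nbr h0 u v hadj
  · rw [e1, e2, e3]
    exact hacc

variable (P) in
/-- The levels after a refinement. -/
noncomputable def gLevel (i : ℕ) (m : N.ids → Mem) (v : N.ids) : ℕ :=
  newLevel P (N.localInput v) i (m v) (gPipe P (P.I + 3) m P.R v).est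

theorem gFinish_refine {i : ℕ} (hi : i < P.I) (m : N.ids → Mem) (ω : N.ids → Bool) (v : N.ids) :
    (gFinish P i (P.I + 3) m ω v).phi = (m v).phi ∧
      (gFinish P i (P.I + 3) m ω v).lev = gLevel P i m v ∧
      (gFinish P i (P.I + 3) m ω v).coin = ω v := by
  unfold gFinish finish
  rw [if_neg (by omega), if_neg (by omega), if_pos hi]
  exact ⟨rfl, rfl, rfl⟩

theorem gFinish_last (m : N.ids → Mem) (ω : N.ids → Bool) (v : N.ids) :
    (gFinish P P.I (P.I + 3) m ω v).phi = (m v).phi + (gLevel P P.I m v + 7) / 8 ∧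
      (gFinish P P.I (P.I + 3) m ω v).lev = (if v = N.source then 0 else 1) ∧
      (gFinish P P.I (P.I + 3) m ω v).coin = ω v := by
  unfold gFinish finish
  rw [if_neg (by omega), if_neg (by omega), if_neg (lt_irrefl _)]
  refine ⟨rfl, ?_, rfl⟩
  simp [Network.localInput]

theorem LevelInv.start {o : ℕ} (hN : N.graph.Connected)
    (hd : ∀ v, N.distance N.source v ≤ 2 ^ P.I) {φ : N.ids → ℕ} (hφ : Network.Feasible φ)
    (hp : ∀ v, 8 ^ o * (N.distance N.source v - φ v) ≤ 7 ^ o * 2 ^ P.I) :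
    LevelInv P o 0 φ fun v => if v = N.source then 0 else 1 := by
  refine ⟨hφ, hp, ?_⟩
  convert layered_zero (W := N.redW φ) (s := N.source) (I := P.I) fun v => ?_
  obtain ⟨h1, j, hj⟩ := Network.exists_path_distance hN hφ v
  exact ⟨_, j, hj, (Nat.sub_le _ _).trans (hd v)⟩

theorem LevelInv.refine (hN : N.graph.Connected) (hE : P.E = N.ecc)
    (hb : ∀ i ∈ N.ids, i ≤ P.n ^ P.b) (hh : 0 < P.h) {o i : ℕ} (hi : i < P.I) {m : N.ids → Mem}
    (h : PhaseInv P o i (P.I + 3) m) :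
    LevelInv P o (i + 1) (fun v => (m v).phi) (gLevel P i m) := by
  classical
  have hA0 : 0 < P.A := Nat.mul_pos (by omega) hh
  have hacc := h.acc (by omega)
  refine ⟨h.level.feasible, h.level.progress, ?_⟩
  have key := h.level.layered.refine hi
    (near := fun v => Near P (N.localInput v) i (m v) (gPipe P (P.I + 3) m P.R v).est)
    (fun v hv => by
      obtain ⟨u, c, j, hl, hp, hc⟩ := Near.sound hA0 hacc hv
      refine ⟨u, c, j, hl, hp, hc.trans (le_of_eq ?_)⟩
      exact if_pos hi)
    (fun u v c j hp hl hc => by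
      obtain ⟨h1, h2⟩ := threshold_le hi hc
      refine near_of_path hN hE hb h.sample.2 hacc h.sample.1 hp hl ?_
        (h2.trans (Nat.pow_le_pow_right (by norm_num) (by omega))) h1
      intro x y c' j' hp' hc'
      have := h.level.layered.narrow i le_rfl x y c' j' hp' ?_
      · simpa using this
      · refine (Nat.mul_le_mul_left _ hc').trans (hc.trans ?_)
        exact Nat.mul_le_mul (Nat.pow_le_pow_right (by norm_num) (by omega)) (by omega))
  convert key using 1
  funext v
  unfold gLevel newLevel
  rw [if_pos hi]

/-- Rounding ℓ/8 up keeps feasibility, since ℓ rises by at most 8 times the reduced weight, and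
gains at least an eighth of the gap, since ℓ is at least the reduced distance. -/
theorem LevelInv.last (hN : N.graph.Connected) (hE : P.E = N.ecc)
    (hb : ∀ i ∈ N.ids, i ≤ P.n ^ P.b) (hd : ∀ v, N.distance N.source v ≤ 2 ^ P.I)
    (hh : 0 < P.h) (hI : 0 < P.I) {o : ℕ} {m : N.ids → Mem} (h : PhaseInv P o P.I (P.I + 3) m) :
    LevelInv P (o + 1) 0 (fun v => (m v).phi + (gLevel P P.I m v + 7) / 8)
      fun v => if v = N.source then 0 else 1 := by
  classical
  have hA0 : 0 < P.A := Nat.mul_pos (by omega) hh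
  have hacc := h.acc (by omega)
  have hthr : P.thr P.I = 0 := if_neg (lt_irrefl _)
  have key := h.level.layered.final hI
    (near := fun v => Near P (N.localInput v) P.I (m v) (gPipe P (P.I + 3) m P.R v).est)
    (fun v hv => by
      obtain ⟨u, c, j, hl, hp, hc⟩ := Near.sound hA0 hacc hv
      rw [hthr] at hc
      have : c = 0 := by
        rcases Nat.eq_zero_or_pos c with h | h
        · exact h
        · have := Nat.mul_pos (show 0 < 4 * P.I by omega) h
          omega
      exact ⟨u, j, hl, this ▸ hp⟩)
    (fun u v j hp hl => by
      refine near_of_path hN hE hb h.sample.2 hacc h.sample.1 hp hl ?_ (Nat.zero_le _) (by simp)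
      intro x y c' j' hp' hc'
      have := h.level.layered.narrow P.I le_rfl x y c' j' hp' ?_
      · simpa using this
      · rw [Nat.le_zero.mp hc']
        simp)
  have hlev : ∀ v, gLevel P P.I m v = (m v).lev -
      if Near P (N.localInput v) P.I (m v) (gPipe P (P.I + 3) m P.R v).est then 1 else 0 := by
    intro v
    unfold gLevel newLevel
    rw [if_neg (lt_irrefl _), one_mul]
  simp only [← hlev] at key
  obtain ⟨key1, key2⟩ := key
  have hf := h.level.feasible
  refine LevelInv.start hN hd ⟨?_, fun u v hadj => ?_⟩ fun v => ?_
  · have h0 := h.level.layered.source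
    have h1 : gLevel P P.I m N.source = 0 := by rw [hlev]; omega
    have h2 : (m N.source).phi = 0 := hf.1
    simp [h1, h2]
  · have h1 := key1 u v _ (Network.redW_of_adj hadj)
    have h2 : (m v).phi ≤ (m u).phi + N.weight u v := hf.2 u v hadj
    dsimp only at h1 ⊢
    omega
  · obtain ⟨c, j, hp, hc⟩ := key2 v
    have h1 := Network.distance_le_of_path hf hp
    have h2 : 8 * (N.distance N.source v - ((m v).phi + (gLevel P P.I m v + 7) / 8)) ≤
        7 * (N.distance N.source v - (m v).phi) := by omega
    have h3 := h.level.progress v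
    calc 8 ^ (o + 1) * (N.distance N.source v - ((m v).phi + (gLevel P P.I m v + 7) / 8))
        = 8 ^ o * (8 * (N.distance N.source v -
          ((m v).phi + (gLevel P P.I m v + 7) / 8))) := by ring
      _ ≤ 8 ^ o * (7 * (N.distance N.source v - (m v).phi)) := Nat.mul_le_mul_left _ h2
      _ = 7 * (8 ^ o * (N.distance N.source v - (m v).phi)) := by ring
      _ ≤ 7 * (7 ^ o * 2 ^ P.I) := Nat.mul_le_mul_left _ h3
      _ = _ := by ring

/-- As 2 · 7^8 ≤ 8^8, eight iterations halve the gap; 8(I + 1) of them push the bound 2^I below 1.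
-/
theorem LevelInv.eq_distance (hN : N.graph.Connected) {φ ℓ : N.ids → ℕ}
    (h : LevelInv P P.J 0 φ ℓ) (v : N.ids) : φ v = N.distance N.source v := by
  have h1 := (Network.exists_path_distance hN h.feasible v).1
  by_contra hne
  have h2 := h.progress v
  have h3 : 8 ^ P.J ≤ 7 ^ P.J * 2 ^ P.I :=
    le_trans (Nat.le_mul_of_pos_right _ (by omega)) h2
  unfold Params.J at h3
  rw [pow_mul, pow_mul] at h3
  have h4 : (7 ^ 8) ^ (P.I + 1) * 2 ^ P.I < (8 ^ 8) ^ (P.I + 1) := by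
    calc (7 ^ 8) ^ (P.I + 1) * 2 ^ P.I < (7 ^ 8) ^ (P.I + 1) * 2 ^ (P.I + 1) := by
          refine Nat.mul_lt_mul_of_pos_left (Nat.pow_lt_pow_right (by norm_num) (by omega))
            (by positivity)
      _ = (7 ^ 8 * 2) ^ (P.I + 1) := (mul_pow _ _ _).symm
      _ ≤ _ := Nat.pow_le_pow_left (by norm_num) _
  omega

end Loop

/-! ### Sampling -/

section Sampling

theorem one_sub_pow_le {p : NNReal} (hp : p ≤ 1) {k t : ℕ} (hk : 1 ≤ p * k) :
    (1 - (p : ℝ≥0∞)) ^ (k * t) ≤ (2 ^ t)⁻¹ := by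
  have h1 : (1 - (p : ℝ)) ^ k ≤ 1 / 2 := by
    calc (1 - (p : ℝ)) ^ k ≤ (Real.exp (-p)) ^ k :=
          pow_le_pow_left₀ (sub_nonneg.mpr (by exact_mod_cast hp)) (Real.one_sub_le_exp_neg _) k
      _ = Real.exp (-(p * k)) := by rw [← Real.exp_nat_mul]; ring_nf
      _ ≤ Real.exp (-1) := Real.exp_le_exp.mpr (neg_le_neg (by exact_mod_cast hk))
      _ ≤ 1 / 2 := by
        rw [Real.exp_neg, one_div]
        exact inv_anti₀ two_pos (by linarith [Real.add_one_le_exp 1])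
  have h2 : (1 - p) ^ k ≤ (2 : NNReal)⁻¹ := by
    rw [← NNReal.coe_le_coe]
    push_cast [NNReal.coe_sub hp]
    simpa using h1
  have h3 : (1 - (p : ℝ≥0∞)) ^ k ≤ 2⁻¹ := by
    have := ENNReal.coe_le_coe.mpr h2
    rwa [ENNReal.coe_pow, ENNReal.coe_sub, ENNReal.coe_inv two_ne_zero] at this
  rw [pow_mul, ENNReal.inv_pow]
  exact pow_le_pow_left' h3 t

/-- (1 + p)^n ≤ e^(pn) ≤ e^g ≤ 4^g, which the 2g in the exponent cancels. -/
theorem one_add_pow_div_le {p : NNReal} {n g t : ℕ} (hg : p * n ≤ g) :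
    (1 + (p : ℝ≥0∞)) ^ n / 2 ^ (2 * g + 2 * t) ≤ (2 ^ t)⁻¹ := by
  have h1 : (1 + (p : ℝ)) ^ n ≤ 2 ^ (2 * g) := by
    calc (1 + (p : ℝ)) ^ n ≤ (Real.exp p) ^ n :=
          pow_le_pow_left₀ (by positivity) (by linarith [Real.add_one_le_exp (p : ℝ)]) n
      _ = Real.exp (p * n) := by rw [← Real.exp_nat_mul]; ring_nf
      _ ≤ Real.exp (g * 1) := Real.exp_le_exp.mpr (by rw [mul_one]; exact_mod_cast hg)
      _ = Real.exp 1 ^ g := Real.exp_nat_mul _ _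
      _ ≤ (2 ^ 2) ^ g := pow_le_pow_left₀ (Real.exp_nonneg _)
          (by linarith [Real.exp_one_lt_d9]) _
      _ = _ := (pow_mul _ _ _).symm
  have h2 : (1 + p) ^ n ≤ (2 : NNReal) ^ (2 * g) := by
    rw [← NNReal.coe_le_coe]
    exact_mod_cast h1
  have h3 : (1 + (p : ℝ≥0∞)) ^ n ≤ 2 ^ (2 * g) := by exact_mod_cast ENNReal.coe_le_coe.mpr h2
  have h4 : (2 : ℝ≥0∞) ^ t ≤ 2 ^ (2 * t) := pow_le_pow_right' one_le_two (by omega)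
  refine (ENNReal.div_le_div_right h3 _).trans ?_
  rw [pow_add, ENNReal.div_eq_inv_mul, ENNReal.mul_inv (by simp) (by simp),
    mul_comm, ← mul_assoc, ENNReal.mul_inv_cancel (by simp) (by simp), one_mul]
  exact ENNReal.inv_le_inv.mpr h4

variable {N : Network} {P : Params}

/-- Vacuous: a window of `Fintype.card V` distinct predecessors would contain `v` itself. It covers
the case in which `h` is cut off at n. -/
theorem hits_of_window {V : Type} [Fintype V] {W : V → V → ℕ∞} {ℓ : V → ℕ} {S : V → Prop} :
    Hits W ℓ (Fintype.card V) S := by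
  intro v c j ho hj
  obtain ⟨F, hF, h⟩ := ho.exists_window hj
  have hv : v ∈ F := by
    rw [Finset.card_eq_iff_eq_univ] at hF
    rw [hF]
    exact Finset.mem_univ v
  obtain ⟨c₂, j₂, _, _, ho', hlt, -⟩ := h v hv
  have := (ho.unique ho').2
  omega

/-- By uniqueness of the optimal pair, one window per vertex can be fixed independently of the
coins; a union bound over the vertices follows. -/
theorem coins_hits_le {V : Type} [Fintype V] {p : NNReal} (hp : p ≤ 1) (W : V → V → ℕ∞)
    (ℓ : V → ℕ) (h : ℕ) : (indep fun _ : V => coin p).toOuterMeasure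
      {ω | ¬ Hits W ℓ h fun v => ω v = true} ≤ Fintype.card V * (1 - (p : ℝ≥0∞)) ^ h := by
  have key : ∀ v, ∃ F : Finset V, ∃ q : Prop, (q → F.card = h) ∧
      ∀ c j, OptEnter W ℓ v c j → h ≤ j → q ∧ ∀ x ∈ F, ∃ c₂ j₂ c₁ j₁,
        OptEnter W ℓ x c₂ j₂ ∧ j₂ < j ∧ Path (cellWeight W ℓ) x v c₁ j₁ ∧ j₁ ≤ h ∧ c = c₂ + c₁ := by
    intro v
    by_cases hv : ∃ c j, OptEnter W ℓ v c j ∧ h ≤ j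
    · obtain ⟨c, j, ho, hj⟩ := hv
      obtain ⟨F, hF, hx⟩ := ho.exists_window hj
      refine ⟨F, True, fun _ => hF, fun c' j' ho' hj' => ⟨trivial, ?_⟩⟩
      obtain ⟨rfl, rfl⟩ := ho.unique ho'
      exact hx
    · exact ⟨∅, False, False.elim, fun c j ho hj => absurd ⟨c, j, ho, hj⟩ hv⟩
  choose F q hF hq using key
  have hsub : {ω : V → Bool | ¬ Hits W ℓ h fun v => ω v = true} ⊆
      ⋃ v, {ω | q v ∧ ∀ x ∈ F v, ω x = false} := by
    intro ω hω
    by_contra hne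
    rw [Set.mem_iUnion, not_exists] at hne
    refine hω fun v c j ho hj => ?_
    obtain ⟨hqv, hx⟩ := hq v c j ho hj
    have := hne v
    simp only [Set.mem_ofPred_eq, not_and, not_forall, Bool.not_eq_false] at this
    obtain ⟨x, hxF, hxω⟩ := this hqv
    obtain ⟨c₂, j₂, c₁, j₁, h1, h2, h3, h4, h5⟩ := hx x hxF
    exact ⟨x, c₂, j₂, c₁, j₁, hxω, h1, h2, h3, h4, h5⟩
  refine (MeasureTheory.measure_mono hsub).trans
    ((MeasureTheory.measure_iUnion_fintype_le _ _).trans ?_)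
  refine (Finset.sum_le_card_nsmul _ _ ((1 - (p : ℝ≥0∞)) ^ h) fun v _ => ?_).trans
    (le_of_eq (by rw [nsmul_eq_mul, Finset.card_univ]))
  by_cases hqv : q v
  · have := coins_miss_le p hp (F v)
    rw [hF v hqv] at this
    exact (MeasureTheory.measure_mono fun ω hω => hω.2).trans this
  · simp [hqv]

theorem coins_sample_le (hn : P.n = N.size) (hn2 : 2 ≤ P.n) (φ ℓ : N.ids → ℕ) :
    (indep fun _ : N.ids => coin (P.g / (N.size : NNReal))).toOuterMeasure
      {ω | ¬ SampleInv P φ ℓ ω} ≤ (N.size + 1) * (2 ^ P.t)⁻¹ := by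
  have hcard : Fintype.card N.ids = P.n := by rw [hn]; exact Fintype.card_coe _
  have hgn : P.g ≤ P.n := by
    have h1 := Nat.sqrt_le_self (Nat.sqrt P.n)
    have h2 := Nat.sqrt_lt_self (n := P.n) (by omega)
    unfold Params.g
    omega
  have hg0 : 0 < P.g := Nat.succ_pos _
  rw [← hn]
  have hn0 : (P.n : NNReal) ≠ 0 := by exact_mod_cast (show P.n ≠ 0 by omega)
  set p : NNReal := P.g / (P.n : NNReal) with hp
  have hp1 : p ≤ 1 := by
    rw [hp]
    exact div_le_one_of_le₀ (by exact_mod_cast hgn) zero_le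
  have hpn : p * P.n = P.g := div_mul_cancel₀ _ hn0
  have hsub : {ω : N.ids → Bool | ¬ SampleInv P φ ℓ ω} ⊆
      {ω | ¬ Hits (N.redW φ) ℓ P.h fun v => ω v = true} ∪
        {ω | P.m < (Finset.univ.filter fun v => ω v = true).card} := by
    intro ω hω
    by_contra h
    rw [Set.mem_union, not_or] at h
    exact hω ⟨not_not.mp h.1, not_lt.mp h.2⟩
  refine (MeasureTheory.measure_mono hsub).trans ((MeasureTheory.measure_union_le _ _).trans ?_)
  rw [add_mul, one_mul]
  refine add_le_add ?_ ?_
  · rcases min_choice ((P.n / P.g + 1) * P.t) P.n with h | h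
    · have h' : P.h = (P.n / P.g + 1) * P.t := h
      rw [h']
      refine (coins_hits_le hp1 _ _ _).trans ?_
      rw [hcard]
      gcongr
      refine one_sub_pow_le hp1 ?_
      have h3 : P.n ≤ P.g * (P.n / P.g + 1) := (Nat.lt_mul_div_succ P.n hg0).le
      have h4 : (P.n : NNReal) ≤ P.g * ((P.n / P.g + 1 : ℕ) : NNReal) := by exact_mod_cast h3
      rw [hp, div_mul_eq_mul_div, one_le_div (by positivity)]
      exact h4
    · have h' : P.h = Fintype.card N.ids := h.trans hcard.symm
      rw [h']
      have : {ω : N.ids → Bool | ¬ Hits (N.redW φ) ℓ (Fintype.card N.ids) fun v => ω v = true} =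
          ∅ := by
        ext ω
        simp only [Set.mem_ofPred_eq, Set.mem_empty_iff_false, iff_false, not_not]
        exact hits_of_window
      rw [this]
      simp
  · refine (coins_many_le p hp1 P.m).trans ?_
    rw [hcard]
    exact one_add_pow_div_le hpn.le

end Sampling

/-! ### The main loop -/

section Main

variable {a b τ : ℕ} {N : Network}

theorem distance_le_two_pow (hV : N.Valid a b) (v : N.ids) :
    N.distance N.source v ≤ 2 ^ (N.params a b τ).I := by
  refine (Network.distance_le_pow hV v).trans ?_
  change N.size ^ (a + 1) ≤ 2 ^ ((a + 1) * Nat.clog 2 N.size)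
  rw [mul_comm, pow_mul]
  exact Nat.pow_le_pow_left (Nat.le_pow_clog one_lt_two _) _

theorem params_I_pos (hn : 2 ≤ N.size) : 0 < (N.params a b τ).I :=
  Nat.mul_pos (Nat.succ_pos a) (Nat.clog_pos one_lt_two hn)

theorem params_h_pos (hn : 2 ≤ N.size) (hτ : 0 < τ) : 0 < (N.params a b τ).h :=
  lt_min (Nat.mul_pos (Nat.succ_pos _) (Nat.mul_pos hτ (Nat.clog_pos one_lt_two hn)))
    (show 0 < N.size by omega)

theorem indep_not_le_zero {ι : Type} [Fintype ι] {q : ι → PMF Bool} {Inv : (ι → Bool) → Prop}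
    (h : ∀ ω, Inv ω) : (indep q).toOuterMeasure {ω | ¬ Inv ω} ≤ 0 := by
  simp [h]

theorem holds_phases (hV : N.Valid a b) {r o i : ℕ} {ε : ℝ≥0∞} (ho : o ≠ (N.params a b τ).J)
    (hi : i ≤ (N.params a b τ).I)
    (h : (ssspAlgorithm a b τ).Holds N r
      (WorkSet (N.params a b τ) o i 0 0 (PhaseInv (N.params a b τ) o i 0)) ε) (p : ℕ)
    (hp : p ≤ (N.params a b τ).I + 3) :
    (ssspAlgorithm a b τ).Holds N (r + p * (N.params a b τ).R)
      (WorkSet (N.params a b τ) o i p 0 (PhaseInv (N.params a b τ) o i p)) ε := by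
  induction p with
  | zero => simpa using h
  | succ p ih =>
    have hnext : nextPhase (N.params a b τ) o i p = (o, i, p + 1) := if_pos (by omega)
    have := holds_phase (Inv' := PhaseInv (N.params a b τ) o i (p + 1)) (δ := 0) ho
      (ih (by omega)) fun m hm => indep_not_le_zero fun ω => ?_
    · rw [hnext, add_zero] at this
      rw [add_mul, one_mul, ← add_assoc]
      exact this
    · rcases Nat.eq_zero_or_pos p with rfl | h0
      · exact hm.exchange (distance_le_two_pow hV) hV.connected hi ω
      · exact hm.search hV.id_le h0 (by omega) ω

/-- A bound on the probability that a sample is bad. -/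
noncomputable def sampleFail (P : Params) : ℝ≥0∞ := (P.n + 1) * (2 ^ P.t)⁻¹

theorem PhaseInv.of_level {P : Params} {o i : ℕ} {m : N.ids → Mem} {φ ℓ : N.ids → ℕ}
    {σ : N.ids → Bool} (h : LevelInv P o i φ ℓ) (hs : SampleInv P φ ℓ σ)
    (hm : ∀ v, (m v).phi = φ v ∧ (m v).lev = ℓ v ∧ (m v).coin = σ v) : PhaseInv P o i 0 m := by
  obtain rfl : (fun v => (m v).phi) = φ := funext fun v => (hm v).1
  obtain rfl : (fun v => (m v).lev) = ℓ := funext fun v => (hm v).2.1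
  obtain rfl : (fun v => (m v).coin) = σ := funext fun v => (hm v).2.2
  exact ⟨h, hs, fun h0 => absurd h0 (lt_irrefl 0), fun h0 => absurd h0 (lt_irrefl 0)⟩

/-- The new levels are a function of the memories `m` alone, hence fixed before the coins that will
sample for them are drawn. -/
theorem holds_refinement (hV : N.Valid a b) (hn : 2 ≤ N.size) (hτ : 0 < τ) {r o i : ℕ}
    {ε : ℝ≥0∞} (ho : o ≠ (N.params a b τ).J) (hi : i < (N.params a b τ).I)
    (h : (ssspAlgorithm a b τ).Holds N r
      (WorkSet (N.params a b τ) o i 0 0 (PhaseInv (N.params a b τ) o i 0)) ε) :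
    (ssspAlgorithm a b τ).Holds N (r + ((N.params a b τ).I + 4) * (N.params a b τ).R)
      (WorkSet (N.params a b τ) o (i + 1) 0 0 (PhaseInv (N.params a b τ) o (i + 1) 0))
      (ε + sampleFail (N.params a b τ)) := by
  have hnext : nextPhase (N.params a b τ) o i ((N.params a b τ).I + 3) = (o, i + 1, 0) :=
    (if_neg (lt_irrefl _)).trans (if_pos hi)
  have := holds_phase (Inv' := PhaseInv (N.params a b τ) o (i + 1) 0) ho
    (holds_phases hV ho hi.le h _ le_rfl) fun m hm =>
      (MeasureTheory.measure_mono ?_).trans (coins_sample_le (P := N.params a b τ) rfl hn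
        (fun v => (m v).phi) (gLevel (N.params a b τ) i m))
  · rw [hnext, add_assoc, ← Nat.succ_mul] at this
    exact this
  · exact fun ω hω hs => hω (PhaseInv.of_level (LevelInv.refine hV.connected rfl hV.id_le
      (params_h_pos hn hτ) hi hm) hs (gFinish_refine hi m ω))

theorem holds_last (hV : N.Valid a b) (hn : 2 ≤ N.size) (hτ : 0 < τ) {r o : ℕ}
    {ε : ℝ≥0∞} (ho : o ≠ (N.params a b τ).J)
    (h : (ssspAlgorithm a b τ).Holds N r (WorkSet (N.params a b τ) o (N.params a b τ).I 0 0
      (PhaseInv (N.params a b τ) o (N.params a b τ).I 0)) ε) :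
    (ssspAlgorithm a b τ).Holds N (r + ((N.params a b τ).I + 4) * (N.params a b τ).R)
      (WorkSet (N.params a b τ) (o + 1) 0 0 0 (PhaseInv (N.params a b τ) (o + 1) 0 0))
      (ε + sampleFail (N.params a b τ)) := by
  have hnext : nextPhase (N.params a b τ) o (N.params a b τ).I ((N.params a b τ).I + 3) =
      (o + 1, 0, 0) := (if_neg (lt_irrefl _)).trans (if_neg (lt_irrefl _))
  have := holds_phase (Inv' := PhaseInv (N.params a b τ) (o + 1) 0 0) ho
    (holds_phases hV ho le_rfl h _ le_rfl) fun m hm =>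
      (MeasureTheory.measure_mono ?_).trans (coins_sample_le (P := N.params a b τ) rfl hn
        (fun v => (m v).phi + (gLevel (N.params a b τ) (N.params a b τ).I m v + 7) / 8)
        fun v => if v = N.source then 0 else 1)
  · rw [hnext, add_assoc, ← Nat.succ_mul] at this
    exact this
  · exact fun ω hω hs => hω (PhaseInv.of_level (LevelInv.last hV.connected rfl hV.id_le
      (distance_le_two_pow hV) (params_h_pos hn hτ) (params_I_pos hn) hm) hs (gFinish_last m ω))

theorem holds_iteration (hV : N.Valid a b) (hn : 2 ≤ N.size) (hτ : 0 < τ) {r o : ℕ}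
    {ε : ℝ≥0∞} (ho : o ≠ (N.params a b τ).J)
    (h : (ssspAlgorithm a b τ).Holds N r
      (WorkSet (N.params a b τ) o 0 0 0 (PhaseInv (N.params a b τ) o 0 0)) ε) :
    (ssspAlgorithm a b τ).Holds N
      (r + ((N.params a b τ).I + 1) * (((N.params a b τ).I + 4) * (N.params a b τ).R))
      (WorkSet (N.params a b τ) (o + 1) 0 0 0 (PhaseInv (N.params a b τ) (o + 1) 0 0))
      (ε + ((N.params a b τ).I + 1 : ℕ) * sampleFail (N.params a b τ)) := by
  have key : ∀ i ≤ (N.params a b τ).I, (ssspAlgorithm a b τ).Holds N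
      (r + i * (((N.params a b τ).I + 4) * (N.params a b τ).R))
      (WorkSet (N.params a b τ) o i 0 0 (PhaseInv (N.params a b τ) o i 0))
      (ε + i * sampleFail (N.params a b τ)) := by
    intro i
    induction i with
    | zero => intro _; simpa using h
    | succ i ih =>
      intro hi
      have := holds_refinement hV hn hτ ho hi (ih (by omega))
      rw [Nat.add_one_mul i, ← add_assoc]
      exact this.mono subset_rfl (by rw [add_assoc, Nat.cast_succ i, add_one_mul])
  have := holds_last hV hn hτ ho (key _ le_rfl)
  rw [Nat.add_one_mul (N.params a b τ).I, ← add_assoc]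
  exact this.mono subset_rfl (by rw [add_assoc, Nat.cast_succ (N.params a b τ).I, add_one_mul])

/-- The number of rounds of the algorithm. -/
def Params.rounds (P : Params) : ℕ :=
  3 * P.E + 3 + P.J * ((P.I + 1) * ((P.I + 4) * P.R))

theorem successProb_le (hV : N.Valid a b) (hn : 2 ≤ N.size) (hτ : 0 < τ) :
    1 - ((1 + (N.params a b τ).J * ((N.params a b τ).I + 1) : ℕ) : ℝ≥0∞) *
      sampleFail (N.params a b τ) ≤
      (ssspAlgorithm a b τ).successProb N (N.params a b τ).rounds := by
  have hstart : (ssspAlgorithm a b τ).Holds N (3 * N.ecc + 3)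
      (WorkSet (N.params a b τ) 0 0 0 0 (PhaseInv (N.params a b τ) 0 0 0))
      (sampleFail (N.params a b τ)) := by
    refine holds_start hV.connected ((MeasureTheory.measure_mono ?_).trans
      (coins_sample_le (P := N.params a b τ) rfl hn (fun _ => 0)
        fun v => if v = N.source then 0 else 1))
    intro ω hω hs
    refine hω (PhaseInv.of_level (LevelInv.start hV.connected (distance_le_two_pow hV)
      ⟨rfl, fun _ _ _ => Nat.zero_le _⟩ fun v => ?_) hs fun v => ⟨rfl, ?_, rfl⟩)
    · simpa using distance_le_two_pow hV v
    · simp [startMem, Network.localInput]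
  have key : ∀ o ≤ (N.params a b τ).J, (ssspAlgorithm a b τ).Holds N
      (3 * N.ecc + 3 +
        o * (((N.params a b τ).I + 1) * (((N.params a b τ).I + 4) * (N.params a b τ).R)))
      (WorkSet (N.params a b τ) o 0 0 0 (PhaseInv (N.params a b τ) o 0 0))
      (sampleFail (N.params a b τ) +
        o * (((N.params a b τ).I + 1 : ℕ) * sampleFail (N.params a b τ))) := by
    intro o
    induction o with
    | zero => intro _; simpa using hstart
    | succ o ih =>
      intro ho
      have := holds_iteration hV hn hτ (show o ≠ _ by omega) (ih (by omega))
      rw [Nat.add_one_mul o, ← add_assoc]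
      exact this.mono subset_rfl (by rw [add_assoc, Nat.cast_succ o, add_one_mul])
  have hend := (key _ le_rfl).mono (G' := {σ | ∀ t, (ssspAlgorithm a b τ).output (σ t) =
    some (N.distance N.source t)}) ?_ le_rfl
  · refine le_trans (le_of_eq ?_) hend.le_toOuterMeasure
    rw [Nat.cast_add, Nat.cast_mul, Nat.cast_one, add_mul, one_mul, mul_assoc]
  · rintro σ ⟨m, hm, rfl⟩ t
    have h1 := hm.level.eq_distance hV.connected t
    rw [← h1]
    exact if_pos rfl

end Main

/-! ### Bounds for the parameters -/

section Bounds

variable {a b τ : ℕ} {N : Network}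

theorem Network.one_le_ecc (hN : N.graph.Connected) (hn : 2 ≤ N.size) : 1 ≤ N.ecc := by
  have hcard : 1 < Fintype.card N.ids := by
    rw [Fintype.card_coe]
    exact hn
  obtain ⟨v, hv⟩ := Fintype.exists_ne_of_one_lt_card hcard N.source
  exact (hN.pos_dist_of_ne hv.symm).trans_le (depth_le_ecc v)

theorem failure_le (hn : 2 ≤ N.size) (c : ℕ) (hτ : c + 2 * a + 10 ≤ τ) :
    ((1 + (N.params a b τ).J * ((N.params a b τ).I + 1) : ℕ) : ℝ≥0∞) *
      sampleFail (N.params a b τ) ≤ 1 / (N.size : ℝ≥0∞) ^ c := by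
  have hL : Nat.clog 2 N.size ≤ N.size := Nat.clog_le_of_le_pow Nat.lt_two_pow_self.le
  have ha : a + 2 ≤ N.size ^ (a + 1) :=
    (Nat.lt_two_pow_self (n := a + 1)).trans_le (Nat.pow_le_pow_left hn _)
  have hI : (N.params a b τ).I + 1 ≤ N.size ^ (a + 1) * N.size := by
    calc (N.params a b τ).I + 1 ≤ (a + 1) * N.size + N.size :=
          add_le_add (Nat.mul_le_mul_left _ hL) (by omega)
      _ = (a + 2) * N.size := by ring
      _ ≤ _ := Nat.mul_le_mul_right _ ha
  have h16 : 16 ≤ N.size ^ 4 := Nat.pow_le_pow_left hn 4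
  have hX : (1 + (N.params a b τ).J * ((N.params a b τ).I + 1)) * (N.size + 1) * N.size ^ c ≤
      2 ^ (N.params a b τ).t := by
    calc (1 + (N.params a b τ).J * ((N.params a b τ).I + 1)) * (N.size + 1) * N.size ^ c
        ≤ (16 * ((N.params a b τ).I + 1) ^ 2) * (N.size * N.size) * N.size ^ c := by
          refine Nat.mul_le_mul_right _ (Nat.mul_le_mul ?_ (by nlinarith))
          unfold Params.J
          nlinarith [Nat.zero_le (N.params a b τ).I]
      _ ≤ (N.size ^ 4 * (N.size ^ (a + 1) * N.size) ^ 2) * (N.size * N.size) * N.size ^ c := by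
          gcongr
      -- The exponent is 4 for the constant 16, 2(a + 2) for (I + 1)², 2 for n(n + 1), and c for the
      -- required probability; this fixes the slack `τ`.
      _ = N.size ^ (c + 2 * a + 10) := by ring
      _ ≤ N.size ^ τ := Nat.pow_le_pow_right (by omega) hτ
      _ ≤ (2 ^ Nat.clog 2 N.size) ^ τ :=
        Nat.pow_le_pow_left (Nat.le_pow_clog one_lt_two _) _
      _ = 2 ^ (τ * Nat.clog 2 N.size) := by rw [← pow_mul, mul_comm]
  have hX' : ((1 + (N.params a b τ).J * ((N.params a b τ).I + 1) : ℕ) : ℝ≥0∞) *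
      (N.size + 1) * (N.size : ℝ≥0∞) ^ c ≤ 2 ^ (N.params a b τ).t := by
    exact_mod_cast hX
  have hn0 : (N.size : ℝ≥0∞) ^ c ≠ 0 := pow_ne_zero _ (by
    exact_mod_cast (show N.size ≠ 0 by omega))
  have hnt : (N.size : ℝ≥0∞) ^ c ≠ ⊤ := ENNReal.pow_ne_top (ENNReal.natCast_ne_top _)
  rw [show sampleFail (N.params a b τ) = (N.size + 1) * (2 ^ (N.params a b τ).t)⁻¹ from rfl]
  rw [ENNReal.le_div_iff_mul_le (Or.inl hn0) (Or.inl hnt), ← mul_assoc, mul_right_comm]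
  refine (mul_le_mul_left hX' _).trans (le_of_eq ?_)
  exact ENNReal.mul_inv_cancel (by simp) (by simp)

/-- All transmitted numbers are bounded by powers of Y = 2^⌈log₂ n⌉; the largest bound is that for
the labels, `Λ`. The exponent grows by one to make room for X + 2. -/
theorem bandwidth_le (hV : N.Valid a b) (hn : 2 ≤ N.size) :
    (ssspAlgorithm a b τ).BandwidthAtMost N
      (8 * (4 * a + 4 * b + 27) * Nat.clog 2 N.size) := by
  obtain ⟨Y, hY⟩ : ∃ Y, 2 ^ Nat.clog 2 N.size = Y := ⟨_, rfl⟩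
  have hnY : N.size ≤ Y := hY ▸ Nat.le_pow_clog one_lt_two _
  have hLY : Nat.clog 2 N.size ≤ Y := hY ▸ Nat.lt_two_pow_self.le
  have hY2 : 2 ≤ Y := hn.trans hnY
  have hY1 : 1 ≤ Y := by omega
  have hmono : ∀ {i j : ℕ}, i ≤ j → Y ^ i ≤ Y ^ j := fun h => Nat.pow_le_pow_right hY1 h
  have hthree : ∀ {x y z i j k l : ℕ}, x ≤ Y ^ i → y ≤ Y ^ j → z ≤ Y ^ k → i ≤ l → j ≤ l →
      k ≤ l → x + y + z ≤ Y ^ (l + 2) := by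
    intro x y z i j k l hx hy hz h1 h2 h3
    have := hx.trans (hmono h1)
    have := hy.trans (hmono h2)
    have := hz.trans (hmono h3)
    have h4 : 4 * Y ^ l ≤ Y ^ (l + 2) := by
      rw [pow_add, mul_comm]
      exact Nat.mul_le_mul_left _ (Nat.pow_le_pow_left hY2 2)
    omega
  have hI2 : 2 ^ (N.params a b τ).I = Y ^ (a + 1) := by
    change 2 ^ ((a + 1) * Nat.clog 2 N.size) = _
    rw [mul_comm, pow_mul, hY]
  have hI : (N.params a b τ).I ≤ Y ^ (a + 1) := hI2 ▸ Nat.lt_two_pow_self.le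
  have hh : (N.params a b τ).h ≤ Y := (min_le_right _ _).trans hnY
  have hA : (N.params a b τ).A ≤ Y ^ (a + 3) := by
    calc (N.params a b τ).A ≤ Y * Y ^ (a + 1) * Y :=
          Nat.mul_le_mul (Nat.mul_le_mul hY2 hI) hh
      _ = _ := by ring
  have hE : (N.params a b τ).E ≤ Y := (Network.ecc_lt_size hV.connected).le.trans hnY
  have hdouble : ∀ {x i : ℕ}, x ≤ Y ^ i → 2 * x ≤ Y ^ (i + 1) := by
    intro x i hx
    rw [pow_succ, mul_comm 2]
    exact Nat.mul_le_mul hx hY2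
  have hK : (N.params a b τ).K ≤ Y ^ (a + 6) :=
    hthree (l := a + 4) (hdouble hA) (hh.trans (pow_one Y).ge)
      (hdouble (hE.trans (pow_one Y).ge)) le_rfl (by omega) (by omega)
  have hcap : (N.params a b τ).cap ≤ Y ^ (2 * a + 7) := by
    calc (N.params a b τ).cap ≤ Y ^ (a + 1) * Y ^ (a + 6) := Nat.mul_le_mul hI2.le hK
      _ = _ := by ring
  have hb : N.size ^ b + 2 ≤ Y ^ (b + 2) := by
    have := Nat.pow_le_pow_left hnY b
    have h1 : N.size ^ b + 1 + 1 ≤ Y ^ (b + 2) :=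
      hthree this (pow_zero Y).ge (pow_zero Y).ge le_rfl (Nat.zero_le _) (Nat.zero_le _)
    omega
  have hΛ : (N.params a b τ).Λ ≤ Y ^ (4 * a + 4 * b + 26) := by
    have h1 : (N.size ^ b + 2) ^ 2 ≤ Y ^ (2 * b + 4) := by
      calc (N.size ^ b + 2) ^ 2 ≤ (Y ^ (b + 2)) ^ 2 := Nat.pow_le_pow_left hb 2
        _ = _ := by ring
    have h2 : (N.size ^ b + 2) ^ 2 + (N.params a b τ).cap + 1 ≤ Y ^ (2 * a + 2 * b + 11 + 2) :=
      hthree h1 hcap (pow_zero Y).ge (by omega) (by omega) (by omega)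
    calc (N.params a b τ).Λ ≤ (Y ^ (2 * a + 2 * b + 11 + 2)) ^ 2 := Nat.pow_le_pow_left h2 2
      _ = _ := by ring
  have hX2 : 2 ≤ Y ^ (4 * a + 4 * b + 26) := hY2.trans (Nat.le_self_pow (by omega) Y)
  rw [mul_assoc]
  refine bandwidthAtMost hV.connected (X := Y ^ (4 * a + 4 * b + 26)) ?_ ?_ (by omega) ?_ ?_ hΛ
  · rw [mul_comm (4 * a + 4 * b + 27), pow_mul, hY, pow_succ Y (4 * a + 4 * b + 26)]
    nlinarith
  · exact hnY.trans (Nat.le_self_pow (by omega) Y)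
  · exact hI2.le.trans (hmono (by omega))
  · exact hK.trans (hmono (by omega))

/-! ### The number of rounds -/

theorem lt_params_g_pow (P : Params) : P.n < P.g ^ 4 := by
  have h1 := Nat.lt_succ_sqrt' P.n
  have h2 := Nat.lt_succ_sqrt' (Nat.sqrt P.n)
  calc P.n < (Nat.sqrt P.n + 1) ^ 2 := h1
    _ ≤ ((Nat.sqrt (Nat.sqrt P.n) + 1) ^ 2) ^ 2 := Nat.pow_le_pow_left h2 2
    _ = P.g ^ 4 := by unfold Params.g; ring

theorem params_g_pow_le (P : Params) : (P.g - 1) ^ 4 ≤ P.n := by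
  have h1 := Nat.sqrt_le' P.n
  have h2 := Nat.sqrt_le' (Nat.sqrt P.n)
  calc (P.g - 1) ^ 4 = (Nat.sqrt (Nat.sqrt P.n) ^ 2) ^ 2 := by
        rw [← pow_mul]; rfl
    _ ≤ (Nat.sqrt P.n) ^ 2 := Nat.pow_le_pow_left h2 2
    _ ≤ P.n := h1

/-- With q = n^(1/4), the sample parameter `g` lies between q and 2q. So n/g ≤ q³ governs the
searches, while the quadratic cost of the broadcast is only of order q², up to the slack `t`. -/
theorem rounds_le {P : Params} {F q : ℝ} (hq : 1 ≤ q) (hq4 : q ^ 4 = P.n) (hqF : q ^ 3 ≤ F)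
    (hE : (P.E : ℝ) ≤ F) (hI : 1 ≤ P.I) (ht : 1 ≤ P.t) :
    (P.rounds : ℝ) ≤ 10000 * P.I ^ 4 * P.t ^ 2 * F := by
  have hI' : (1 : ℝ) ≤ P.I := by exact_mod_cast hI
  have ht' : (1 : ℝ) ≤ P.t := by exact_mod_cast ht
  have hq0 : (0 : ℝ) < q := by linarith
  have hq3 : (1 : ℝ) ≤ q ^ 3 := one_le_pow₀ hq
  have hF : 1 ≤ F := hq3.trans hqF
  have hg : (P.g : ℝ) ≤ 2 * q := by
    have h1 : ((P.g - 1 : ℕ) : ℝ) ^ 4 ≤ q ^ 4 := by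
      rw [hq4]; exact_mod_cast params_g_pow_le P
    have h2 := le_of_pow_le_pow_left₀ (by norm_num) hq0.le h1
    have hg0 : 0 < P.g := Nat.succ_pos _
    rw [Nat.cast_pred hg0] at h2
    linarith
  have hg' : q ≤ P.g := by
    refine le_of_pow_le_pow_left₀ (n := 4) (by norm_num) (Nat.cast_nonneg _) ?_
    rw [hq4]
    exact_mod_cast (lt_params_g_pow P).le
  have hdiv : ((P.n / P.g : ℕ) : ℝ) ≤ q ^ 3 := by
    refine Nat.cast_div_le.trans ?_
    rw [div_le_iff₀ (by linarith), ← hq4, pow_succ]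
    exact mul_le_mul_of_nonneg_left hg' (by positivity)
  have hh : (P.h : ℝ) ≤ 2 * F * P.t := by
    have h1 : (P.h : ℝ) ≤ ((P.n / P.g : ℕ) + 1) * P.t := by
      exact_mod_cast min_le_left _ _
    refine h1.trans (mul_le_mul_of_nonneg_right ?_ (by positivity))
    linarith
  have hA : (P.A : ℝ) ≤ 4 * F * P.I * P.t := by
    have h1 : (P.A : ℝ) = 2 * P.I * P.h := by unfold Params.A; push_cast; ring
    rw [h1]
    nlinarith
  have hK : (P.K : ℝ) ≤ 12 * F * P.I * P.t := by
    have h1 : (P.K : ℝ) = 2 * P.A + P.h + 2 * P.E := by unfold Params.K; push_cast; ring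
    have h2 : F ≤ F * P.t := le_mul_of_one_le_right (by linarith) ht'
    have h3 : F * P.t ≤ F * P.t * P.I := le_mul_of_one_le_right (by positivity) hI'
    rw [h1]
    nlinarith
  have hm : ((P.m : ℝ) + 1) ^ 2 ≤ 49 * F * P.t ^ 2 := by
    have h1 : (P.m : ℝ) = 2 * P.g + 2 * P.t := by unfold Params.m; push_cast; ring
    have h2 : (P.m : ℝ) + 1 ≤ 7 * (q * P.t) := by
      have h3 : q ≤ q * P.t := le_mul_of_one_le_right hq0.le ht'
      have h4 : (P.t : ℝ) ≤ q * P.t := le_mul_of_one_le_left (by linarith) hq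
      rw [h1]
      linarith
    calc ((P.m : ℝ) + 1) ^ 2 ≤ (7 * (q * P.t)) ^ 2 := pow_le_pow_left₀ (by positivity) h2 2
      _ = 49 * q ^ 2 * P.t ^ 2 := by ring
      _ ≤ 49 * F * P.t ^ 2 := by
        have : q ^ 2 ≤ q ^ 3 := pow_le_pow_right₀ hq (by norm_num)
        gcongr
        linarith
  have hR : (P.R : ℝ) ≤ 62 * F * P.I * P.t ^ 2 := by
    have h1 : (P.R : ℝ) = P.K + (P.m + 1) ^ 2 + 1 := by unfold Params.R; push_cast; ring
    have h2 : F * P.I * P.t ≤ F * P.I * P.t ^ 2 := by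
      rw [pow_two, ← mul_assoc]
      exact le_mul_of_one_le_right (by positivity) ht'
    have h3 : F * P.t ^ 2 ≤ F * P.t ^ 2 * P.I := le_mul_of_one_le_right (by positivity) hI'
    have h4 : (1 : ℝ) ≤ F * P.t ^ 2 := one_le_mul_of_one_le_of_one_le hF (one_le_pow₀ ht')
    rw [h1]
    nlinarith
  have hT : (P.rounds : ℝ) =
      3 * P.E + 3 + 8 * (P.I + 1) ^ 2 * (P.I + 4) * P.R := by
    unfold Params.rounds Params.J; push_cast; ring
  have hI3 : 8 * ((P.I : ℝ) + 1) ^ 2 * (P.I + 4) ≤ 160 * P.I ^ 3 := by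
    calc 8 * ((P.I : ℝ) + 1) ^ 2 * (P.I + 4) ≤ 8 * (2 * P.I) ^ 2 * (5 * P.I) := by
          gcongr <;> linarith
      _ = _ := by ring
  have h1 : 8 * ((P.I : ℝ) + 1) ^ 2 * (P.I + 4) * P.R ≤
      160 * P.I ^ 3 * (62 * F * P.I * P.t ^ 2) :=
    mul_le_mul hI3 hR (Nat.cast_nonneg _) (by positivity)
  have h2 : F ≤ F * (P.I ^ 4 * P.t ^ 2) :=
    le_mul_of_one_le_right (by linarith)
      (one_le_mul_of_one_le_of_one_le (one_le_pow₀ hI') (one_le_pow₀ ht'))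
  rw [hT]
  nlinarith

/-- From 2^(clog − 1) < n one gets clog · log 2 ≤ 2 log n, and 2/log 2 < 3. -/
theorem clog_le_three_mul_log {n : ℕ} (hn : 2 ≤ n) : (Nat.clog 2 n : ℝ) ≤ 3 * Real.log n := by
  have h1 : 2 ^ (Nat.clog 2 n - 1) < n := Nat.pow_pred_clog_lt_self one_lt_two hn
  have h2 : (2 : ℝ) ^ (Nat.clog 2 n - 1) ≤ n := by exact_mod_cast h1.le
  have h3 := Real.log_le_log (by positivity) h2
  have h4 : Real.log 2 ≤ Real.log n := Real.log_le_log two_pos (by exact_mod_cast hn)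
  have h5 : 1 ≤ Nat.clog 2 n := Nat.clog_pos one_lt_two hn
  rw [Real.log_pow, Nat.cast_sub h5] at h3
  have h6 := Real.log_two_gt_d9
  push_cast at h3
  nlinarith

theorem rounds_le_log (hV : N.Valid a b) (hn : 2 ≤ N.size) (hτ : 1 ≤ τ) :
    ((N.params a b τ).rounds : ℝ) ≤ 10000 * ((a + 1) * 3) ^ 4 * (τ * 3) ^ 2 *
      ((N.size : ℝ) ^ (3 / 4 : ℝ) * (N.hopDiam : ℝ) ^ (1 / 4 : ℝ)) * Real.log N.size ^ 6 := by
  have hE1 := Network.one_le_ecc hV.connected hn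
  have hED := Network.ecc_le_hopDiam hV.connected
  have hEn := (Network.ecc_lt_size hV.connected).le
  have hD : (1 : ℝ) ≤ N.hopDiam := by exact_mod_cast hE1.trans hED
  have hn1 : (1 : ℝ) ≤ N.size := by exact_mod_cast (show 1 ≤ N.size by omega)
  have hlog := clog_le_three_mul_log hn
  have hq4 : ((N.size : ℝ) ^ (1 / 4 : ℝ)) ^ 4 = N.size := by
    rw [← Real.rpow_natCast, ← Real.rpow_mul (by positivity)]
    norm_num
  have hq3 : ((N.size : ℝ) ^ (1 / 4 : ℝ)) ^ 3 = (N.size : ℝ) ^ (3 / 4 : ℝ) := by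
    rw [← Real.rpow_natCast, ← Real.rpow_mul (by positivity)]
    norm_num
  have hD1 : (1 : ℝ) ≤ (N.hopDiam : ℝ) ^ (1 / 4 : ℝ) := Real.one_le_rpow hD (by norm_num)
  have hE : (N.ecc : ℝ) ≤ (N.size : ℝ) ^ (3 / 4 : ℝ) * (N.hopDiam : ℝ) ^ (1 / 4 : ℝ) := by
    have hE0 : (0 : ℝ) < N.ecc := by exact_mod_cast hE1
    -- The eccentricity is split so that one factor is bounded through n and the other through the
    -- diameter.
    calc (N.ecc : ℝ) = (N.ecc : ℝ) ^ (3 / 4 : ℝ) * (N.ecc : ℝ) ^ (1 / 4 : ℝ) := by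
          rw [← Real.rpow_add hE0]
          norm_num
      _ ≤ _ := by gcongr
  have key := rounds_le (P := N.params a b τ) (Real.one_le_rpow hn1 (by norm_num)) hq4
    (hq3.le.trans (le_mul_of_one_le_right (by positivity) hD1)) hE (params_I_pos hn)
    (Nat.mul_pos hτ (Nat.clog_pos one_lt_two hn))
  refine key.trans ?_
  have hI : ((N.params a b τ).I : ℝ) ≤ (a + 1) * 3 * Real.log N.size := by
    have : ((N.params a b τ).I : ℝ) = (a + 1) * Nat.clog 2 N.size := by
      change (((a + 1) * Nat.clog 2 N.size : ℕ) : ℝ) = _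
      push_cast
      ring
    rw [this, mul_assoc]
    gcongr
  have ht : ((N.params a b τ).t : ℝ) ≤ τ * 3 * Real.log N.size := by
    have : ((N.params a b τ).t : ℝ) = τ * Nat.clog 2 N.size := Nat.cast_mul _ _
    rw [this, mul_assoc]
    gcongr
  have h1 := pow_le_pow_left₀ (Nat.cast_nonneg _) hI 4
  have h2 := pow_le_pow_left₀ (Nat.cast_nonneg _) ht 2
  generalize hF : (N.size : ℝ) ^ (3 / 4 : ℝ) * (N.hopDiam : ℝ) ^ (1 / 4 : ℝ) = F
  have hF0 : 0 ≤ F := by rw [← hF]; positivity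
  calc 10000 * ((N.params a b τ).I : ℝ) ^ 4 * ((N.params a b τ).t : ℝ) ^ 2 * F
      ≤ 10000 * ((a + 1) * 3 * Real.log N.size) ^ 4 * (τ * 3 * Real.log N.size) ^ 2 * F := by
        gcongr
    _ = _ := by ring

theorem bandwidthAtMost_of_subsingleton {A : Algorithm} (hn : N.size ≤ 1) (L : ℕ) :
    A.BandwidthAtMost N L := by
  intro r σ _ u v h
  have : Subsingleton N.ids := Finset.card_le_one_iff_subsingleton_coe.mp hn
  exact absurd (Subsingleton.elim u v) h.ne

end Bounds
end Congest

theorem theorem1 :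
    ∃ k : ℕ, ∀ a b : ℕ, ∃ B : ℕ, ∀ c : ℕ, ∃ (A : Congest.Algorithm) (C : ℝ),
      ∀ N : Congest.Network, N.Valid a b →
        A.BandwidthAtMost N (B * Nat.clog 2 N.size) ∧
        ∃ T : ℕ,
          (T : ℝ) ≤ C * ((N.size : ℝ) ^ (3 / 4 : ℝ) * (N.hopDiam : ℝ) ^ (1 / 4 : ℝ)) *
            Real.log N.size ^ k ∧
          1 - 1 / (N.size : ℝ≥0∞) ^ c ≤ A.successProb N T := by
  refine ⟨6, fun a b => ⟨8 * (4 * a + 4 * b + 27), fun c =>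
    ⟨Congest.ssspAlgorithm a b (c + 2 * a + 10),
      10000 * ((a + 1) * 3) ^ 4 * ((c + 2 * a + 10 : ℕ) * 3) ^ 2, fun N hV => ?_⟩⟩⟩
  have hpos : 1 ≤ N.size := Finset.card_pos.mpr ⟨N.source, N.source.2⟩
  -- For a single vertex the bound contains log 1 = 0, so T = 0 is forced; but then the required
  -- probability is 1 − 1 = 0, and there are no edges.
  rcases hpos.eq_or_lt with hn | hn
  · refine ⟨Congest.bandwidthAtMost_of_subsingleton hn.ge _, 0, ?_, ?_⟩
    · rw [← hn]
      simp
    · rw [← hn]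
      simp
  · exact ⟨Congest.bandwidth_le hV hn, _, Congest.rounds_le_log hV hn (by omega),
      le_trans (tsub_le_tsub_left (Congest.failure_le hn c le_rfl) _)
        (Congest.successProb_le hV hn (by omega))⟩
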